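/- Let $U$ be a coordinate domain of an oriented four-dimensional spacetime with smooth metric $g$ of signature $(-,+,+,+)$, and let $u$ be a smooth time-like vector field on $U$ with $u^2=-1$. Write $(x,y)=g(x,y)$, $x^2=(x,x)$, identify vectors with 1-forms through $g$, let $*$ be the Hodge dual, $i(x)$ the interior product, and put $$a=i(u)\nabla u,\quad \theta=\nabla\cdot u,\quad w=*(u\wedge du),\quad v=*(a\wedge da),\quad b=-u+\tfrac1{a^2}\,i(a)du,\quad c=\tfrac1{a^2}\,i(a)da,$$ $$c_u=-(c,u),\quad c_b=\tfrac{(c,b)}{b^2},\quad \Omega=\theta-c_u,\quad \nu=\Omega+2c_b,$$ and, for a function $f$, $$\dot f=u(f),\quad f^*=\tfrac{(df,a)}{a^2},\quad \tilde f=\tfrac{(df,b)}{b^2},\quad \hat f=\tfrac{(df,w)}{w^2}.$$ Assume that, everywhere on $U$, $a\neq0$, $w\neq0$, $(a,w)=(c,w)=0$, $v=0$, $\tilde c_b=\tilde\Omega=0$ (where $\tilde c_b$ is the derivative $\tilde f$ of $f=c_b$) and $\varphi_1:=\nu^*+2(\theta+c_b-2c_u)=0$. A perfect energy tensor with velocity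 $u$ on an open set $V$ is a tensor $T=(\rho+p)\,u\otimes u+p\,g$ with smooth functions $\rho,p$ on $V$ such that $\rho+p\neq0$ everywhere on $V$ and $\nabla\cdot T=0$. Then: (i) Every point of $U$ has an open neighbourhood on which $u$ is the velocity of a perfect energy tensor if, and only if, $\hat\Omega=0$ and $2\Omega c_b+\dot\Omega=0$ on $U$. (ii) If $\hat\Omega=0$ and $2\Omega c_b+\dot\Omega=0$ on $U$, then every point of $U$ has arbitrarily small open neighbourhoods $V$ on which there are smooth independent functions $\tau,\alpha,\mu$ and a smooth function $\beta=\beta(\tau,\alpha,\mu)$ such that $$u=-d\tau+\mu\,d\alpha,\qquad a=\beta\,d\alpha,$$ such that $\nu$, $\Omega$ and $\beta-\mu c_b$ are smooth functions of $(\tau,\alpha)$ on $V$, and such that the pairs $(\rho,p)$ which define a perfect energy tensor with velocity $u$ on $V$ are exactly those given by $$p=p(\tau,\alpha),\qquad \rho=-p-\beta^{-1}\left[\mu\,p_{,\tau}+p_{,\alpha}\right],$$ with $\rho+p\neq0$ everywhere on $V$, where $p(\tau,\alpha)$ is any smooth solution of the second-order system $$p_{,\tau\tau}+\nu\,p_{,\tau}=0,\qquad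 p_{,\tau\alpha}+\Omega\,p_{,\alpha}+2(\beta-\mu c_b)\,p_{,\tau}=0.$$ -/

import Mathlib

open scoped ContDiff

/-!
 Tensor calculus in the coordinates of an oriented coordinate domain of a four-dimensional
 spacetime.  Points are `Fin 4 → ℝ`.  A scalar is a function of the point, a 1-form, a vector
 field, a 2-form, a 3-form, a metric are the functions giving their components.
-/

namespace Kin

noncomputable section

/-- Points of the coordinate domain. -/
abbrev Pt : Type := Fin 4 → ℝ

/-- Components of a vector field (contravariant), or of a 1-form (covariant). -/
abbrev VField : Type := Pt → Fin 4 → ℝ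

/-- Components of a 1-form. -/
abbrev Form1 : Type := Pt → Fin 4 → ℝ

/-- Covariant components of a 2-form. -/
abbrev Form2 : Type := Pt → Fin 4 → Fin 4 → ℝ

/-- Covariant components of a 3-form. -/
abbrev Form3 : Type := Pt → Fin 4 → Fin 4 → Fin 4 → ℝ

/-- Components `g_ij` of a metric. -/
abbrev Metric : Type := Pt → Matrix (Fin 4) (Fin 4) ℝ

/-- The partial derivative `∂_i f`. -/
def pd (i : Fin 4) (f : Pt → ℝ) (x : Pt) : ℝ := fderiv ℝ f x (Pi.single i 1)

/-- The differential `df` of a scalar. -/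
def dS (f : Pt → ℝ) : Form1 := fun x i => pd i f x

/-- `g` is a smooth Lorentzian metric, of signature `(-,+,+,+)`, on `U`. -/
structure IsLorentzMetric (U : Set Pt) (g : Metric) : Prop where
  smooth : ∀ i j, ContDiffOn ℝ ∞ (fun x => g x i j) U
  symm : ∀ x ∈ U, ∀ i j, g x i j = g x j i
  signature : ∀ x ∈ U, ∃ A : Matrix (Fin 4) (Fin 4) ℝ, IsUnit A.det ∧
    g x = A.transpose * Matrix.diagonal ![-1, 1, 1, 1] * A

/-- The contravariant components `g^ij`. -/
def ginv (g : Metric) (x : Pt) (i j : Fin 4) : ℝ := (g x)⁻¹ i j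

/-- The Christoffel symbol `Γ^k_ij` of the Levi-Civita connection. -/
def christoffel (g : Metric) (k i j : Fin 4) (x : Pt) : ℝ :=
  (1 / 2) * ∑ l, ginv g x k l *
    (pd i (fun y => g y l j) x + pd j (fun y => g y l i) x - pd l (fun y => g y i j) x)

/-- Lowering the index of a vector field. -/
def flat (g : Metric) (X : VField) : Form1 := fun x i => ∑ j, g x i j * X x j

/-- Raising the index of a 1-form. -/
def sharp (g : Metric) (s : Form1) : VField := fun x i => ∑ j, ginv g x i j * s x j

/-- The metric product `(s, t)` of two 1-forms (equivalently, of the associated vectors). -/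
def ip (g : Metric) (s t : Form1) (x : Pt) : ℝ := ∑ i, ∑ j, ginv g x i j * s x i * t x j

/-- The exterior derivative of a 1-form. -/
def d1 (s : Form1) : Form2 :=
  fun x i j => pd i (fun y => s y j) x - pd j (fun y => s y i) x

/-- The exterior product of a 1-form and a 2-form. -/
def wedge12 (s : Form1) (F : Form2) : Form3 :=
  fun x i j k => s x i * F x j k + s x j * F x k i + s x k * F x i j

/-- The interior product of a vector field with a 2-form (contraction of the first slot). -/
def interior (X : VField) (F : Form2) : Form1 := fun x j => ∑ i, X x i * F x i j

/-- The Levi-Civita symbol: the sign of `(i, j, k, l)` if it is a permutation, else zero. -/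
def levi (i j k l : Fin 4) : ℝ :=
  (Matrix.of fun r s : Fin 4 => if ![i, j, k, l] r = s then (1 : ℝ) else 0).det

/-- The Hodge dual of a 3-form, `(*T)_l = (1/3!) η_ijkl T^ijk`, where `η = √|det g| ε` is the
metric volume element of the coordinate orientation. -/
def hodge3 (g : Metric) (T : Form3) : Form1 := fun x l =>
  (1 / 6) * ∑ i, ∑ j, ∑ k, Real.sqrt |(g x).det| * levi i j k l *
    ∑ i', ∑ j', ∑ k', ginv g x i i' * ginv g x j j' * ginv g x k k' * T x i' j' k'

/-! The concomitants of a vector field `u`, as scalars and 1-forms. -/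

/-- The acceleration `a = i(u)∇u`, as a vector field. -/
def accV (g : Metric) (u : VField) : VField := fun x k =>
  ∑ i, u x i * (pd i (fun y => u y k) x + ∑ j, christoffel g k i j x * u x j)

/-- The acceleration as a 1-form. -/
def acc (g : Metric) (u : VField) : Form1 := flat g (accV g u)

/-- The expansion `θ = ∇·u`. -/
def expansion (g : Metric) (u : VField) (x : Pt) : ℝ :=
  ∑ i, (pd i (fun y => u y i) x + ∑ j, christoffel g i i j x * u x j)

/-- The rotation vector `w = *(u ∧ du)`. -/
def rot (g : Metric) (u : VField) : Form1 :=
  hodge3 g (wedge12 (flat g u) (d1 (flat g u)))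

/-- The rotation vector `v = *(a ∧ da)` of the acceleration. -/
def accRot (g : Metric) (u : VField) : Form1 :=
  hodge3 g (wedge12 (acc g u) (d1 (acc g u)))

/-- `b = -u + a⁻² i(a)du`. -/
def bForm (g : Metric) (u : VField) : Form1 := fun x i =>
  - flat g u x i +
    (1 / ip g (acc g u) (acc g u) x) * interior (accV g u) (d1 (flat g u)) x i

/-- `c = a⁻² i(a)da`. -/
def cForm (g : Metric) (u : VField) : Form1 := fun x i =>
  (1 / ip g (acc g u) (acc g u) x) * interior (accV g u) (d1 (acc g u)) x i

/-- The component `c_u = -(c,u)`. -/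
def cu (g : Metric) (u : VField) (x : Pt) : ℝ := - ip g (cForm g u) (flat g u) x

/-- The component `c_b = (c,b)/b²`. -/
def cb (g : Metric) (u : VField) (x : Pt) : ℝ :=
  ip g (cForm g u) (bForm g u) x / ip g (bForm g u) (bForm g u) x

/-- `φ̇ = u(φ)`. -/
def dotD (u : VField) (f : Pt → ℝ) (x : Pt) : ℝ := ∑ i, u x i * pd i f x

/-- `φ^* = (dφ, a)/a²`. -/
def starD (g : Metric) (u : VField) (f : Pt → ℝ) (x : Pt) : ℝ :=
  ip g (dS f) (acc g u) x / ip g (acc g u) (acc g u) x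

/-- `φ̃ = (dφ, b)/b²`. -/
def tildeD (g : Metric) (u : VField) (f : Pt → ℝ) (x : Pt) : ℝ :=
  ip g (dS f) (bForm g u) x / ip g (bForm g u) (bForm g u) x

/-- `φ̂ = (dφ, w)/w²`. -/
def hatD (g : Metric) (u : VField) (f : Pt → ℝ) (x : Pt) : ℝ :=
  ip g (dS f) (rot g u) x / ip g (rot g u) (rot g u) x

/-- `Ω = θ - c_u`. -/
def Om (g : Metric) (u : VField) (x : Pt) : ℝ := expansion g u x - cu g u x

/-- `ν = Ω + 2 c_b`. -/
def nu (g : Metric) (u : VField) (x : Pt) : ℝ := Om g u x + 2 * cb g u x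

/-- `φ₁ = ν^* + 2 (θ + c_b - 2 c_u)`. -/
def varphi1 (g : Metric) (u : VField) (x : Pt) : ℝ :=
  starD g u (nu g u) x + 2 * (expansion g u x + cb g u x - 2 * cu g u x)

/-- `u` is a smooth unit time-like vector field on `U`. -/
structure IsUnitTimelike (U : Set Pt) (g : Metric) (u : VField) : Prop where
  smooth : ∀ i, ContDiffOn ℝ ∞ (fun x => u x i) U
  unit : ∀ x ∈ U, ∑ i, ∑ j, g x i j * u x i * u x j = -1

/-- The class under consideration: non-geodesic, rotating, `(a,w) = (c,w) = 0`, `v = 0`,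
`c̃_b = Ω̃ = 0` and `φ₁ = 0`, at every point of `U`. -/
structure IsFlowClass (U : Set Pt) (g : Metric) (u : VField) : Prop where
  nongeodesic : ∀ x ∈ U, acc g u x ≠ 0
  rotating : ∀ x ∈ U, rot g u x ≠ 0
  acc_rot : ∀ x ∈ U, ip g (acc g u) (rot g u) x = 0
  c_rot : ∀ x ∈ U, ip g (cForm g u) (rot g u) x = 0
  accRot_zero : ∀ x ∈ U, accRot g u x = 0
  tilde_cb : ∀ x ∈ U, tildeD g u (cb g u) x = 0
  tilde_Om : ∀ x ∈ U, tildeD g u (Om g u) x = 0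
  varphi1_zero : ∀ x ∈ U, varphi1 g u x = 0

/-- The energy tensor `T = (ρ + p) u ⊗ u + p g`, contravariant components. -/
def energyTensor (g : Metric) (u : VField) (rho p : Pt → ℝ) (i j : Fin 4) (x : Pt) : ℝ :=
  (rho x + p x) * u x i * u x j + p x * ginv g x i j

/-- The divergence `∇_i T^ij` of a contravariant 2-tensor. -/
def divT (g : Metric) (T : Fin 4 → Fin 4 → Pt → ℝ) (x : Pt) (j : Fin 4) : ℝ :=
  ∑ i, (pd i (T i j) x +
    ∑ k, (christoffel g i i k x * T k j x + christoffel g j i k x * T i k x))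

/-- `{u, ρ, p}` is a perfect energy tensor on `V`: divergence-free, with `ρ + p ≠ 0`. -/
structure IsPerfect (V : Set Pt) (g : Metric) (u : VField) (rho p : Pt → ℝ) : Prop where
  smooth_rho : ContDiffOn ℝ ∞ rho V
  smooth_p : ContDiffOn ℝ ∞ p V
  nonzero : ∀ x ∈ V, rho x + p x ≠ 0
  conserved : ∀ x ∈ V, divT g (energyTensor g u rho p) x = 0

/-- `u` is the velocity of a perfect energy tensor, locally about every point of `U`. -/
def IsPerfectVelocity (U : Set Pt) (g : Metric) (u : VField) : Prop :=
  ∀ x ∈ U, ∃ V : Set Pt, IsOpen V ∧ x ∈ V ∧ V ⊆ U ∧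
    ∃ rho p : Pt → ℝ, IsPerfect V g u rho p

/-! Functions of the two variables `(τ, α)`. -/

/-- Partial derivative with respect to the first variable, `τ`. -/
def dTau (P : ℝ × ℝ → ℝ) (q : ℝ × ℝ) : ℝ := fderiv ℝ P q (1, 0)

/-- Partial derivative with respect to the second variable, `α`. -/
def dAlpha (P : ℝ × ℝ → ℝ) (q : ℝ × ℝ) : ℝ := fderiv ℝ P q (0, 1)

/-- `f = F(τ, α)` on `V`, with `F` smooth on the set of values of `(τ, α)`. -/
def RepresentedBy (V : Set Pt) (tau alpha f : Pt → ℝ) (F : ℝ × ℝ → ℝ) : Prop :=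
  ContDiffOn ℝ ∞ F ((fun x => (tau x, alpha x)) '' V) ∧ ∀ x ∈ V, f x = F (tau x, alpha x)

/-- `τ, α, μ` are independent functions on `V` and `β = B(τ, α, μ)` is a function of them such
that `u = -dτ + μ dα` and `a = β dα`. -/
structure IsAdapted (V : Set Pt) (g : Metric) (u : VField)
    (tau alpha mu beta : Pt → ℝ) : Prop where
  smooth_tau : ContDiffOn ℝ ∞ tau V
  smooth_alpha : ContDiffOn ℝ ∞ alpha V
  smooth_mu : ContDiffOn ℝ ∞ mu V
  indep : ∀ x ∈ V, LinearIndependent ℝ ![dS tau x, dS alpha x, dS mu x]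
  beta_fun : ∃ B : ℝ × ℝ × ℝ → ℝ,
    ContDiffOn ℝ ∞ B ((fun x => (tau x, alpha x, mu x)) '' V) ∧
    ∀ x ∈ V, beta x = B (tau x, alpha x, mu x)
  u_eq : ∀ x ∈ V, flat g u x = - dS tau x + mu x • dS alpha x
  a_eq : ∀ x ∈ V, acc g u x = beta x • dS alpha x

/-- The system `P_ττ + ν P_τ = 0`, `P_τα + Ω P_α + 2 (β - μ c_b) P_τ = 0` on `V`. -/
def SolvesSystem (V : Set Pt) (g : Metric) (u : VField) (tau alpha mu beta : Pt → ℝ)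
    (P : ℝ × ℝ → ℝ) : Prop :=
  ∀ x ∈ V,
    dTau (dTau P) (tau x, alpha x) + nu g u x * dTau P (tau x, alpha x) = 0 ∧
    dAlpha (dTau P) (tau x, alpha x) + Om g u x * dAlpha P (tau x, alpha x) +
      2 * (beta x - mu x * cb g u x) * dTau P (tau x, alpha x) = 0

end

end Kin

/-!
The hypotheses provide, at each point, an orthogonal frame of 1-forms `u, a, b, w` in which
`du = a ∧ (u + b)` and `da = a ∧ c`, `c = c_u u + c_b b` (`adaptedFrame`): since `i(u)du = a`, the
condition `(a, w) = 0` says that `a ∧ du = 0`, and `v = 0` says that `a ∧ da = 0`.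

Conservation of `T = (ρ + p) u ⊗ u + p g` amounts to `dp = -f u + h a` and `ḣ + θ h + f = 0`,
where `f = ṗ` and `h = -(ρ + p)` (`divT_eq_zero_iff`). Applying `d` to `dp` and contracting with
the frame (`integrability`) gives `f~ = f^ = h^ = 0`, `h~ = c_b h - f` and `f^* + f = ḣ + c_u h`,
so that `df = -ḟ u + H a` with `H = -2 f - Ω h`. This equation has the same form, and its own
integrability conditions are `ḟ = -ν f`, `Ω^ h = 0` and `φ₁ f = (2 Ω c_b + Ω̇) h`. As `φ₁ = 0` and
`h ≠ 0`, the two conditions on `Ω` are necessary (`IsPerfect.conditions`).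

The structure equations of `u` and `a` also make the Frobenius theorem available: locally
`u = -dτ + μ dα` and `a = β dα` (`exists_frobenius_potentials`). It is proved here from smooth
dependence of solutions of differential equations on the data (`exists_radial_solution`), which is
in turn the inverse function theorem in the Banach space of continuous curves. Expanding `dμ` and
`dβ` in the frame shows that `τ, α, μ` are independent and that `ĉ_b = 0`; completing them by a
fourth coordinate, one obtains cubical charts (`FlowChart`) in which a function with `f~ = f^ = 0`
is a function of `(τ, α)`. This applies to `p`, `Ω`, `ν` and `σ = β - μ c_b`, and the equations
for `f` found above become the system for `p(τ, α)` (`FlowChart.isPerfect_iff`).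

Conversely, the conditions on `Ω` together with `φ₁ = 0` become `Ω_τ = -(ν - Ω) Ω` and
`2 σ_τ = ν_α + 2 σ Ω` in the plane of `(τ, α)`. These are the compatibility conditions of the
system. One solves `p_τ = f`, `f_τ = -ν f` in the direction of `τ`, with data on the line `τ = τ₀`
chosen so that the second equation holds there; the compatibility conditions imply that its left
side satisfies a linear homogeneous equation in `τ`, hence vanishes (`exists_plane_solution`).
With `p = α - α₀` on that line, `ρ + p` does not vanish near the given point.
-/

namespace Kin

/-! ### Composition operators on spaces of continuous curves -/

section CompositionOperator

open Filter Topology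

variable {K E F : Type} [TopologicalSpace K] [CompactSpace K]
  [NormedAddCommGroup E] [NormedSpace ℝ E] [NormedAddCommGroup F] [NormedSpace ℝ F]

/-- Pointwise application of a continuous family of continuous linear maps to a continuous
function, as a continuous bilinear map. -/
noncomputable def applyFamily : C(K, E →L[ℝ] F) →L[ℝ] C(K, E) →L[ℝ] C(K, F) :=
  LinearMap.mkContinuous₂
    (LinearMap.mk₂ ℝ
      (fun (L : C(K, E →L[ℝ] F)) (f : C(K, E)) =>
        (⟨fun s => L s (f s), L.continuous.clm_apply f.continuous⟩ : C(K, F)))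
      (fun _ _ _ => by ext; simp) (fun _ _ _ => by ext; simp)
      (fun _ _ _ => by ext; simp) (fun _ _ _ => by ext; simp))
    1 (fun L f => by
      rw [ContinuousMap.norm_le _ (by positivity)]
      intro s
      simp only [LinearMap.mk₂_apply, ContinuousMap.coe_mk, one_mul]
      exact (ContinuousLinearMap.le_opNorm _ _).trans
        (mul_le_mul (L.norm_coe_le_norm s) (f.norm_coe_le_norm s) (by positivity)
          (by positivity)))

@[simp]
theorem applyFamily_apply (L : C(K, E →L[ℝ] F)) (f : C(K, E)) (s : K) :
    applyFamily L f s = L s (f s) := rfl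

/-- The composition operator `γ ↦ H ∘ γ` is differentiable on the space of continuous functions;
compactness of `K` makes the first order expansion of `H` uniform along `γ`. -/
theorem hasFDerivAt_comp_continuousMap (H : C(E, F)) (D : C(E, E →L[ℝ] F))
    (hD : ∀ x, HasFDerivAt H (D x) x) (γ : C(K, E)) :
    HasFDerivAt (fun γ : C(K, E) => H.comp γ) (applyFamily (D.comp γ)) γ := by
  rw [hasFDerivAt_iff_isLittleO]
  refine Asymptotics.isLittleO_iff.2 fun ε hε => ?_
  have hu := (isCompact_range γ.continuous).uniformContinuousAt_of_continuousAt D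
    (fun a _ => D.continuous.continuousAt) (Metric.dist_mem_uniformity hε)
  obtain ⟨δ, hδ, hsub⟩ := Metric.mem_uniformity_dist.1 hu
  filter_upwards [Metric.ball_mem_nhds γ hδ] with γ' hγ'
  rw [ContinuousMap.norm_le _ (by positivity)]
  intro s
  have hs : dist (γ' s) (γ s) < δ := (ContinuousMap.dist_apply_le_dist s).trans_lt hγ'
  have key : ‖H (γ' s) - H (γ s) - D (γ s) (γ' s - γ s)‖ ≤ ε * ‖γ' s - γ s‖ := by
    refine (convex_ball (γ s) δ).norm_image_sub_le_of_norm_hasFDerivWithin_le'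
      (f' := D) (fun x _ => (hD x).hasFDerivWithinAt) (fun x hx => ?_)
      (Metric.mem_ball_self hδ) (Metric.mem_ball.2 hs)
    have h1 : dist (γ s) x < δ := by rw [dist_comm]; exact hx
    have h2 := hsub h1
    simp only [Set.mem_ofPred_eq, Set.mem_range_self, forall_const] at h2
    rw [← dist_eq_norm, dist_comm]
    exact h2.le
  refine le_trans (by simpa using key) ?_
  gcongr
  simpa using (γ' - γ).norm_coe_le_norm s

/-- The derivative of `γ ↦ H ∘ γ` is built from the composition operator of `fderiv ℝ H`, so the
smoothness class can be raised by induction; the target space changes at each step. -/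
theorem contDiff_nat_comp_continuousMap (n : ℕ) :
    ∀ (F : Type) [NormedAddCommGroup F] [NormedSpace ℝ F] (H : C(E, F)), ContDiff ℝ ∞ H →
      ContDiff ℝ n (fun γ : C(K, E) => H.comp γ) := by
  induction n with
  | zero =>
    intro F _ _ H _
    exact contDiff_zero.2 (ContinuousMap.continuous_postcomp H)
  | succ n ih =>
    intro F _ _ H hH
    have h1 : ContDiff ℝ ∞ (fderiv ℝ H) := hH.fderiv_right (by simp)
    refine contDiff_succ_iff_hasFDerivAt.2
      ⟨fun γ => applyFamily ((⟨fderiv ℝ H, h1.continuous⟩ : C(E, E →L[ℝ] F)).comp γ), ?_, ?_⟩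
    · exact applyFamily.contDiff.comp (ih _ ⟨fderiv ℝ H, h1.continuous⟩ h1)
    · intro γ
      exact hasFDerivAt_comp_continuousMap H ⟨fderiv ℝ H, h1.continuous⟩
        (fun x => (hH.differentiable (by simp) x).hasFDerivAt) γ

theorem contDiff_comp_continuousMap (H : C(E, F)) (hH : ContDiff ℝ ∞ H) :
    ContDiff ℝ ∞ (fun γ : C(K, E) => H.comp γ) :=
  contDiff_infty.2 fun n => contDiff_nat_comp_continuousMap n F H hH

end CompositionOperator

/-! ### Differential equations along rays, with smooth dependence on the data -/

section RadialEquation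

open Filter Topology Set

/-- Integration from the left endpoint, as an operator on continuous functions on `[0, 1]`. -/
noncomputable def integrateCLM (E : Type) [NormedAddCommGroup E] [NormedSpace ℝ E] :
    C(Icc (0 : ℝ) 1, E) →L[ℝ] C(Icc (0 : ℝ) 1, E) :=
  LinearMap.mkContinuous
    { toFun := fun f =>
        ⟨fun r => ∫ s in (0 : ℝ)..r, IccExtend zero_le_one f s,
          (intervalIntegral.continuous_primitive
            (fun a b => (f.continuous.Icc_extend').intervalIntegrable a b) 0).comp
            continuous_subtype_val⟩
      map_add' := fun f f' => by
        ext r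
        simp only [ContinuousMap.coe_mk, ContinuousMap.add_apply]
        rw [← intervalIntegral.integral_add
          (f.continuous.Icc_extend'.intervalIntegrable _ _)
          (f'.continuous.Icc_extend'.intervalIntegrable _ _)]
        rfl
      map_smul' := fun c f => by
        ext r
        simp only [ContinuousMap.coe_mk, ContinuousMap.smul_apply, RingHom.id_apply]
        rw [← intervalIntegral.integral_smul]
        rfl }
    1 (fun f => by
      rw [ContinuousMap.norm_le _ (by positivity)]
      intro r
      have h := intervalIntegral.norm_integral_le_of_norm_le_const
        (f := IccExtend zero_le_one f) (a := 0) (b := (r : ℝ)) (C := ‖f‖)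
        (fun x _ => f.norm_coe_le_norm _)
      refine h.trans ?_
      rw [sub_zero, abs_of_nonneg r.2.1, one_mul]
      exact mul_le_of_le_one_right (norm_nonneg _) r.2.2)

theorem integrateCLM_apply {E : Type} [NormedAddCommGroup E] [NormedSpace ℝ E]
    (f : C(Icc (0 : ℝ) 1, E)) (r : Icc (0 : ℝ) 1) :
    integrateCLM E f r = ∫ s in (0 : ℝ)..r, IccExtend zero_le_one f s := rfl

/-- Multiplication by a bump function extends a smooth germ to the whole space. -/
theorem exists_contDiff_eqOn_ball {X F : Type} [NormedAddCommGroup X] [NormedSpace ℝ X]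
    [FiniteDimensional ℝ X] [NormedAddCommGroup F] [NormedSpace ℝ F] {f : X → F} {O : Set X}
    (hO : IsOpen O) {x₀ : X} (hx₀ : x₀ ∈ O) (hf : ContDiffOn ℝ ∞ f O) :
    ∃ f' : X → F, ContDiff ℝ ∞ f' ∧ ∃ ρ > 0, Metric.ball x₀ ρ ⊆ O ∧
      ∀ x ∈ Metric.ball x₀ ρ, f' x = f x := by
  obtain ⟨R, hR, hsub⟩ := Metric.isOpen_iff.1 hO x₀ hx₀
  let χ : ContDiffBump x₀ := ⟨R / 4, R / 2, by positivity, by linarith⟩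
  have hsupp : tsupport (fun x => χ x) ⊆ O := by
    have : tsupport (fun x => χ x) = Metric.closedBall x₀ (R / 2) := χ.tsupport_eq
    rw [this]
    exact (Metric.closedBall_subset_ball (by linarith)).trans hsub
  refine ⟨fun x => χ x • f x, ?_, R / 4, by positivity,
    (Metric.ball_subset_ball (by linarith)).trans hsub, fun x hx => ?_⟩
  · refine contDiff_iff_contDiffAt.2 fun x => ?_
    by_cases hx : x ∈ tsupport (fun x => χ x)
    · exact χ.contDiff.contDiffAt.smul (hf.contDiffAt (hO.mem_nhds (hsupp hx)))
    · refine (contDiffAt_const (c := (0 : F))).congr_of_eventuallyEq ?_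
      filter_upwards [notMem_tsupport_iff_eventuallyEq.1 hx] with y hy
      simp [hy]
  · have : χ x = 1 := χ.one_of_mem_closedBall (Metric.ball_subset_closedBall hx)
    simp [this]

/-- Inverse function theorem in the form of a smooth chart: the source can be taken inside the
open set on which the map is smooth, with a smooth inverse on the whole target. -/
theorem exists_smooth_chart {X Z : Type} [NormedAddCommGroup X] [NormedSpace ℝ X]
    [CompleteSpace X] [NormedAddCommGroup Z] [NormedSpace ℝ Z] {f : X → Z} {O : Set X}
    (hO : IsOpen O) {x₀ : X} (hx₀ : x₀ ∈ O) (hf : ContDiffOn ℝ ∞ f O) (f' : X ≃L[ℝ] Z)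
    (hf' : HasFDerivAt f (f' : X →L[ℝ] Z) x₀) :
    ∃ e : OpenPartialHomeomorph X Z, x₀ ∈ e.source ∧ e.source ⊆ O ∧ (⇑e = f) ∧
      ContDiffOn ℝ ∞ e.symm e.target := by
  have hfx : ContDiffAt ℝ ∞ f x₀ := hf.contDiffAt (hO.mem_nhds hx₀)
  let e₀ := hfx.toOpenPartialHomeomorph f hf' (by simp)
  have hcont : ContinuousOn (fderiv ℝ f) O := hf.continuousOn_fderiv_of_isOpen hO (by simp)
  let I : Set (X →L[ℝ] Z) := range ((↑) : (X ≃L[ℝ] Z) → X →L[ℝ] Z)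
  have hI : IsOpen I := ContinuousLinearEquiv.isOpen
  have hO' : IsOpen (O ∩ fderiv ℝ f ⁻¹' I) := hcont.isOpen_inter_preimage hO hI
  refine ⟨e₀.restrOpen _ hO', ⟨hfx.mem_toOpenPartialHomeomorph_source hf' (by simp), hx₀, ?_⟩,
    fun x hx => hx.2.1, rfl, fun z hz => ?_⟩
  · exact ⟨f', hf'.fderiv.symm⟩
  · set e := e₀.restrOpen _ hO' with he
    have hs : e.symm z ∈ e.source := e.map_target hz
    obtain ⟨L, hL⟩ : fderiv ℝ f (e.symm z) ∈ I := hs.2.2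
    have hzO : ContDiffAt ℝ ∞ f (e.symm z) := hf.contDiffAt (hO.mem_nhds hs.2.1)
    refine (e.contDiffAt_symm (f₀' := L) hz ?_ hzO).contDiffWithinAt
    rw [hL]
    exact (hzO.differentiableAt (by simp)).hasFDerivAt

variable {E Y : Type} [NormedAddCommGroup E] [NormedSpace ℝ E]
  [NormedAddCommGroup Y] [NormedSpace ℝ Y] [FiniteDimensional ℝ Y]

/-- The ray `s ↦ s • y`, depending linearly on `y`, together with the constant `y`. -/
noncomputable def rayCLM (E Y : Type) [NormedAddCommGroup E] [NormedSpace ℝ E]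
    [NormedAddCommGroup Y] [NormedSpace ℝ Y] [FiniteDimensional ℝ Y] :
    Y →L[ℝ] C(Icc (0 : ℝ) 1, E × Y × Y) :=
  LinearMap.toContinuousLinearMap
    { toFun := fun y => ⟨fun s => (0, (s : ℝ) • y, y), by fun_prop⟩
      map_add' := fun y y' => by ext s <;> simp
      map_smul' := fun c y => by
        ext s
        · simp
        · exact smul_comm (s : ℝ) c y
        · rfl }

@[simp]
theorem rayCLM_apply (y : Y) (s : Icc (0 : ℝ) 1) : rayCLM E Y y s = (0, (s : ℝ) • y, y) := rfl

/-- The lift of a curve `γ` in `E` to the curve `(γ s, s y, y)`. -/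
noncomputable def liftCLM (E Y : Type) [NormedAddCommGroup E] [NormedSpace ℝ E]
    [NormedAddCommGroup Y] [NormedSpace ℝ Y] [FiniteDimensional ℝ Y] :
    (E × Y) × C(Icc (0 : ℝ) 1, E) →L[ℝ] C(Icc (0 : ℝ) 1, E × Y × Y) :=
  ((ContinuousLinearMap.inl ℝ E (Y × Y)).compLeftContinuous ℝ (Icc (0 : ℝ) 1)).comp
      (ContinuousLinearMap.snd ℝ _ _) +
    (rayCLM E Y).comp ((ContinuousLinearMap.snd ℝ E Y).comp (ContinuousLinearMap.fst ℝ _ _))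

theorem liftCLM_apply (q : (E × Y) × C(Icc (0 : ℝ) 1, E)) (s : Icc (0 : ℝ) 1) :
    liftCLM E Y q s = (q.2 s, (s : ℝ) • q.1.2, q.1.2) := by
  simp [liftCLM]

/-- Constant curves, as a continuous linear map. -/
noncomputable def constCLM (E : Type) [NormedAddCommGroup E] [NormedSpace ℝ E]
    [FiniteDimensional ℝ E] : E →L[ℝ] C(Icc (0 : ℝ) 1, E) :=
  LinearMap.toContinuousLinearMap
    { toFun := fun e => ContinuousMap.const _ e
      map_add' := fun _ _ => rfl
      map_smul' := fun _ _ => rfl }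

@[simp]
theorem constCLM_apply [FiniteDimensional ℝ E] (e : E) (s : Icc (0 : ℝ) 1) :
    constCLM E e s = e := rfl

/-- Smooth dependence on data for the equation `S' = A (S, s y) y` along rays `s ↦ s y`: the value
`S (t, y)` at the end of the ray, with initial value `t` at the origin, is smooth in `(t, y)`, and
its radial derivative is `A (S, y) y`.  The curves are found by the inverse function theorem in
`C([0, 1], E)`, applied at the constant curve over the trivial ray. -/
theorem exists_radial_solution [FiniteDimensional ℝ E] {A : E × Y → Y →L[ℝ] E} {O : Set (E × Y)}
    (hO : IsOpen O) {e₀ : E} (h₀ : (e₀, (0 : Y)) ∈ O) (hA : ContDiffOn ℝ ∞ A O) :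
    ∃ δ > 0, ∃ S : E × Y → E, ContDiffOn ℝ ∞ S (Metric.ball (e₀, 0) δ) ∧
      (∀ t, (t, (0 : Y)) ∈ Metric.ball (e₀, (0 : Y)) δ → S (t, 0) = t) ∧
      ∀ p ∈ Metric.ball (e₀, (0 : Y)) δ, (S p, p.2) ∈ O ∧
        fderiv ℝ S p (0, p.2) = A (S p, p.2) p.2 := by
  obtain ⟨A', hA', ρ, hρ, hρO, hAA'⟩ := exists_contDiff_eqOn_ball hO h₀ hA
  let H : C(E × Y × Y, E) := ⟨fun z => A' (z.1, z.2.1) z.2.2, by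
    have := hA'.continuous; fun_prop⟩
  have hH : ContDiff ℝ ∞ H := by
    change ContDiff ℝ ∞ (fun z : E × Y × Y => A' (z.1, z.2.1) z.2.2)
    exact (hA'.comp (by fun_prop)).clm_apply (by fun_prop)
  -- The zeros of `Ψ₂` are the solutions of the integral equation along the ray.
  let Ψ₂ : (E × Y) × C(Icc (0 : ℝ) 1, E) → C(Icc (0 : ℝ) 1, E) := fun q =>
    q.2 - constCLM E q.1.1 - integrateCLM E (H.comp (liftCLM E Y q))
  have hΨ₂ : ContDiff ℝ ∞ Ψ₂ := by
    refine (contDiff_snd.sub ((constCLM E).contDiff.comp (contDiff_fst.comp contDiff_fst))).sub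
      ((integrateCLM E).contDiff.comp
        ((contDiff_comp_continuousMap H hH).comp (liftCLM E Y).contDiff))
  have hzero : ∀ t γ, Ψ₂ ((t, 0), γ) = γ - constCLM E t := by
    intro t γ
    have : H.comp (liftCLM E Y ((t, 0), γ)) = 0 := by
      ext s; simp [H, liftCLM_apply]
    simp only [Ψ₂, this, map_zero, sub_zero]
  let q₀ : (E × Y) × C(Icc (0 : ℝ) 1, E) := ((e₀, 0), constCLM E e₀)
  let D := fderiv ℝ Ψ₂ q₀
  have hD : HasFDerivAt Ψ₂ D q₀ := (hΨ₂.differentiable (by simp) q₀).hasFDerivAt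
  -- Over the trivial ray `Ψ₂` is a translation, so its derivative in `γ` is the identity.
  have hDinr : ∀ η, D (0, η) = η := by
    intro η
    have h1 : HasFDerivAt (fun γ => Ψ₂ ((e₀, 0), γ))
        (D.comp (ContinuousLinearMap.inr ℝ (E × Y) C(Icc (0 : ℝ) 1, E))) (constCLM E e₀) :=
      HasFDerivAt.comp (constCLM E e₀) hD (hasFDerivAt_prodMk_right _ _)
    have h2 : HasFDerivAt (fun γ => Ψ₂ ((e₀, 0), γ))
        (ContinuousLinearMap.id ℝ C(Icc (0 : ℝ) 1, E)) (constCLM E e₀) := by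
      simp only [hzero]
      exact (hasFDerivAt_id _).sub_const _
    have := congrArg (fun L => L η) (h1.unique h2)
    simpa using this
  let f' : ((E × Y) × C(Icc (0 : ℝ) 1, E)) ≃L[ℝ] (E × Y) × C(Icc (0 : ℝ) 1, E) :=
    (ContinuousLinearEquiv.refl ℝ (E × Y)).skewProd
      (ContinuousLinearEquiv.refl ℝ C(Icc (0 : ℝ) 1, E))
      (D.comp (ContinuousLinearMap.inl ℝ (E × Y) C(Icc (0 : ℝ) 1, E)))
  have hf' : HasFDerivAt (fun q => (q.1, Ψ₂ q)) (f' : _ →L[ℝ] _) q₀ := by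
    refine (hasFDerivAt_fst.prodMk hD).congr_fderiv ?_
    ext1
    · ext x <;> simp [f']
    · ext1 η
      simp [f', hDinr]
  obtain ⟨e, hqe, -, hef, hesymm⟩ := exists_smooth_chart isOpen_univ (mem_univ q₀)
    (contDiff_fst.prodMk hΨ₂).contDiffOn f' hf'
  have heq₀ : e q₀ = ((e₀, 0), 0) := by
    rw [hef]; simp only [q₀, hzero, sub_self]
  have htarget : ((e₀, 0), 0) ∈ e.target := heq₀ ▸ e.map_source hqe
  have hsymm₀ : e.symm ((e₀, 0), 0) = q₀ := by rw [← heq₀, e.left_inv hqe]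
  obtain ⟨r₁, hr₁, hsub⟩ := Metric.isOpen_iff.1 e.open_source q₀ hqe
  let r := min r₁ ρ
  have hr : 0 < r := lt_min hr₁ hρ
  have hcont : ContinuousAt (fun p : E × Y => e.symm (p, 0)) (e₀, 0) := by
    have h1 : ContinuousAt e.symm ((e₀, 0), 0) := e.continuousAt_symm htarget
    exact ContinuousAt.comp (f := fun p : E × Y => (p, (0 : C(Icc (0 : ℝ) 1, E)))) h1
      (by fun_prop)
  have hev : ∀ᶠ p in 𝓝 (e₀, (0 : Y)), (p, (0 : C(Icc (0 : ℝ) 1, E))) ∈ e.target ∧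
      e.symm (p, 0) ∈ Metric.ball q₀ r := by
    refine Filter.Eventually.and ?_ ?_
    · exact (show ContinuousAt (fun p : E × Y => (p, (0 : C(Icc (0 : ℝ) 1, E)))) (e₀, 0) by
        fun_prop).eventually (e.open_target.mem_nhds htarget)
    · exact hcont.eventually (by simp only [hsymm₀]; exact Metric.ball_mem_nhds _ hr)
  obtain ⟨δ₁, hδ₁, hball⟩ := Metric.eventually_nhds_iff_ball.1 hev
  let δ := min δ₁ r
  have hδ : 0 < δ := lt_min hδ₁ hr
  let γ : E × Y → C(Icc (0 : ℝ) 1, E) := fun p => (e.symm (p, 0)).2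
  have hB : ∀ p ∈ Metric.ball (e₀, (0 : Y)) δ, (p, (0 : C(Icc (0 : ℝ) 1, E))) ∈ e.target ∧
      e.symm (p, 0) ∈ Metric.ball q₀ r := fun p hp =>
    hball p (Metric.ball_subset_ball (min_le_left _ _) hp)
  have hfix : ∀ p ∈ Metric.ball (e₀, (0 : Y)) δ, e.symm (p, 0) = (p, γ p) ∧ Ψ₂ (p, γ p) = 0 := by
    intro p hp
    have h1 := e.right_inv (hB p hp).1
    rw [hef] at h1
    have h2 : (e.symm (p, 0)).1 = p := congrArg Prod.fst h1
    have h3 : e.symm (p, 0) = (p, γ p) := Prod.ext h2 rfl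
    exact ⟨h3, by rw [← h3]; exact congrArg Prod.snd h1⟩
  have hnear : ∀ p ∈ Metric.ball (e₀, (0 : Y)) δ, ∀ s, dist (γ p s) e₀ < r := by
    intro p hp s
    have h1 := (hB p hp).2
    rw [(hfix p hp).1] at h1
    have h2 : dist (γ p) (constCLM E e₀) < r := (le_max_right _ _).trans_lt h1
    exact (ContinuousMap.dist_apply_le_dist (g := constCLM E e₀) s).trans_lt h2
  have hint : ∀ p ∈ Metric.ball (e₀, (0 : Y)) δ, ∀ s : Icc (0 : ℝ) 1, γ p s = p.1 +
      ∫ x in (0 : ℝ)..s, IccExtend zero_le_one (H.comp (liftCLM E Y (p, γ p))) x := by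
    intro p hp s
    have h1 := congrArg (fun f : C(Icc (0 : ℝ) 1, E) => f s) (hfix p hp).2
    simp only [Ψ₂, ContinuousMap.sub_apply, integrateCLM_apply,
      ContinuousMap.zero_apply] at h1
    rw [sub_sub, sub_eq_zero] at h1
    exact h1
  have hsmall : ∀ p ∈ Metric.ball (e₀, (0 : Y)) δ, ∀ s ∈ Icc (0 : ℝ) 1,
      (p.1, s • p.2) ∈ Metric.ball (e₀, (0 : Y)) δ := by
    intro p hp s hs
    rw [Metric.mem_ball, Prod.dist_eq, max_lt_iff] at hp ⊢
    refine ⟨hp.1, lt_of_le_of_lt ?_ hp.2⟩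
    simp only [dist_zero_right, norm_smul, Real.norm_eq_abs, abs_of_nonneg hs.1]
    exact mul_le_of_le_one_left (norm_nonneg _) hs.2
  -- The curve over a shorter ray is the rescaled curve: both solve the same equation.
  have hscale : ∀ p ∈ Metric.ball (e₀, (0 : Y)) δ, ∀ s : Icc (0 : ℝ) 1,
      γ (p.1, (s : ℝ) • p.2) 1 = γ p s := by
    intro p hp s
    have hp' := hsmall p hp s s.2
    let σ : C(Icc (0 : ℝ) 1, E) := ⟨fun x => γ p (s * x), by fun_prop⟩
    suffices hσ : (((p.1, (s : ℝ) • p.2), γ (p.1, (s : ℝ) • p.2)) :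
        (E × Y) × C(Icc (0 : ℝ) 1, E)) = ((p.1, (s : ℝ) • p.2), σ) by
      have := congrArg (fun q => q.2 1) hσ
      simpa [σ] using this
    refine e.injOn ?_ (hsub ?_) ?_
    · rw [← (hfix _ hp').1]; exact e.map_target (hB _ hp').1
    · rw [Metric.mem_ball, Prod.dist_eq, max_lt_iff]
      refine ⟨(Metric.mem_ball.1 hp').trans_le ((min_le_right _ _).trans (min_le_left _ _)), ?_⟩
      refine lt_of_lt_of_le ?_ (min_le_left _ ρ)
      rw [ContinuousMap.dist_lt_iff hr]
      exact fun x => hnear p hp _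
    · rw [hef]
      simp only [Prod.mk.injEq, true_and]
      rw [(hfix _ hp').2]
      symm
      ext x
      simp only [Ψ₂, ContinuousMap.sub_apply, integrateCLM_apply,
        ContinuousMap.zero_apply]
      rw [sub_sub, sub_eq_zero]
      change γ p (s * x) = _
      rw [hint p hp]
      congr 1
      have h1 := intervalIntegral.smul_integral_comp_mul_left (a := 0) (b := (x : ℝ))
        (IccExtend zero_le_one (H.comp (liftCLM E Y (p, γ p)))) (s : ℝ)
      rw [mul_zero] at h1
      rw [show ((s * x : Icc (0 : ℝ) 1) : ℝ) = s * x from rfl, ← h1,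
        ← intervalIntegral.integral_smul]
      refine intervalIntegral.integral_congr fun y hy => ?_
      rw [uIcc_of_le x.2.1] at hy
      have hy1 : y ∈ Icc (0 : ℝ) 1 := ⟨hy.1, hy.2.trans x.2.2⟩
      have hy2 : (s : ℝ) * y ∈ Icc (0 : ℝ) 1 :=
        ⟨mul_nonneg s.2.1 hy1.1, mul_le_one₀ s.2.2 hy1.1 hy1.2⟩
      simp only [IccExtend_of_mem _ _ hy1, IccExtend_of_mem _ _ hy2, ContinuousMap.comp_apply,
        liftCLM_apply, H, ContinuousMap.coe_mk, map_smul, smul_smul]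
      rw [mul_comm y]
      rfl
  have hmemρ : ∀ p ∈ Metric.ball (e₀, (0 : Y)) δ, (γ p 1, p.2) ∈ Metric.ball (e₀, (0 : Y)) ρ := by
    intro p hp
    rw [Metric.mem_ball, Prod.dist_eq, max_lt_iff]
    refine ⟨(hnear p hp 1).trans_le (min_le_right _ _), ?_⟩
    exact (le_max_right _ _).trans_lt ((Metric.mem_ball.1 hp).trans_le
      ((min_le_right _ _).trans (min_le_right _ _)))
  have hSsmooth : ContDiffOn ℝ ∞ (fun p => γ p 1) (Metric.ball (e₀, (0 : Y)) δ) := by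
    let ev : C(Icc (0 : ℝ) 1, E) →L[ℝ] E := ContinuousMap.evalCLM ℝ (1 : Icc (0 : ℝ) 1)
    refine ev.contDiff.comp_contDiffOn (contDiff_snd.comp_contDiffOn ?_)
    exact hesymm.comp (f := fun p : E × Y => (p, (0 : C(Icc (0 : ℝ) 1, E))))
      (by fun_prop) fun p hp => (hB p hp).1
  refine ⟨δ, hδ, fun p => γ p 1, hSsmooth, fun t ht => ?_, fun p hp => ⟨hρO (hmemρ p hp), ?_⟩⟩
  · have h1 := (hfix _ ht).2
    rw [hzero, sub_eq_zero] at h1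
    change γ (t, 0) 1 = t
    rw [h1, constCLM_apply]
  · let g : ℝ → E := IccExtend zero_le_one (H.comp (liftCLM E Y (p, γ p)))
    have hg : Continuous g := (H.comp (liftCLM E Y (p, γ p))).continuous.Icc_extend'
    have h1 : HasDerivAt (fun s : ℝ => p.1 + ∫ x in (0 : ℝ)..s, g x) (g 1) 1 :=
      (intervalIntegral.integral_hasDerivAt_right (hg.intervalIntegrable _ _)
        hg.stronglyMeasurable.stronglyMeasurableAtFilter hg.continuousAt).const_add _
    have h2 : HasDerivAt (fun s : ℝ => γ (p.1, s • p.2) 1)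
        (fderiv ℝ (fun p => γ p 1) p (0, p.2)) 1 := by
      have h3 : HasFDerivAt (fun p => γ p 1) (fderiv ℝ (fun p => γ p 1) p)
          (p.1, (1 : ℝ) • p.2) := by
        rw [one_smul]
        exact ((hSsmooth.contDiffAt (Metric.isOpen_ball.mem_nhds hp)).differentiableAt
          (by simp)).hasFDerivAt
      have h4 : HasDerivAt (fun s : ℝ => (p.1, s • p.2)) ((0 : E), p.2) 1 := by
        simpa using (hasDerivAt_const (1 : ℝ) p.1).prodMk
          ((hasDerivAt_id (1 : ℝ)).smul_const p.2)
      exact h3.comp_hasDerivAt 1 h4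
    have h5 : HasDerivWithinAt (fun s : ℝ => γ (p.1, s • p.2) 1) (g 1) (Icc 0 1) 1 := by
      refine h1.hasDerivWithinAt.congr (fun s hs => ?_) ?_
      · rw [hscale p hp ⟨s, hs⟩, hint p hp]
      · have := hscale p hp 1
        simp only [Icc.coe_one] at this
        rw [this, hint p hp]
        rfl
    have h6 : UniqueDiffWithinAt ℝ (Icc (0 : ℝ) 1) 1 :=
      uniqueDiffOn_Icc zero_lt_one 1 (right_mem_Icc.2 zero_le_one)
    rw [h6.eq_deriv _ h2.hasDerivWithinAt h5, ← hAA' _ (hmemρ p hp)]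
    simp only [g, IccExtend_of_mem _ _ (right_mem_Icc.2 (zero_le_one' ℝ))]
    simp only [ContinuousMap.comp_apply, liftCLM_apply, H, ContinuousMap.coe_mk, one_smul]
    rfl

end RadialEquation

/-! ### Frobenius potentials -/

section Frobenius

open Filter Topology Set

/-- A solution of a scalar linear homogeneous equation that starts at zero vanishes. -/
theorem eq_zero_of_linear_ode {q κ : ℝ → ℝ} (hκ : ContinuousOn κ (Icc 0 1))
    (hq : ∀ s ∈ Icc (0 : ℝ) 1, HasDerivAt q (κ s * q s) s) (h0 : q 0 = 0) : q 1 = 0 := by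
  obtain ⟨M, hM⟩ := isCompact_Icc.exists_bound_of_continuousOn hκ
  have hM0 : 0 ≤ M := (norm_nonneg _).trans (hM 0 (left_mem_Icc.2 zero_le_one))
  have h := ODE_solution_unique_of_mem_Icc_right (v := fun s x => κ s * x)
    (s := fun _ => univ) (K := ⟨M, hM0⟩) (f := q) (g := fun _ => 0) (a := 0) (b := 1)
    (fun s hs => LipschitzOnWith.of_dist_le_mul fun x _ y _ => by
      rw [Real.dist_eq, Real.dist_eq, ← mul_sub, abs_mul]
      exact mul_le_mul_of_nonneg_right (hM s (Ico_subset_Icc_self hs)) (abs_nonneg _))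
    (fun s hs => (hq s hs).continuousAt.continuousWithinAt)
    (fun s hs => (hq s (Ico_subset_Icc_self hs)).hasDerivWithinAt) (fun _ _ => mem_univ _)
    continuousOn_const (fun s _ => by simpa using hasDerivWithinAt_const s (Ici s) (0 : ℝ))
    (fun _ _ => mem_univ _) h0
  exact h (right_mem_Icc.2 zero_le_one)

/-- The exterior derivative of a 1-form, evaluated on two vectors. -/
noncomputable def curl {X : Type} [NormedAddCommGroup X] [NormedSpace ℝ X]
    (φ : X → X →L[ℝ] ℝ) (x v w : X) : ℝ := fderiv ℝ φ x v w - fderiv ℝ φ x w v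

theorem two_le_smoothness : minSmoothness ℝ 2 ≤ (∞ : ℕ∞ω) := by
  rw [minSmoothness_of_isRCLikeNormedField]
  exact WithTop.coe_le_coe.2 (le_top : (2 : ℕ∞) ≤ ⊤)

/-- The exterior derivative commutes with pull-back. -/
theorem curl_pullback {X Z : Type} [NormedAddCommGroup X] [NormedSpace ℝ X]
    [NormedAddCommGroup Z] [NormedSpace ℝ Z] {φ : X → X →L[ℝ] ℝ} {Φ : Z → X} {p : Z}
    (hΦ : ContDiffAt ℝ ∞ Φ p) (hφ : DifferentiableAt ℝ φ (Φ p)) (v w : Z) :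
    DifferentiableAt ℝ (fun p => (φ (Φ p)).comp (fderiv ℝ Φ p)) p ∧
    curl (fun p => (φ (Φ p)).comp (fderiv ℝ Φ p)) p v w =
      curl φ (Φ p) (fderiv ℝ Φ p v) (fderiv ℝ Φ p w) := by
  have h1 : HasFDerivAt (fderiv ℝ Φ) (fderiv ℝ (fderiv ℝ Φ) p) p :=
    ((hΦ.fderiv_right (m := ∞) (by simp)).differentiableAt (by simp)).hasFDerivAt
  have h2 : HasFDerivAt (fun p => φ (Φ p)) _ p :=
    hφ.hasFDerivAt.comp p (hΦ.differentiableAt (by simp)).hasFDerivAt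
  have h3 := h2.clm_comp h1
  refine ⟨h3.differentiableAt, ?_⟩
  have hs : fderiv ℝ (fderiv ℝ Φ) p v w = fderiv ℝ (fderiv ℝ Φ) p w v :=
    (hΦ.isSymmSndFDerivAt two_le_smoothness) v w
  simp only [curl, h3.fderiv]
  simp [hs]

/-- `d(df) = 0`. -/
theorem curl_fderiv {X : Type} [NormedAddCommGroup X] [NormedSpace ℝ X] {f : X → ℝ} {x : X}
    (hf : ContDiffAt ℝ ∞ f x) (v w : X) :
    DifferentiableAt ℝ (fderiv ℝ f) x ∧ curl (fderiv ℝ f) x v w = 0 :=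
  ⟨(hf.fderiv_right (m := ∞) (by simp)).differentiableAt (by simp),
    sub_eq_zero.2 ((hf.isSymmSndFDerivAt two_le_smoothness) v w)⟩

/-- The symmetry of the second derivative, for iterated directional derivatives. -/
theorem fderiv_fderiv_comm {X : Type} [NormedAddCommGroup X] [NormedSpace ℝ X] {f : X → ℝ} {x : X}
    (hf : ContDiffAt ℝ ∞ f x) (v w : X) :
    fderiv ℝ (fun y => fderiv ℝ f y w) x v = fderiv ℝ (fun y => fderiv ℝ f y v) x w := by
  obtain ⟨h, h0⟩ := curl_fderiv hf v w
  have hd : ∀ v w : X, fderiv ℝ (fun y => fderiv ℝ f y w) x v =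
      fderiv ℝ (fderiv ℝ f) x v w := by
    intro v w
    rw [fderiv_clm_apply h (differentiableAt_const w)]
    simp
  rw [hd, hd]
  exact sub_eq_zero.1 h0

theorem hasDerivAt_form_along {Z : Type} [NormedAddCommGroup Z] [NormedSpace ℝ Z]
    {φ : Z → Z →L[ℝ] ℝ} {D : Z →L[ℝ] Z →L[ℝ] ℝ} {c v : ℝ → Z} {c' v' : Z} {s : ℝ}
    (hφ : HasFDerivAt φ D (c s)) (hc : HasDerivAt c c' s) (hv : HasDerivAt v v' s) :
    HasDerivAt (fun r => φ (c r) (v r)) (D c' (v s) + φ (c s) v') s := by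
  have h : HasDerivAt (fun r => φ (c r)) (D c') s := hφ.comp_hasDerivAt s hc
  exact h.clm_apply hv

variable {Y : Type} [NormedAddCommGroup Y] [NormedSpace ℝ Y]

theorem hasDerivAt_line (t : ℝ) (y η : Y) (s : ℝ) :
    HasDerivAt (fun r : ℝ => (t, y + r • η)) ((0 : ℝ), η) s :=
  (hasDerivAt_const s t).prodMk
    (by simpa only [one_smul, id] using ((hasDerivAt_id s).smul_const η).const_add y)

theorem hasDerivAt_ray (t : ℝ) (y : Y) (s : ℝ) :
    HasDerivAt (fun r : ℝ => (t, r • y)) ((0 : ℝ), y) s :=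
  (hasDerivAt_const s t).prodMk
    (by simpa only [one_smul, id] using (hasDerivAt_id s).smul_const y)

/-- If a 1-form `φ` vanishes on the radial vectors `(0, y)`, then its radial variation on a vector
`(0, η)` transported along the ray is governed by `dφ` alone. -/
theorem hasDerivAt_radial {δ : ℝ} {φ : ℝ × Y → ℝ × Y →L[ℝ] ℝ}
    (hφ : ∀ p ∈ Metric.ball (0 : ℝ × Y) δ, DifferentiableAt ℝ φ p)
    (hrad : ∀ p ∈ Metric.ball (0 : ℝ × Y) δ, φ p (0, p.2) = 0) {t s : ℝ} {y : Y}
    (hp : (t, s • y) ∈ Metric.ball (0 : ℝ × Y) δ) (η : Y) :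
    HasDerivAt (fun s : ℝ => φ (t, s • y) (0, s • η))
      (curl φ (t, s • y) (0, s • y) (0, η)) s := by
  set D := fderiv ℝ φ (t, s • y) with hDdef
  have hD : HasFDerivAt φ D (t, s • y) := (hφ _ hp).hasFDerivAt
  have h3 : HasDerivAt (fun s : ℝ => φ (t, s • y) (0, s • η))
      (D (0, y) (0, s • η) + φ (t, s • y) (0, η)) s :=
    hasDerivAt_form_along hD (hasDerivAt_ray t y s) (hasDerivAt_ray 0 η s)
  have hpt : (t, s • y + (0 : ℝ) • η) = (t, s • y) := by rw [zero_smul, add_zero]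
  have hD' : HasFDerivAt φ D (t, s • y + (0 : ℝ) • η) := by rw [hpt]; exact hD
  have h6 : HasDerivAt (fun r : ℝ => φ (t, s • y + r • η) ((0 : ℝ), s • y + r • η))
      (D (0, η) (0, s • y + (0 : ℝ) • η) + φ (t, s • y + (0 : ℝ) • η) (0, η)) 0 :=
    hasDerivAt_form_along hD' (hasDerivAt_line t (s • y) η 0) (hasDerivAt_line 0 (s • y) η 0)
  -- Differentiating `φ (0, y) = 0` transversally trades `φ (0, η)` for a derivative of `φ`.
  have h7 : (fun r : ℝ => φ (t, s • y + r • η) ((0 : ℝ), s • y + r • η)) =ᶠ[𝓝 0]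
      fun _ => (0 : ℝ) := by
    have hc : ContinuousAt (fun r : ℝ => (t, s • y + r • η)) 0 :=
      (hasDerivAt_line t (s • y) η 0).continuousAt
    filter_upwards [hc.eventually (Metric.isOpen_ball.mem_nhds
      (show (t, s • y + (0 : ℝ) • η) ∈ Metric.ball (0 : ℝ × Y) δ by rw [hpt]; exact hp))]
      with r hr
    exact hrad _ hr
  have h8 := h6.unique ((hasDerivAt_const (0 : ℝ) (0 : ℝ)).congr_of_eventuallyEq h7)
  rw [hpt, zero_smul, add_zero] at h8
  have e1 : D (0, s • y) (0, η) = D (0, y) (0, s • η) := by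
    have h1 : ((0 : ℝ), s • y) = s • ((0 : ℝ), y) := Prod.ext (by simp) rfl
    have h2 : ((0 : ℝ), s • η) = s • ((0 : ℝ), η) := Prod.ext (by simp) rfl
    rw [h1, h2, map_smul, map_smul]
    rfl
  refine h3.congr_deriv ?_
  rw [curl, ← hDdef, e1]
  linarith

theorem mem_ball_ray {δ : ℝ} {p : ℝ × Y} (hp : p ∈ Metric.ball (0 : ℝ × Y) δ) {s : ℝ}
    (hs : s ∈ Icc (0 : ℝ) 1) : (p.1, s • p.2) ∈ Metric.ball (0 : ℝ × Y) δ := by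
  rw [Metric.mem_ball, Prod.dist_eq, max_lt_iff] at hp ⊢
  refine ⟨hp.1, lt_of_le_of_lt ?_ hp.2⟩
  simp only [Prod.snd_zero, dist_zero_right, norm_smul, Real.norm_eq_abs, abs_of_nonneg hs.1]
  exact mul_le_of_le_one_left (norm_nonneg _) hs.2

/-- Radial form of the Frobenius theorem: if `dφ = φ ∧ C` and `φ` vanishes on radial vectors, then
`φ` vanishes on all vectors of `Y`. -/
theorem vanishes_of_radial {δ : ℝ} {φ C : ℝ × Y → ℝ × Y →L[ℝ] ℝ}
    (hφ : ∀ p ∈ Metric.ball (0 : ℝ × Y) δ, DifferentiableAt ℝ φ p)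
    (hC : ContinuousOn C (Metric.ball (0 : ℝ × Y) δ))
    (hrad : ∀ p ∈ Metric.ball (0 : ℝ × Y) δ, φ p (0, p.2) = 0)
    (hcurl : ∀ p ∈ Metric.ball (0 : ℝ × Y) δ, ∀ v w, curl φ p v w = φ p v * C p w - φ p w * C p v)
    {p : ℝ × Y} (hp : p ∈ Metric.ball (0 : ℝ × Y) δ) (η : Y) : φ p (0, η) = 0 := by
  have h := eq_zero_of_linear_ode (q := fun s : ℝ => φ (p.1, s • p.2) (0, s • η))
    (κ := fun s => -C (p.1, s • p.2) (0, p.2)) ?_ ?_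
    (by simp only [zero_smul]; exact map_zero _)
  · simpa using h
  · refine ContinuousOn.neg (ContinuousOn.clm_apply ?_ continuousOn_const)
    exact hC.comp (by fun_prop) fun s hs => mem_ball_ray hp hs
  · intro s hs
    have hm := mem_ball_ray hp hs
    refine (hasDerivAt_radial hφ hrad hm η).congr_deriv ?_
    rw [hcurl _ hm, hrad _ hm]
    have e1 : ((0 : ℝ), s • p.2) = s • ((0 : ℝ), p.2) := by simp
    have e2 : ((0 : ℝ), s • η) = s • ((0 : ℝ), η) := by simp
    rw [e1, e2]
    simp only [map_smul, smul_eq_mul]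
    ring

/-- Radial form of the Poincaré lemma: a form closed along `Y` which vanishes on radial vectors
vanishes on all vectors of `Y`. -/
theorem vanishes_of_radial_of_curl {δ : ℝ} {φ : ℝ × Y → ℝ × Y →L[ℝ] ℝ}
    (hφ : ∀ p ∈ Metric.ball (0 : ℝ × Y) δ, DifferentiableAt ℝ φ p)
    (hrad : ∀ p ∈ Metric.ball (0 : ℝ × Y) δ, φ p (0, p.2) = 0)
    (hcurl : ∀ p ∈ Metric.ball (0 : ℝ × Y) δ, ∀ v w : Y, curl φ p (0, v) (0, w) = 0)
    {p : ℝ × Y} (hp : p ∈ Metric.ball (0 : ℝ × Y) δ) (η : Y) : φ p (0, η) = 0 := by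
  have h := eq_zero_of_linear_ode (q := fun s : ℝ => φ (p.1, s • p.2) (0, s • η))
    (κ := fun _ => 0) continuousOn_const ?_
    (by simp only [zero_smul]; exact map_zero _)
  · simpa using h
  · intro s hs
    have hm := mem_ball_ray hp hs
    refine (hasDerivAt_radial hφ hrad hm η).congr_deriv ?_
    rw [hcurl _ hm]
    simp

theorem contDiffOn_smul_form {Z : Type} [NormedAddCommGroup Z] [NormedSpace ℝ Z] {f : Z → ℝ}
    {L : Z → Y →L[ℝ] ℝ} {O : Set Z} (hf : ContDiffOn ℝ ∞ f O) (hL : ContDiffOn ℝ ∞ L O) :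
    ContDiffOn ℝ ∞ (fun z => f z • L z) O := hf.smul hL

/-- Frobenius theorem for a 1-form `A` with `dA = A ∧ C`, together with the relative Poincaré lemma
for a 1-form `B` with `dB = A ∧ K`: locally `A = β dα` and `B = -dτ + μ dα`.

A slice `t ↦ x₀ + t e` transverse to `A` is propagated along the rays of the kernel of `A x₀`, so
that `A` annihilates the radial velocities; `t` becomes `α`, and `-τ` is the integral of `B` along
the propagated rays. -/
theorem exists_frobenius_potentials {X : Type} [NormedAddCommGroup X] [NormedSpace ℝ X]
    [FiniteDimensional ℝ X] {U : Set X} (hU : IsOpen U) {A B C K : X → X →L[ℝ] ℝ}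
    (hA : ContDiffOn ℝ ∞ A U) (hB : ContDiffOn ℝ ∞ B U) (hC : ContinuousOn C U)
    (hdA : ∀ x ∈ U, ∀ v w, curl A x v w = A x v * C x w - A x w * C x v)
    (hdB : ∀ x ∈ U, ∀ v w, curl B x v w = A x v * K x w - A x w * K x v)
    {x₀ : X} (hx₀ : x₀ ∈ U) (hA₀ : A x₀ ≠ 0) :
    ∃ V : Set X, IsOpen V ∧ x₀ ∈ V ∧ V ⊆ U ∧ ∃ τ α μ β : X → ℝ,
      ContDiffOn ℝ ∞ τ V ∧ ContDiffOn ℝ ∞ α V ∧ ContDiffOn ℝ ∞ μ V ∧ ContDiffOn ℝ ∞ β V ∧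
      ∀ x ∈ V, A x = β x • fderiv ℝ α x ∧ B x = -fderiv ℝ τ x + μ x • fderiv ℝ α x := by
  obtain ⟨e, he⟩ : ∃ e, A x₀ e ≠ 0 := by
    by_contra! h
    exact hA₀ (ContinuousLinearMap.ext h)
  obtain ⟨Y, hY⟩ : ∃ Y : Submodule ℝ X, ∀ x, x ∈ Y ↔ A x₀ x = 0 :=
    ⟨LinearMap.ker (A x₀ : X →ₗ[ℝ] ℝ), fun _ => Iff.rfl⟩
  let ι : Y →L[ℝ] X := Y.subtypeL
  let pt : (ℝ × ℝ) × Y → X := fun q => x₀ + q.1.1 • e + ι q.2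
  have hpt : ContDiff ℝ ∞ pt := by
    change ContDiff ℝ ∞ (fun q : (ℝ × ℝ) × Y => x₀ + q.1.1 • e + ι q.2)
    fun_prop
  let U' : Set X := U ∩ (fun x => A x e) ⁻¹' {0}ᶜ
  have hU' : IsOpen U' :=
    (hA.continuousOn.clm_apply continuousOn_const).isOpen_inter_preimage hU
      isOpen_compl_singleton
  let O : Set ((ℝ × ℝ) × Y) := pt ⁻¹' U'
  have hO : IsOpen O := hU'.preimage hpt.continuous
  have hO₀ : ((0 : ℝ × ℝ), (0 : Y)) ∈ O := by
    change x₀ + (0 : ℝ) • e + ι 0 ∈ U'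
    simp only [zero_smul, map_zero, add_zero]
    exact ⟨hx₀, he⟩
  -- The state is the pair `(s, θ)`: the curve `x₀ + s e + y` has velocity in the kernel of `A`, and
  -- `θ` accumulates minus the integral of `B` along it.
  let R : (ℝ × ℝ) × Y → Y →L[ℝ] ℝ × ℝ := fun q =>
    (ContinuousLinearMap.inl ℝ ℝ ℝ).comp ((-(A (pt q) e)⁻¹) • (A (pt q)).comp ι) +
    (ContinuousLinearMap.inr ℝ ℝ ℝ).comp
      (-(B (pt q)).comp ι + (B (pt q) e * (A (pt q) e)⁻¹) • (A (pt q)).comp ι)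
  have hR : ContDiffOn ℝ ∞ R O := by
    have hAq : ContDiffOn ℝ ∞ (fun q => A (pt q)) O :=
      hA.comp hpt.contDiffOn fun q hq => hq.1
    have hBq : ContDiffOn ℝ ∞ (fun q => B (pt q)) O :=
      hB.comp hpt.contDiffOn fun q hq => hq.1
    have hinv : ContDiffOn ℝ ∞ (fun q => (A (pt q) e)⁻¹) O :=
      (hAq.clm_apply contDiffOn_const).inv fun q hq => hq.2
    have hAι : ContDiffOn ℝ ∞ (fun q => (A (pt q)).comp ι) O := hAq.clm_comp contDiffOn_const
    have hBι : ContDiffOn ℝ ∞ (fun q => (B (pt q)).comp ι) O := hBq.clm_comp contDiffOn_const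
    exact (contDiffOn_const.clm_comp (contDiffOn_smul_form hinv.neg hAι)).add
      (contDiffOn_const.clm_comp
        (hBι.neg.add (contDiffOn_smul_form ((hBq.clm_apply contDiffOn_const).mul hinv) hAι)))
  obtain ⟨δ, hδ, S, hS, hS₀, hSr⟩ := exists_radial_solution hO hO₀ hR
  let W : Set (ℝ × Y) := Metric.ball 0 δ
  have hW : IsOpen W := Metric.isOpen_ball
  have h0W : (0 : ℝ × Y) ∈ W := Metric.mem_ball_self hδ
  let j : ℝ × Y →L[ℝ] (ℝ × ℝ) × Y :=
    ((ContinuousLinearMap.inl ℝ ℝ ℝ).comp (ContinuousLinearMap.fst ℝ ℝ Y)).prod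
      (ContinuousLinearMap.snd ℝ ℝ Y)
  have hjW : ∀ p ∈ W, j p ∈ Metric.ball ((0 : ℝ × ℝ), (0 : Y)) δ := by
    intro p hp
    have hp' : dist p 0 < δ := hp
    rw [Prod.dist_eq, max_lt_iff] at hp'
    rw [Metric.mem_ball, Prod.dist_eq, Prod.dist_eq]
    exact max_lt (max_lt hp'.1 (by simpa [j] using hδ)) hp'.2
  let T : ℝ × Y → ℝ × ℝ := fun p => S (j p)
  have hT : ContDiffOn ℝ ∞ T W := hS.comp j.contDiff.contDiffOn hjW
  have hTr : ∀ p ∈ W, fderiv ℝ T p (0, p.2) = R (T p, p.2) p.2 := by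
    intro p hp
    have h1 : HasFDerivAt S (fderiv ℝ S (j p)) (j p) :=
      ((hS.contDiffAt (Metric.isOpen_ball.mem_nhds (hjW p hp))).differentiableAt
        (by simp)).hasFDerivAt
    have h2 : HasFDerivAt T ((fderiv ℝ S (j p)).comp j) p := h1.comp p j.hasFDerivAt
    rw [h2.fderiv]
    exact (hSr _ (hjW p hp)).2
  let S₁ : ℝ × Y → ℝ := fun p => (T p).1
  let θ : ℝ × Y → ℝ := fun p => (T p).2
  have hS₁ : ContDiffOn ℝ ∞ S₁ W := hT.fst
  have hθ : ContDiffOn ℝ ∞ θ W := hT.snd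
  let Φ : ℝ × Y → X := fun p => x₀ + S₁ p • e + ι p.2
  have hΦ : ContDiffOn ℝ ∞ Φ W :=
    (contDiffOn_const.add (hS₁.smul contDiffOn_const)).add (ι.contDiff.comp contDiff_snd).contDiffOn
  have hΦU : ∀ p ∈ W, Φ p ∈ U' := fun p hp => (hSr _ (hjW p hp)).1
  have hTd : ∀ p ∈ W, HasFDerivAt T (fderiv ℝ T p) p := fun p hp =>
    ((hT.contDiffAt (hW.mem_nhds hp)).differentiableAt (by simp)).hasFDerivAt
  have hS₁d : ∀ p ∈ W, ∀ v, fderiv ℝ S₁ p v = (fderiv ℝ T p v).1 := fun p hp v => by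
    rw [(hTd p hp).fst.fderiv]; rfl
  have hθd : ∀ p ∈ W, ∀ v, fderiv ℝ θ p v = (fderiv ℝ T p v).2 := fun p hp v => by
    rw [(hTd p hp).snd.fderiv]; rfl
  have hΦd : ∀ p ∈ W, ∀ v, fderiv ℝ Φ p v = fderiv ℝ S₁ p v • e + ι v.2 := by
    intro p hp v
    have h1 : HasFDerivAt S₁ (fderiv ℝ S₁ p) p :=
      ((hS₁.contDiffAt (hW.mem_nhds hp)).differentiableAt (by simp)).hasFDerivAt
    have h2 := ((h1.smul_const e).const_add x₀).add (ι.hasFDerivAt.comp p hasFDerivAt_snd)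
    have h3 : HasFDerivAt Φ _ p := h2
    rw [h3.fderiv]
    rfl
  have hradA : ∀ p ∈ W, A (Φ p) (fderiv ℝ Φ p (0, p.2)) = 0 := by
    intro p hp
    have h1 : A (Φ p) e ≠ 0 := (hΦU p hp).2
    have h2 : (fderiv ℝ T p (0, p.2)).1 = -(A (Φ p) e)⁻¹ * A (Φ p) (ι p.2) := by
      rw [hTr p hp]
      simp [R, pt, Φ, S₁]
    rw [hΦd p hp, hS₁d p hp, h2]
    simp only [map_add, map_smul, smul_eq_mul]
    field_simp
    ring
  have hradB : ∀ p ∈ W, B (Φ p) (fderiv ℝ Φ p (0, p.2)) + fderiv ℝ θ p (0, p.2) = 0 := by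
    intro p hp
    have h2 : (fderiv ℝ T p (0, p.2)).1 = -(A (Φ p) e)⁻¹ * A (Φ p) (ι p.2) := by
      rw [hTr p hp]
      simp [R, pt, Φ, S₁]
    have h3 : (fderiv ℝ T p (0, p.2)).2 =
        -B (Φ p) (ι p.2) + B (Φ p) e * (A (Φ p) e)⁻¹ * A (Φ p) (ι p.2) := by
      rw [hTr p hp]
      simp [R, pt, Φ, S₁]
    rw [hΦd p hp, hS₁d p hp, hθd p hp, h2, h3]
    simp only [map_add, map_smul, smul_eq_mul]
    ring
  -- Both pulled back forms vanish on radial vectors, hence on all of `Y`: `Φ* A` is a multiple of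
  -- `dt`, and so is `Φ* B + dθ`.
  let φA : ℝ × Y → ℝ × Y →L[ℝ] ℝ := fun p => (A (Φ p)).comp (fderiv ℝ Φ p)
  let φB : ℝ × Y → ℝ × Y →L[ℝ] ℝ := fun p => (B (Φ p)).comp (fderiv ℝ Φ p) + fderiv ℝ θ p
  have hΦa : ∀ p ∈ W, ContDiffAt ℝ ∞ Φ p := fun p hp => hΦ.contDiffAt (hW.mem_nhds hp)
  have hAd : ∀ p ∈ W, DifferentiableAt ℝ A (Φ p) := fun p hp =>
    (hA.contDiffAt (hU.mem_nhds (hΦU p hp).1)).differentiableAt (by simp)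
  have hBd : ∀ p ∈ W, DifferentiableAt ℝ B (Φ p) := fun p hp =>
    (hB.contDiffAt (hU.mem_nhds (hΦU p hp).1)).differentiableAt (by simp)
  have hfdΦ : ContDiffOn ℝ ∞ (fderiv ℝ Φ) W := hΦ.fderiv_of_isOpen hW (by simp)
  have hvA : ∀ p ∈ W, ∀ η, φA p (0, η) = 0 := by
    intro p hp η
    refine vanishes_of_radial (C := fun p => (C (Φ p)).comp (fderiv ℝ Φ p))
      (fun p hp => (curl_pullback (hΦa p hp) (hAd p hp) 0 0).1) ?_ hradA ?_ hp η
    · exact (hC.comp hΦ.continuousOn fun p hp => (hΦU p hp).1).clm_comp hfdΦ.continuousOn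
    · intro p hp v w
      rw [(curl_pullback (hΦa p hp) (hAd p hp) v w).2, hdA _ (hΦU p hp).1]
      rfl
  have hvB : ∀ p ∈ W, ∀ η, φB p (0, η) = 0 := by
    intro p hp η
    have hsum : ∀ p ∈ W, DifferentiableAt ℝ φB p ∧ ∀ v w : ℝ × Y, curl φB p v w =
        curl B (Φ p) (fderiv ℝ Φ p v) (fderiv ℝ Φ p w) := by
      intro p hp
      have hθp := hθ.contDiffAt (hW.mem_nhds hp)
      have h1 := (curl_pullback (hΦa p hp) (hBd p hp) 0 0).1
      have h2 := (curl_fderiv hθp 0 0).1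
      refine ⟨h1.add h2, fun v w => ?_⟩
      rw [← (curl_pullback (hΦa p hp) (hBd p hp) v w).2]
      have h3 : HasFDerivAt φB _ p := h1.hasFDerivAt.add h2.hasFDerivAt
      have h4 := (curl_fderiv hθp v w).2
      simp only [curl, h3.fderiv, add_apply] at h4 ⊢
      linarith
    refine vanishes_of_radial_of_curl (fun p hp => (hsum p hp).1) hradB (fun p hp v w => ?_) hp η
    rw [(hsum p hp).2, hdB _ (hΦU p hp).1]
    have h1 : A (Φ p) (fderiv ℝ Φ p (0, v)) = 0 := hvA p hp v
    have h2 : A (Φ p) (fderiv ℝ Φ p (0, w)) = 0 := hvA p hp w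
    rw [h1, h2]
    ring
  have hΦ₀ : ∀ t, (t, (0 : Y)) ∈ W → Φ (t, 0) = x₀ + t • e := by
    intro t ht
    have h1 : T (t, 0) = (t, 0) := hS₀ _ (hjW _ ht)
    simp [Φ, S₁, h1]
  have hS₁t : ∀ t : ℝ, fderiv ℝ S₁ 0 (t, 0) = t := by
    intro t
    have h1 : HasFDerivAt S₁ (fderiv ℝ S₁ 0) ((0 : ℝ), (0 : Y)) :=
      ((hS₁.contDiffAt (hW.mem_nhds h0W)).differentiableAt (by simp)).hasFDerivAt
    have h2 : HasDerivAt (fun t : ℝ => S₁ (t, (0 : Y))) (fderiv ℝ S₁ 0 (1, 0)) 0 :=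
      HasFDerivAt.comp_hasDerivAt (f := fun t : ℝ => (t, (0 : Y))) (0 : ℝ) h1
        ((hasDerivAt_id' (0 : ℝ)).prodMk (hasDerivAt_const (0 : ℝ) (0 : Y)))
    have h3 : (fun t : ℝ => S₁ (t, (0 : Y))) =ᶠ[𝓝 0] id := by
      have hc : ContinuousAt (fun t : ℝ => (t, (0 : Y))) 0 := by fun_prop
      filter_upwards [hc.eventually (hW.mem_nhds h0W)] with t ht
      exact congrArg Prod.fst (hS₀ _ (hjW _ ht))
    have h4 := h2.unique ((hasDerivAt_id (0 : ℝ)).congr_of_eventuallyEq h3)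
    have h5 : (t, (0 : Y)) = t • ((1 : ℝ), (0 : Y)) := by simp
    rw [h5, map_smul, h4, smul_eq_mul, mul_one]
  -- `Φ` is a local diffeomorphism, since `e` is transverse to the kernel `Y` of `A x₀`.
  have hbij : Function.Bijective (fderiv ℝ Φ 0) := by
    have hsplit : ∀ v : ℝ × Y, fderiv ℝ Φ 0 v =
        (v.1 + fderiv ℝ S₁ 0 (0, v.2)) • e + (v.2 : X) := by
      intro v
      have h1 : v = (v.1, 0) + (0, v.2) := by simp
      rw [hΦd 0 h0W, h1, map_add, hS₁t]
      simp [ι]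
    have hker : ∀ y : Y, A x₀ (y : X) = 0 := fun y => (hY _).1 y.2
    constructor
    · rw [injective_iff_map_eq_zero]
      intro v hv
      rw [hsplit] at hv
      have h1 := congrArg (A x₀) hv
      simp only [map_add, map_smul, hker, add_zero, map_zero, smul_eq_mul, mul_eq_zero, he,
        or_false] at h1
      rw [h1, zero_smul, zero_add] at hv
      have h2 : v.2 = 0 := Subtype.ext hv
      have h3 : ((0 : ℝ), (0 : Y)) = 0 := rfl
      rw [h2, h3, map_zero, add_zero] at h1
      exact Prod.ext h1 h2
    · intro x
      let y : Y := ⟨x - (A x₀ x / A x₀ e) • e, by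
        rw [hY]
        simp only [map_sub, map_smul, smul_eq_mul]
        field_simp
        ring⟩
      refine ⟨(A x₀ x / A x₀ e - fderiv ℝ S₁ 0 (0, y), y), ?_⟩
      rw [hsplit]
      simp [y]
  let L : (ℝ × Y) ≃L[ℝ] X :=
    (LinearEquiv.ofBijective (fderiv ℝ Φ 0 : ℝ × Y →ₗ[ℝ] X) hbij).toContinuousLinearEquiv
  have hL : HasFDerivAt Φ (L : ℝ × Y →L[ℝ] X) 0 := by
    refine ((hΦa 0 h0W).differentiableAt (by simp)).hasFDerivAt.congr_fderiv ?_
    ext v <;> rfl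
  obtain ⟨E, hE0, hEW, hEΦ, hEs⟩ := exists_smooth_chart hW h0W hΦ L hL
  have hEx : ∀ x ∈ E.target, E.symm x ∈ W ∧ Φ (E.symm x) = x := fun x hx =>
    ⟨hEW (E.map_target hx), by rw [← hEΦ]; exact E.right_inv hx⟩
  have hEW' : MapsTo E.symm E.target W := fun x hx => (hEx x hx).1
  have hmap : ContDiffOn ℝ ∞ (fun x => fderiv ℝ Φ (E.symm x) (1, 0)) E.target :=
    (hfdΦ.comp hEs hEW').clm_apply contDiffOn_const
  have hsub : E.target ⊆ U := fun x hx => by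
    rw [← (hEx x hx).2]; exact (hΦU _ (hEx x hx).1).1
  refine ⟨E.target, E.open_target, ?_, hsub, fun x => θ (E.symm x), fun x => (E.symm x).1,
    fun x => B x (fderiv ℝ Φ (E.symm x) (1, 0)) + fderiv ℝ θ (E.symm x) (1, 0),
    fun x => A x (fderiv ℝ Φ (E.symm x) (1, 0)), hθ.comp hEs hEW', hEs.fst, ?_,
    (hA.mono hsub).clm_apply hmap, ?_⟩
  · have h1 := E.map_source hE0
    rw [hEΦ] at h1
    have h2 := hΦ₀ 0 h0W
    rw [zero_smul, add_zero] at h2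
    change Φ 0 = x₀ at h2
    rwa [h2] at h1
  · exact ((hB.mono hsub).clm_apply hmap).add
      (((hθ.fderiv_of_isOpen hW (m := ∞) (by simp)).comp hEs hEW').clm_apply contDiffOn_const)
  · intro x hx
    obtain ⟨hpW, hpx⟩ := hEx x hx
    set p := E.symm x with hp
    let M := fderiv ℝ E.symm x
    have hM : HasFDerivAt E.symm M x :=
      ((hEs.contDiffAt (E.open_target.mem_nhds hx)).differentiableAt (by simp)).hasFDerivAt
    have hΦp : HasFDerivAt Φ (fderiv ℝ Φ p) (E.symm x) :=
      ((hΦa p hpW).differentiableAt (by simp)).hasFDerivAt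
    have hθp : HasFDerivAt θ (fderiv ℝ θ p) (E.symm x) :=
      ((hθ.contDiffAt (hW.mem_nhds hpW)).differentiableAt (by simp)).hasFDerivAt
    have hMΦ : ∀ v, fderiv ℝ Φ p (M v) = v := by
      have h1 : HasFDerivAt (fun y => Φ (E.symm y)) ((fderiv ℝ Φ p).comp M) x := hΦp.comp x hM
      have h2 : HasFDerivAt (fun y => Φ (E.symm y)) (ContinuousLinearMap.id ℝ X) x := by
        refine (hasFDerivAt_id x).congr_of_eventuallyEq ?_
        filter_upwards [E.open_target.mem_nhds hx] with y hy
        exact (hEx y hy).2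
      exact fun v => congrArg (fun L => L v) (h1.unique h2)
    have hα : fderiv ℝ (fun x => (E.symm x).1) x = (ContinuousLinearMap.fst ℝ ℝ Y).comp M :=
      hM.fst.fderiv
    have hτ : fderiv ℝ (fun x => θ (E.symm x)) x = (fderiv ℝ θ p).comp M :=
      (hθp.comp x hM).fderiv
    have hdec : ∀ v, M v = (M v).1 • ((1 : ℝ), (0 : Y)) + (0, (M v).2) := fun v => by simp
    rw [hα, hτ]
    constructor
    · ext v
      have h1 : A x (fderiv ℝ Φ p (0, (M v).2)) = 0 := by
        have := hvA p hpW (M v).2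
        rw [← hpx]; exact this
      have h2 : A x v = A x (fderiv ℝ Φ p (M v)) := by rw [hMΦ]
      rw [h2, hdec v, map_add, map_add, h1, map_smul, map_smul]
      simp
      ring
    · ext v
      have h1 : B x (fderiv ℝ Φ p (0, (M v).2)) + fderiv ℝ θ p (0, (M v).2) = 0 := by
        have := hvB p hpW (M v).2
        rw [← hpx]; exact this
      have h2 : B x v = B x (fderiv ℝ Φ p (M v)) := by rw [hMΦ]
      have h3 : fderiv ℝ θ p (M v) =
          (M v).1 * fderiv ℝ θ p (1, 0) + fderiv ℝ θ p (0, (M v).2) := by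
        conv_lhs => rw [hdec v, map_add, map_smul, smul_eq_mul]
      have h4 : B x (fderiv ℝ Φ p (M v)) =
          (M v).1 * B x (fderiv ℝ Φ p (1, 0)) + B x (fderiv ℝ Φ p (0, (M v).2)) := by
        conv_lhs => rw [hdec v, map_add, map_smul, map_add, map_smul, smul_eq_mul]
      simp only [add_apply, neg_apply,
        smul_apply, ContinuousLinearMap.comp_apply,
        ContinuousLinearMap.coe_fst', smul_eq_mul]
      rw [h2, h3, h4]
      linear_combination h1

end Frobenius

/-! ### Exterior algebra at a point -/

section Pointwise

open Matrix

/-- Twelve times the Levi-Civita symbol is the Vandermonde product of its indices. -/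
theorem levi_eq (i j k l : Fin 4) : levi i j k l =
    (((j : ℕ) : ℝ) - (i : ℕ)) * (((k : ℕ) : ℝ) - (i : ℕ)) * (((l : ℕ) : ℝ) - (i : ℕ)) *
    (((k : ℕ) : ℝ) - (j : ℕ)) * (((l : ℕ) : ℝ) - (j : ℕ)) * (((l : ℕ) : ℝ) - (k : ℕ)) / 12 := by
  have key : (Matrix.of fun r s : Fin 4 => if ![i, j, k, l] r = s then (1 : ℝ) else 0) *
      vandermonde (fun s : Fin 4 => ((s : ℕ) : ℝ)) =
      vandermonde (fun r : Fin 4 => (((![i, j, k, l] r : Fin 4) : ℕ) : ℝ)) := by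
    ext r s
    simp [Matrix.mul_apply, vandermonde_apply]
  have h := congrArg Matrix.det key
  rw [det_mul, det_vandermonde, det_vandermonde] at h
  have hI0 : Finset.Ioi (0 : Fin 4) = {1, 2, 3} := by decide
  have hI1 : Finset.Ioi (1 : Fin 4) = {2, 3} := by decide
  have hI2 : Finset.Ioi (2 : Fin 4) = {3} := by decide
  have hI3 : Finset.Ioi (3 : Fin 4) = ∅ := by decide
  simp [Fin.prod_univ_four, hI0, hI1, hI2, hI3] at h
  rw [levi]
  norm_num at h
  linarith

/-- Components of the contraction of the Levi-Civita symbol with an antisymmetric tensor. -/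
theorem sum_levi {T : Fin 4 → Fin 4 → Fin 4 → ℝ} (h₁ : ∀ i j k, T j i k = -T i j k)
    (h₂ : ∀ i j k, T i k j = -T i j k) :
    (fun l => ∑ i, ∑ j, ∑ k, levi i j k l * T i j k) =
      ![-6 * T 1 2 3, 6 * T 0 2 3, -6 * T 0 1 3, 6 * T 0 1 2] := by
  ext l
  fin_cases l
  · simp [Fin.sum_univ_four, levi_eq]
    rw [h₁ 1 2 3, h₂ 1 2 3, h₂ 2 1 3, h₁ 1 2 3, h₁ 1 3 2, h₂ 1 2 3, h₂ 3 1 2, h₁ 1 3 2, h₂ 1 2 3]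
    ring
  · simp [Fin.sum_univ_four, levi_eq]
    rw [h₁ 0 2 3, h₂ 0 2 3, h₂ 2 0 3, h₁ 0 2 3, h₁ 0 3 2, h₂ 0 2 3, h₂ 3 0 2, h₁ 0 3 2, h₂ 0 2 3]
    ring
  · simp [Fin.sum_univ_four, levi_eq]
    rw [h₁ 0 1 3, h₂ 0 1 3, h₂ 1 0 3, h₁ 0 1 3, h₁ 0 3 1, h₂ 0 1 3, h₂ 3 0 1, h₁ 0 3 1, h₂ 0 1 3]
    ring
  · simp [Fin.sum_univ_four, levi_eq]
    rw [h₁ 0 1 2, h₂ 0 1 2, h₂ 1 0 2, h₁ 0 1 2, h₁ 0 2 1, h₂ 0 1 2, h₂ 2 0 1, h₁ 0 2 1, h₂ 0 1 2]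
    ring

/-- An antisymmetric tensor with three indices in `Fin 4` has four independent components. -/
theorem antisymm_eq_zero {T : Fin 4 → Fin 4 → Fin 4 → ℝ} (h₁ : ∀ i j k, T j i k = -T i j k)
    (h₂ : ∀ i j k, T i k j = -T i j k) (h012 : T 0 1 2 = 0) (h013 : T 0 1 3 = 0)
    (h023 : T 0 2 3 = 0) (h123 : T 1 2 3 = 0) (i j k : Fin 4) : T i j k = 0 := by
  have e₁ : ∀ i k, T i i k = 0 := fun i k => by linarith [h₁ i i k]
  have e₂ : ∀ i k, T k i i = 0 := fun i k => by linarith [h₂ k i i]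
  have e₃ : ∀ i k, T i k i = 0 := fun i k => by rw [h₂, e₁, neg_zero]
  have perm : ∀ i j k, T i j k = 0 → T i k j = 0 ∧ T j i k = 0 ∧ T j k i = 0 ∧ T k i j = 0 ∧
      T k j i = 0 := by
    intro i j k h
    refine ⟨by rw [h₂, h, neg_zero], by rw [h₁, h, neg_zero], ?_, ?_, ?_⟩
    · rw [h₂, h₁, h]; simp
    · rw [h₁, h₂, h]; simp
    · rw [h₁, h₂, h₁, h]; simp
  obtain ⟨p1, p2, p3, p4, p5⟩ := perm _ _ _ h012
  obtain ⟨q1, q2, q3, q4, q5⟩ := perm _ _ _ h013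
  obtain ⟨r1, r2, r3, r4, r5⟩ := perm _ _ _ h023
  obtain ⟨s1, s2, s3, s4, s5⟩ := perm _ _ _ h123
  fin_cases i <;> fin_cases j <;> fin_cases k <;>
    first
    | exact e₁ _ _ | exact e₂ _ _ | exact e₃ _ _
    | exact h012 | exact p1 | exact p2 | exact p3 | exact p4 | exact p5
    | exact h013 | exact q1 | exact q2 | exact q3 | exact q4 | exact q5
    | exact h023 | exact r1 | exact r2 | exact r3 | exact r4 | exact r5
    | exact h123 | exact s1 | exact s2 | exact s3 | exact s4 | exact s5

/-- The exterior product of a vector and a bivector, or of a 1-form and a 2-form, at a point. -/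
def wedgeAt (P : Fin 4 → ℝ) (F : Fin 4 → Fin 4 → ℝ) (i j k : Fin 4) : ℝ :=
  P i * F j k + P j * F k i + P k * F i j

/-- Both indices of a 2-form raised by the matrix `H`. -/
def raise2 (H : Matrix (Fin 4) (Fin 4) ℝ) (F : Fin 4 → Fin 4 → ℝ) (j k : Fin 4) : ℝ :=
  ∑ j', ∑ k', H j j' * H k k' * F j' k'

variable {H : Matrix (Fin 4) (Fin 4) ℝ} {F : Fin 4 → Fin 4 → ℝ}

theorem raise2_antisymm (hF : ∀ i j, F j i = -F i j) (j k : Fin 4) :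
    raise2 H F k j = -raise2 H F j k := by
  unfold raise2
  rw [Finset.sum_comm, ← Finset.sum_neg_distrib]
  refine Finset.sum_congr rfl fun a _ => ?_
  rw [← Finset.sum_neg_distrib]
  refine Finset.sum_congr rfl fun b _ => ?_
  rw [hF a b]; ring

theorem wedgeAt_swap₁ (hF : ∀ i j, F j i = -F i j) (P : Fin 4 → ℝ) (i j k : Fin 4) :
    wedgeAt P F j i k = -wedgeAt P F i j k := by
  simp only [wedgeAt]
  linear_combination P j * hF k i + P i * hF j k + P k * hF i j

theorem wedgeAt_swap₂ (hF : ∀ i j, F j i = -F i j) (P : Fin 4 → ℝ) (i j k : Fin 4) :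
    wedgeAt P F i k j = -wedgeAt P F i j k := by
  simp only [wedgeAt]
  linear_combination P j * hF k i + P i * hF j k + P k * hF i j

theorem raise3_aux (p a b c : Fin 4 → ℝ) (F : Fin 4 → Fin 4 → ℝ) :
    ∑ i, ∑ j, ∑ k, a i * b j * c k * (p i * F j k) =
      (∑ i, a i * p i) * ∑ j, ∑ k, b j * c k * F j k := by
  rw [Finset.sum_mul]
  simp only [Finset.mul_sum]
  refine Finset.sum_congr rfl fun i _ => Finset.sum_congr rfl fun j _ =>
    Finset.sum_congr rfl fun k _ => by ring

theorem raise3_wedge (p : Fin 4 → ℝ) (i j k : Fin 4) :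
    ∑ i', ∑ j', ∑ k', H i i' * H j j' * H k k' * wedgeAt p F i' j' k' =
      wedgeAt (H *ᵥ p) (raise2 H F) i j k := by
  simp only [wedgeAt, mul_add, Finset.sum_add_distrib]
  congr 1
  · congr 1
    · exact raise3_aux p (H i) (H j) (H k) F
    · rw [show (H *ᵥ p) j * raise2 H F k i = _ from (raise3_aux p (H j) (H k) (H i) F).symm,
        Finset.sum_comm]
      refine Finset.sum_congr rfl fun a _ => ?_
      rw [Finset.sum_comm]
      refine Finset.sum_congr rfl fun b _ => Finset.sum_congr rfl fun c _ => by ring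
  · rw [show (H *ᵥ p) k * raise2 H F i j = _ from (raise3_aux p (H k) (H i) (H j) F).symm]
    rw [Finset.sum_congr rfl fun a _ => Finset.sum_comm, Finset.sum_comm]
    refine Finset.sum_congr rfl fun a _ => Finset.sum_congr rfl fun b _ =>
      Finset.sum_congr rfl fun c _ => by ring

theorem mulVec_eq_zero_of_left_inverse {G : Matrix (Fin 4) (Fin 4) ℝ} (hGH : G * H = 1)
    {v : Fin 4 → ℝ} (h : H *ᵥ v = 0) : v = 0 := by
  have := congrArg (G *ᵥ ·) h
  simpa [mulVec_mulVec, hGH] using this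

/-- Raising the three indices of a 3-tensor is injective. -/
theorem eq_zero_of_raise3 {G : Matrix (Fin 4) (Fin 4) ℝ} (hGH : G * H = 1)
    {T : Fin 4 → Fin 4 → Fin 4 → ℝ}
    (h : ∀ i j k, ∑ i', ∑ j', ∑ k', H i i' * H j j' * H k k' * T i' j' k' = 0)
    (i j k : Fin 4) : T i j k = 0 := by
  have h1 : ∀ i' j k, ∑ j', ∑ k', H j j' * H k k' * T i' j' k' = 0 := by
    intro i' j k
    refine congrFun (mulVec_eq_zero_of_left_inverse hGH
      (v := fun i' => ∑ j', ∑ k', H j j' * H k k' * T i' j' k')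
      (funext fun i => Eq.trans ?_ (h i j k))) i'
    simp only [mulVec, dotProduct, Finset.mul_sum, mul_assoc]
  have h2 : ∀ i' j' k, ∑ k', H k k' * T i' j' k' = 0 := by
    intro i' j' k
    refine congrFun (mulVec_eq_zero_of_left_inverse hGH
      (v := fun j' => ∑ k', H k k' * T i' j' k') (funext fun j => Eq.trans ?_ (h1 i' j k))) j'
    simp only [mulVec, dotProduct, Finset.mul_sum, mul_assoc]
  exact congrFun (mulVec_eq_zero_of_left_inverse hGH (v := fun k' => T i j k')
    (funext fun k => h2 i j k)) k

/-- Components of the Hodge dual of `p ∧ F`. -/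
theorem hodge3_wedge12 (g : Metric) (s : Form1) (F : Form2) (x : Pt)
    (hF : ∀ i j, F x j i = -F x i j) :
    hodge3 g (wedge12 s F) x = fun l => √|(g x).det| *
      (![-1, 1, -1, 1] l * ![wedgeAt ((g x)⁻¹ *ᵥ s x) (raise2 (g x)⁻¹ (F x)) 1 2 3,
        wedgeAt ((g x)⁻¹ *ᵥ s x) (raise2 (g x)⁻¹ (F x)) 0 2 3,
        wedgeAt ((g x)⁻¹ *ᵥ s x) (raise2 (g x)⁻¹ (F x)) 0 1 3,
        wedgeAt ((g x)⁻¹ *ᵥ s x) (raise2 (g x)⁻¹ (F x)) 0 1 2] l) := by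
  have hR := raise2_antisymm (H := (g x)⁻¹) hF
  have h := sum_levi (wedgeAt_swap₁ hR ((g x)⁻¹ *ᵥ s x)) (wedgeAt_swap₂ hR ((g x)⁻¹ *ᵥ s x))
  have h0 : hodge3 g (wedge12 s F) x = fun l => (1 / 6) * (√|(g x).det| *
      (fun l => ∑ i, ∑ j, ∑ k, levi i j k l *
        wedgeAt ((g x)⁻¹ *ᵥ s x) (raise2 (g x)⁻¹ (F x)) i j k) l) := by
    ext l
    unfold hodge3
    congr 1
    simp only [Finset.mul_sum (a := √|(g x).det|)]
    refine Finset.sum_congr rfl fun i _ => Finset.sum_congr rfl fun j _ =>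
      Finset.sum_congr rfl fun k _ => ?_
    rw [mul_assoc]
    congr 2
    exact raise3_wedge (H := (g x)⁻¹) (F := F x) (s x) i j k
  rw [h0, h]
  ext l
  fin_cases l <;> simp <;> ring

end Pointwise

/-! ### Lorentzian algebra at a point -/

section PointwiseFrame

open Matrix

/-- A trivector annihilated both by the contraction with a covector `p` and by the exterior
product with a vector `P` on which `p` does not vanish is zero. -/
theorem trivector_eq_zero {T : Fin 4 → Fin 4 → Fin 4 → ℝ} (h₁ : ∀ i j k, T j i k = -T i j k)
    (h₂ : ∀ i j k, T i k j = -T i j k) {p P : Fin 4 → ℝ} (hpP : p ⬝ᵥ P = -1)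
    (hm : ∀ k l, ∑ j, p j * T j k l = 0)
    (hQ : P 0 * T 1 2 3 - P 1 * T 0 2 3 + P 2 * T 0 1 3 - P 3 * T 0 1 2 = 0)
    (i j k : Fin 4) : T i j k = 0 := by
  have e₁ : ∀ i k, T i i k = 0 := fun i k => by linarith [h₁ i i k]
  have e₃ : ∀ i k, T i k i = 0 := fun i k => by rw [h₂, e₁, neg_zero]
  have m01 := hm 0 1
  have m02 := hm 0 2
  have m03 := hm 0 3
  have m12 := hm 1 2
  have m13 := hm 1 3
  have m23 := hm 2 3
  simp only [Fin.sum_univ_four, e₁, e₃, mul_zero, zero_add, add_zero, dotProduct]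
    at m01 m02 m03 m12 m13 m23 hpP
  rw [h₁ 0 2 1, h₂ 0 1 2, h₁ 0 3 1, h₂ 0 1 3] at m01
  rw [h₁ 0 1 2, h₁ 0 3 2, h₂ 0 2 3] at m02
  rw [h₁ 0 1 3, h₁ 0 2 3] at m03
  rw [h₁ 1 3 2, h₂ 1 2 3] at m12
  rw [h₁ 1 2 3] at m13
  refine antisymm_eq_zero h₁ h₂ ?_ ?_ ?_ ?_ i j k
  · linear_combination T 0 1 2 * hpP + p 3 * hQ - (P 0 * m12 - P 1 * m02 + P 2 * m01)
  · linear_combination T 0 1 3 * hpP - p 2 * hQ - (P 0 * m13 - P 1 * m03 + P 3 * m01)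
  · linear_combination T 0 2 3 * hpP + p 1 * hQ - (P 0 * m23 - P 2 * m03 + P 3 * m02)
  · linear_combination T 1 2 3 * hpP - p 0 * hQ - (P 1 * m23 - P 2 * m13 + P 3 * m12)

theorem sum_mul_wedgeAt (p P : Fin 4 → ℝ) (F : Fin 4 → Fin 4 → ℝ) (hF : ∀ i j, F j i = -F i j)
    (k l : Fin 4) : ∑ j, p j * wedgeAt P F j k l =
      (p ⬝ᵥ P) * F k l + (∑ j, p j * F j k) * P l - (∑ j, p j * F j l) * P k := by
  simp only [wedgeAt, dotProduct, Finset.sum_mul]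
  rw [← Finset.sum_add_distrib, ← Finset.sum_sub_distrib]
  refine Finset.sum_congr rfl fun j _ => ?_
  rw [hF j l]; ring

/-- If `F = -u ∧ a + ⋯` is a bivector with `i(p)F = A` and `P ∧ F ∧ A = 0`, then `A ∧ F = 0`. -/
theorem wedgeAt_eq_zero_of_contract {p P A : Fin 4 → ℝ} {F : Fin 4 → Fin 4 → ℝ}
    (hF : ∀ i j, F j i = -F i j) (hpP : p ⬝ᵥ P = -1) (hpA : p ⬝ᵥ A = 0)
    (hpF : ∀ k, ∑ j, p j * F j k = A k)
    (hQ : -(A 0 * wedgeAt P F 1 2 3) + A 1 * wedgeAt P F 0 2 3 - A 2 * wedgeAt P F 0 1 3 +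
      A 3 * wedgeAt P F 0 1 2 = 0) (i j k : Fin 4) : wedgeAt A F i j k = 0 := by
  refine trivector_eq_zero (wedgeAt_swap₁ hF A) (wedgeAt_swap₂ hF A) hpP (fun k l => ?_) ?_ i j k
  · rw [sum_mul_wedgeAt _ _ _ hF, hpA, hpF, hpF]; ring
  · rw [← hQ]
    simp only [wedgeAt]
    rw [hF 1 3, hF 0 3, hF 0 2]
    ring

/-- `A ∧ F = 0` means `a² F = A ∧ i(a)F`. -/
theorem decompose_of_wedgeAt_eq_zero {q A : Fin 4 → ℝ} {F : Fin 4 → Fin 4 → ℝ}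
    (hF : ∀ i j, F j i = -F i j) (h : ∀ i j k, wedgeAt A F i j k = 0) (k l : Fin 4) :
    (q ⬝ᵥ A) * F k l = A k * (∑ j, q j * F j l) - A l * (∑ j, q j * F j k) := by
  have h1 := sum_mul_wedgeAt q A F hF k l
  simp only [h, mul_zero, Finset.sum_const_zero] at h1
  linear_combination -h1

/-- Expansion of a covector in an orthogonal basis of non-null covectors. -/
theorem expand_of_orthogonal {H : Matrix (Fin 4) (Fin 4) ℝ} (E : Fin 4 → Fin 4 → ℝ)
    (horth : ∀ k l, k ≠ l → E k ⬝ᵥ H *ᵥ E l = 0) (hne : ∀ k, E k ⬝ᵥ H *ᵥ E k ≠ 0)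
    (s : Fin 4 → ℝ) (i : Fin 4) :
    s i = ∑ k, (s ⬝ᵥ H *ᵥ E k) / (E k ⬝ᵥ H *ᵥ E k) * E k i := by
  let M : Matrix (Fin 4) (Fin 4) ℝ := Matrix.of E
  let N : Matrix (Fin 4) (Fin 4) ℝ :=
    Matrix.of fun i k => (H *ᵥ E k) i / (E k ⬝ᵥ H *ᵥ E k)
  have h1 : M * N = 1 := by
    ext k l
    have : (M * N) k l = (E k ⬝ᵥ H *ᵥ E l) / (E l ⬝ᵥ H *ᵥ E l) := by
      simp only [Matrix.mul_apply, M, N, Matrix.of_apply, dotProduct, Finset.sum_div, mul_div_assoc]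
    rw [this]
    by_cases hkl : k = l
    · subst hkl; rw [div_self (hne k), Matrix.one_apply_eq]
    · rw [horth k l hkl, zero_div, Matrix.one_apply_ne hkl]
  have h2 : N * M = 1 := mul_eq_one_comm.1 h1
  have h3 : s ᵥ* (N * M) = s := by rw [h2, vecMul_one]
  rw [← vecMul_vecMul] at h3
  conv_lhs => rw [← h3]
  simp only [vecMul, dotProduct, M, N, Matrix.of_apply, Finset.sum_div, mul_div_assoc]

/-- In Minkowski space a non-space-like vector orthogonal to a unit time-like one is zero. -/
theorem minkowski_eq_zero {p0 p1 p2 p3 q0 q1 q2 q3 : ℝ}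
    (hp : -(p0 * p0) + p1 * p1 + p2 * p2 + p3 * p3 = -1)
    (hpq : -(p0 * q0) + p1 * q1 + p2 * q2 + p3 * q3 = 0)
    (hq : -(q0 * q0) + q1 * q1 + q2 * q2 + q3 * q3 ≤ 0) :
    q0 = 0 ∧ q1 = 0 ∧ q2 = 0 ∧ q3 = 0 := by
  obtain ⟨r, hr⟩ : ∃ r, r = q1 * q1 + q2 * q2 + q3 * q3 := ⟨_, rfl⟩
  -- The Cauchy-Schwarz inequality for the spatial parts.
  have hcs : (p1 * q1 + p2 * q2 + p3 * q3) ^ 2 ≤ (p1 * p1 + p2 * p2 + p3 * p3) * r := by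
    rw [hr]
    linarith [sq_nonneg (p1 * q2 - p2 * q1), sq_nonneg (p1 * q3 - p3 * q1),
      sq_nonneg (p2 * q3 - p3 * q2)]
  rw [show p1 * q1 + p2 * q2 + p3 * q3 = p0 * q0 by linarith,
    show p1 * p1 + p2 * p2 + p3 * p3 = p0 * p0 - 1 by linarith] at hcs
  have h1 : p0 * p0 * r ≤ p0 * p0 * (q0 * q0) :=
    mul_le_mul_of_nonneg_left (by linarith) (mul_self_nonneg p0)
  have hr1 : r ≤ 0 := by linarith
  have s1 := mul_self_nonneg q1
  have s2 := mul_self_nonneg q2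
  have s3 := mul_self_nonneg q3
  have z1 : q1 = 0 := mul_self_eq_zero.1 (by linarith)
  have z2 : q2 = 0 := mul_self_eq_zero.1 (by linarith)
  have z3 : q3 = 0 := mul_self_eq_zero.1 (by linarith)
  have hp0 : p0 ≠ 0 := by
    rintro rfl
    linarith [mul_self_nonneg p1, mul_self_nonneg p2, mul_self_nonneg p3]
  rw [z1, z2, z3] at hpq
  refine ⟨?_, z1, z2, z3⟩
  have : p0 * q0 = 0 := by linarith
  exact (mul_eq_zero.1 this).resolve_left hp0

/-- In Lorentzian signature, a non-zero covector orthogonal to a unit time-like one is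
space-like. -/
theorem pos_of_orthogonal {G A : Matrix (Fin 4) (Fin 4) ℝ} (hA : IsUnit A.det)
    (hG : G = Aᵀ * diagonal ![-1, 1, 1, 1] * A) {X Y : Fin 4 → ℝ}
    (hX : X ⬝ᵥ G *ᵥ X = -1) (hXY : X ⬝ᵥ G *ᵥ Y = 0) (hY : Y ≠ 0) : 0 < Y ⬝ᵥ G *ᵥ Y := by
  have key : ∀ v w : Fin 4 → ℝ, v ⬝ᵥ G *ᵥ w = -((A *ᵥ v) 0 * (A *ᵥ w) 0) +
      (A *ᵥ v) 1 * (A *ᵥ w) 1 + (A *ᵥ v) 2 * (A *ᵥ w) 2 + (A *ᵥ v) 3 * (A *ᵥ w) 3 := by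
    intro v w
    rw [hG, Matrix.mul_assoc, ← mulVec_mulVec, dotProduct_mulVec, vecMul_transpose,
      ← mulVec_mulVec]
    simp only [dotProduct, Fin.sum_univ_four, mulVec_diagonal]
    simp
  have hY' : A *ᵥ Y ≠ 0 := fun h => hY (by
    have := congrArg (A⁻¹ *ᵥ ·) h
    simpa [mulVec_mulVec, nonsing_inv_mul _ hA] using this)
  rw [key] at hX hXY ⊢
  by_contra hcon
  obtain ⟨z0, z1, z2, z3⟩ := minkowski_eq_zero hX hXY (not_lt.1 hcon)
  apply hY'
  ext i
  fin_cases i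
  exacts [z0, z1, z2, z3]

end PointwiseFrame

/-! ### Tensor calculus and the divergence of the energy tensor -/

section Calculus

open Matrix

variable {U : Set Pt} {g : Metric} {u : VField}

theorem pd_add {f h : Pt → ℝ} {x : Pt} (hf : DifferentiableAt ℝ f x)
    (hh : DifferentiableAt ℝ h x) (i : Fin 4) :
    pd i (fun y => f y + h y) x = pd i f x + pd i h x := by
  simp only [pd]; rw [fderiv_fun_add hf hh]; rfl

theorem pd_mul {f h : Pt → ℝ} {x : Pt} (hf : DifferentiableAt ℝ f x)
    (hh : DifferentiableAt ℝ h x) (i : Fin 4) :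
    pd i (fun y => f y * h y) x = pd i f x * h x + f x * pd i h x := by
  simp only [pd]; rw [fderiv_fun_mul hf hh]
  simp only [_root_.add_apply, _root_.smul_apply, smul_eq_mul]
  ring

theorem pd_sum {ι : Type} [Fintype ι] {f : ι → Pt → ℝ} {x : Pt}
    (hf : ∀ k, DifferentiableAt ℝ (f k) x) (i : Fin 4) :
    pd i (fun y => ∑ k, f k y) x = ∑ k, pd i (f k) x := by
  simp only [pd]; rw [fderiv_fun_sum fun k _ => hf k]
  simp

theorem pd_congr {f h : Pt → ℝ} (hU : IsOpen U) (hfh : ∀ y ∈ U, f y = h y) {x : Pt}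
    (hx : x ∈ U) (i : Fin 4) : pd i f x = pd i h x := by
  have : f =ᶠ[nhds x] h := by
    filter_upwards [hU.mem_nhds hx] with y hy using hfh y hy
  simp only [pd, this.fderiv_eq]

theorem pd_const (c : ℝ) (i : Fin 4) (x : Pt) : pd i (fun _ => c) x = 0 := by
  simp [pd]

theorem contDiffOn_pd {f : Pt → ℝ} (hU : IsOpen U) (hf : ContDiffOn ℝ ∞ f U) (i : Fin 4) :
    ContDiffOn ℝ ∞ (pd i f) U :=
  (hf.fderiv_of_isOpen hU (by simp)).clm_apply contDiffOn_const

theorem differentiableAt_of_contDiffOn {f : Pt → ℝ} (hU : IsOpen U) (hf : ContDiffOn ℝ ∞ f U)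
    {x : Pt} (hx : x ∈ U) : DifferentiableAt ℝ f x :=
  (hf.contDiffAt (hU.mem_nhds hx)).differentiableAt (by simp)

theorem contDiffOn_det {M : Pt → Matrix (Fin 4) (Fin 4) ℝ}
    (hM : ∀ i j, ContDiffOn ℝ ∞ (fun x => M x i j) U) :
    ContDiffOn ℝ ∞ (fun x => (M x).det) U := by
  simp only [det_apply']
  exact ContDiffOn.sum fun σ _ => contDiffOn_const.mul (contDiffOn_prod fun i _ => hM _ _)

namespace IsLorentzMetric

theorem isUnit_det (hg : IsLorentzMetric U g) {x : Pt} (hx : x ∈ U) : IsUnit (g x).det := by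
  obtain ⟨A, hA, h⟩ := hg.signature x hx
  rw [h, det_mul, det_mul, det_transpose, det_diagonal]
  refine (hA.mul ?_).mul hA
  simp [Fin.prod_univ_four]

theorem mul_inv (hg : IsLorentzMetric U g) {x : Pt} (hx : x ∈ U) : g x * (g x)⁻¹ = 1 :=
  mul_nonsing_inv _ (hg.isUnit_det hx)

theorem inv_mul (hg : IsLorentzMetric U g) {x : Pt} (hx : x ∈ U) : (g x)⁻¹ * g x = 1 :=
  nonsing_inv_mul _ (hg.isUnit_det hx)

theorem transpose_eq (hg : IsLorentzMetric U g) {x : Pt} (hx : x ∈ U) : (g x)ᵀ = g x := by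
  ext i j; exact hg.symm x hx j i

theorem inv_symm (hg : IsLorentzMetric U g) {x : Pt} (hx : x ∈ U) (i j : Fin 4) :
    (g x)⁻¹ i j = (g x)⁻¹ j i := by
  have : ((g x)⁻¹)ᵀ = (g x)⁻¹ := by rw [transpose_nonsing_inv, hg.transpose_eq hx]
  exact congrFun (congrFun this.symm i) j

theorem contDiffOn_ginv (hg : IsLorentzMetric U g) (i j : Fin 4) :
    ContDiffOn ℝ ∞ (fun x => ginv g x i j) U := by
  have h : ∀ x ∈ U, ginv g x i j = ((g x).det)⁻¹ * (g x).adjugate i j := by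
    intro x _
    simp [ginv, Matrix.inv_def]
  refine ContDiffOn.congr ?_ h
  refine ((contDiffOn_det hg.smooth).inv fun x hx => (hg.isUnit_det hx).ne_zero).mul ?_
  simp only [adjugate_apply]
  refine contDiffOn_det fun k l => ?_
  simp only [updateRow_apply]
  split_ifs
  · exact contDiffOn_const
  · exact hg.smooth k l

theorem contDiffOn_christoffel (hU : IsOpen U) (hg : IsLorentzMetric U g) (k i j : Fin 4) :
    ContDiffOn ℝ ∞ (christoffel g k i j) U := by
  refine contDiffOn_const.mul (ContDiffOn.sum fun l _ => (hg.contDiffOn_ginv k l).mul ?_)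
  exact ((contDiffOn_pd hU (hg.smooth l j) i).add (contDiffOn_pd hU (hg.smooth l i) j)).sub
    (contDiffOn_pd hU (hg.smooth i j) l)

end IsLorentzMetric

section Smoothness

variable {s t : Form1} {X : VField} {F : Form2}

theorem contDiffOn_ip (hg : IsLorentzMetric U g) (hs : ∀ i, ContDiffOn ℝ ∞ (fun x => s x i) U)
    (ht : ∀ i, ContDiffOn ℝ ∞ (fun x => t x i) U) : ContDiffOn ℝ ∞ (ip g s t) U :=
  ContDiffOn.sum fun i _ => ContDiffOn.sum fun j _ =>
    ((hg.contDiffOn_ginv i j).mul (hs i)).mul (ht j)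

theorem contDiffOn_flat (hg : IsLorentzMetric U g) (hX : ∀ i, ContDiffOn ℝ ∞ (fun x => X x i) U)
    (i : Fin 4) : ContDiffOn ℝ ∞ (fun x => flat g X x i) U :=
  ContDiffOn.sum fun j _ => (hg.smooth i j).mul (hX j)

theorem contDiffOn_d1 (hU : IsOpen U) (hs : ∀ i, ContDiffOn ℝ ∞ (fun x => s x i) U)
    (i j : Fin 4) : ContDiffOn ℝ ∞ (fun x => d1 s x i j) U :=
  (contDiffOn_pd hU (hs j) i).sub (contDiffOn_pd hU (hs i) j)

theorem contDiffOn_interior (hX : ∀ i, ContDiffOn ℝ ∞ (fun x => X x i) U)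
    (hF : ∀ i j, ContDiffOn ℝ ∞ (fun x => F x i j) U) (j : Fin 4) :
    ContDiffOn ℝ ∞ (fun x => interior X F x j) U :=
  ContDiffOn.sum fun i _ => (hX i).mul (hF i j)

theorem contDiffOn_accV (hU : IsOpen U) (hg : IsLorentzMetric U g) (hu : IsUnitTimelike U g u)
    (k : Fin 4) : ContDiffOn ℝ ∞ (fun x => accV g u x k) U :=
  ContDiffOn.sum fun i _ => (hu.smooth i).mul ((contDiffOn_pd hU (hu.smooth k) i).add
    (ContDiffOn.sum fun j _ => (hg.contDiffOn_christoffel hU k i j).mul (hu.smooth j)))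

theorem contDiffOn_acc (hU : IsOpen U) (hg : IsLorentzMetric U g) (hu : IsUnitTimelike U g u)
    (k : Fin 4) : ContDiffOn ℝ ∞ (fun x => acc g u x k) U :=
  contDiffOn_flat hg (contDiffOn_accV hU hg hu) k

theorem contDiffOn_expansion (hU : IsOpen U) (hg : IsLorentzMetric U g)
    (hu : IsUnitTimelike U g u) : ContDiffOn ℝ ∞ (expansion g u) U :=
  ContDiffOn.sum fun i _ => (contDiffOn_pd hU (hu.smooth i) i).add
    (ContDiffOn.sum fun j _ => (hg.contDiffOn_christoffel hU i i j).mul (hu.smooth j))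

end Smoothness

theorem sum_ginv_mul_metric (hg : IsLorentzMetric U g) {x : Pt} (hx : x ∈ U) (k m : Fin 4) :
    ∑ l, g x k l * ginv g x l m = if k = m then 1 else 0 := by
  have := congrFun (congrFun (hg.mul_inv hx) k) m
  rwa [Matrix.mul_apply, Matrix.one_apply] at this

/-- Christoffel symbols with the first index lowered. -/
theorem sum_metric_christoffel (hg : IsLorentzMetric U g) {x : Pt} (hx : x ∈ U) (k i j : Fin 4) :
    ∑ l, g x k l * christoffel g l i j x = (1 / 2) * (pd i (fun y => g y k j) x +
      pd j (fun y => g y k i) x - pd k (fun y => g y i j) x) := by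
  simp only [christoffel]
  have h1 : ∀ l, g x k l * (1 / 2 * ∑ m, ginv g x l m * (pd i (fun y => g y m j) x +
      pd j (fun y => g y m i) x - pd m (fun y => g y i j) x)) =
      ∑ m, g x k l * ginv g x l m * (1 / 2 * (pd i (fun y => g y m j) x +
      pd j (fun y => g y m i) x - pd m (fun y => g y i j) x)) := by
    intro l
    rw [Finset.mul_sum, Finset.mul_sum]
    exact Finset.sum_congr rfl fun m _ => by ring
  simp only [h1]
  rw [Finset.sum_comm]
  simp only [← Finset.sum_mul, sum_ginv_mul_metric hg hx]
  simp

/-- `i(u)du = a`, a consequence of `u² = -1`. -/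
theorem interior_d1_flat (hU : IsOpen U) (hg : IsLorentzMetric U g) (hu : IsUnitTimelike U g u)
    {x : Pt} (hx : x ∈ U) (k : Fin 4) :
    interior u (d1 (flat g u)) x k = acc g u x k := by
  have dg : ∀ i j, DifferentiableAt ℝ (fun y => g y i j) x := fun i j =>
    differentiableAt_of_contDiffOn hU (hg.smooth i j) hx
  have du : ∀ i, DifferentiableAt ℝ (fun y => u y i) x := fun i =>
    differentiableAt_of_contDiffOn hU (hu.smooth i) hx
  have hflat : ∀ i k, pd i (fun y => flat g u y k) x =
      ∑ l, (pd i (fun y => g y k l) x * u x l + g x k l * pd i (fun y => u y l) x) := by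
    intro i k
    simp only [flat]
    rw [pd_sum fun l => (dg k l).fun_mul (du l)]
    exact Finset.sum_congr rfl fun l _ => pd_mul (dg k l) (du l) i
  have hunit : ∑ i, ∑ j, ((pd k (fun y => g y i j) x * u x i + g x i j * pd k (fun y => u y i) x) *
      u x j + g x i j * u x i * pd k (fun y => u y j) x) = 0 := by
    rw [← pd_const (-1) k x, ← pd_congr hU hu.unit hx k,
      pd_sum fun i => DifferentiableAt.fun_sum fun j _ => ((dg i j).fun_mul (du i)).fun_mul (du j)]
    refine Finset.sum_congr rfl fun i _ => ?_
    rw [pd_sum fun j => ((dg i j).fun_mul (du i)).fun_mul (du j)]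
    refine Finset.sum_congr rfl fun j _ => ?_
    rw [pd_mul ((dg i j).fun_mul (du i)) (du j), pd_mul (dg i j) (du i)]
  have hacc : acc g u x k = ∑ i, u x i * (∑ l, g x k l * pd i (fun y => u y l) x) +
      ∑ i, u x i * ∑ j, (∑ l, g x k l * christoffel g l i j x) * u x j := by
    simp only [acc, flat, accV, Finset.mul_sum, Finset.sum_mul, mul_add, Finset.sum_add_distrib]
    congr 1
    · rw [Finset.sum_comm]
      exact Finset.sum_congr rfl fun i _ => Finset.sum_congr rfl fun l _ => by ring
    · rw [Finset.sum_comm]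
      refine Finset.sum_congr rfl fun i _ => ?_
      rw [Finset.sum_comm]
      exact Finset.sum_congr rfl fun l _ => Finset.sum_congr rfl fun j _ => by ring
  rw [hacc]
  simp only [sum_metric_christoffel hg hx, interior, d1, hflat]
  have hs := hg.symm x hx
  simp only [Fin.sum_univ_four] at hunit ⊢
  rw [hs 1 0, hs 2 0, hs 3 0, hs 2 1, hs 3 1, hs 3 2] at hunit ⊢
  linear_combination (-1 / 2) * hunit

theorem pd_ginv (hU : IsOpen U) (hg : IsLorentzMetric U g) {x : Pt} (hx : x ∈ U)
    (i a b : Fin 4) : pd i (fun y => ginv g y a b) x =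
      -∑ c, ∑ d, ginv g x a c * pd i (fun y => g y c d) x * ginv g x d b := by
  have dg : ∀ i j, DifferentiableAt ℝ (fun y => g y i j) x := fun i j =>
    differentiableAt_of_contDiffOn hU (hg.smooth i j) hx
  have dh : ∀ i j, DifferentiableAt ℝ (fun y => ginv g y i j) x := fun i j =>
    differentiableAt_of_contDiffOn hU (hg.contDiffOn_ginv i j) hx
  have h1 : ∀ c, ∑ d, (pd i (fun y => g y c d) x * ginv g x d b +
      g x c d * pd i (fun y => ginv g y d b) x) = 0 := by
    intro c
    rw [← pd_const (if c = b then 1 else 0) i x,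
      ← pd_congr hU (fun y hy => sum_ginv_mul_metric hg hy c b) hx i,
      pd_sum fun d => (dg c d).fun_mul (dh d b)]
    exact Finset.sum_congr rfl fun d _ => (pd_mul (dg c d) (dh d b) i).symm
  have h2 : (g x)⁻¹ *ᵥ (g x *ᵥ fun d => pd i (fun y => ginv g y d b) x) =
      fun d => pd i (fun y => ginv g y d b) x := by
    rw [mulVec_mulVec, hg.inv_mul hx, one_mulVec]
  rw [← congrFun h2 a]
  simp only [mulVec, dotProduct]
  rw [← Finset.sum_neg_distrib]
  refine Finset.sum_congr rfl fun c _ => ?_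
  have h3 := h1 c
  rw [Finset.sum_add_distrib] at h3
  have h4 : ∑ d, g x c d * pd i (fun y => ginv g y d b) x =
      -∑ d, pd i (fun y => g y c d) x * ginv g x d b := by linarith
  rw [h4, mul_neg, Finset.mul_sum]
  congr 1
  exact Finset.sum_congr rfl fun d _ => by simp only [ginv]; ring

theorem sum_swap₁₃ (f : Fin 4 → Fin 4 → Fin 4 → ℝ) :
    ∑ i, ∑ j, ∑ k, f i j k = ∑ i, ∑ j, ∑ k, f k j i := by
  rw [Finset.sum_comm, Finset.sum_congr rfl fun _ _ => Finset.sum_comm, Finset.sum_comm]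

/-- The contracted form of `∇g⁻¹ = 0`. -/
theorem divergence_ginv (hU : IsOpen U) (hg : IsLorentzMetric U g) {x : Pt} (hx : x ∈ U)
    (j : Fin 4) : ∑ i, (pd i (fun y => ginv g y i j) x +
      ∑ k, (christoffel g i i k x * ginv g x k j + christoffel g j i k x * ginv g x i k)) = 0 := by
  have hs : ∀ a b, ginv g x a b = ginv g x b a := hg.inv_symm hx
  have hD : ∀ i a b, pd i (fun y => g y a b) x = pd i (fun y => g y b a) x := fun i a b =>
    pd_congr hU (fun y hy => hg.symm y hy a b) hx i
  set h := fun a b => ginv g x a b with hh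
  set D := fun i a b => pd i (fun y => g y a b) x with hDD
  have e1 : ∑ i, pd i (fun y => ginv g y i j) x = -∑ i, ∑ c, ∑ d, h i c * D i c d * h d j := by
    rw [← Finset.sum_neg_distrib]
    exact Finset.sum_congr rfl fun i _ => pd_ginv hU hg hx i i j
  have e2 : ∑ i, ∑ k, christoffel g i i k x * h k j =
      (1 / 2) * ∑ i, ∑ k, ∑ m, h i m * D k m i * h k j := by
    have s1 : ∑ i, ∑ k, ∑ m, h i m * D i m k * h k j = ∑ i, ∑ k, ∑ m, h i m * D m i k * h k j := by
      rw [sum_swap₁₃]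
      exact Finset.sum_congr rfl fun i _ => Finset.sum_congr rfl fun k _ =>
        Finset.sum_congr rfl fun m _ => by simp only [hh]; rw [hs m i]
    have s2 : ∑ i, ∑ k, christoffel g i i k x * h k j = (1 / 2) *
        (∑ i, ∑ k, ∑ m, h i m * D i m k * h k j + ∑ i, ∑ k, ∑ m, h i m * D k m i * h k j -
        ∑ i, ∑ k, ∑ m, h i m * D m i k * h k j) := by
      simp only [← Finset.sum_add_distrib, ← Finset.sum_sub_distrib, Finset.mul_sum]
      refine Finset.sum_congr rfl fun i _ => Finset.sum_congr rfl fun k _ => ?_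
      simp only [christoffel, Finset.mul_sum, Finset.sum_mul]
      exact Finset.sum_congr rfl fun m _ => by simp only [hh, hDD]; ring
    rw [s2, s1]; ring
  have e3 : ∑ i, ∑ k, christoffel g j i k x * h i k =
      ∑ i, ∑ c, ∑ d, h i c * D i c d * h d j -
      (1 / 2) * ∑ i, ∑ k, ∑ m, h i m * D k m i * h k j := by
    have s1 : ∑ i, ∑ k, ∑ m, h j m * D i m k * h i k =
        ∑ i, ∑ c, ∑ d, h i c * D i c d * h d j :=
      Finset.sum_congr rfl fun i _ => Finset.sum_congr rfl fun k _ =>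
        Finset.sum_congr rfl fun m _ => by
          simp only [hh, hDD]; rw [hs j m, hD i m k]; ring
    have s2 : ∑ i, ∑ k, ∑ m, h j m * D k m i * h i k =
        ∑ i, ∑ c, ∑ d, h i c * D i c d * h d j := by
      rw [← s1, Finset.sum_comm]
      exact Finset.sum_congr rfl fun i _ => Finset.sum_congr rfl fun k _ =>
        Finset.sum_congr rfl fun m _ => by simp only [hh]; rw [hs k i]
    have s3 : ∑ i, ∑ k, ∑ m, h j m * D m i k * h i k =
        ∑ i, ∑ k, ∑ m, h i m * D k m i * h k j := by
      rw [Finset.sum_congr rfl fun _ _ => Finset.sum_comm]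
      exact Finset.sum_congr rfl fun i _ => Finset.sum_congr rfl fun k _ =>
        Finset.sum_congr rfl fun m _ => by
          simp only [hh, hDD]; rw [hs j k, hD k m i]; ring
    have s4 : ∑ i, ∑ k, christoffel g j i k x * h i k = (1 / 2) *
        (∑ i, ∑ k, ∑ m, h j m * D i m k * h i k + ∑ i, ∑ k, ∑ m, h j m * D k m i * h i k -
        ∑ i, ∑ k, ∑ m, h j m * D m i k * h i k) := by
      simp only [← Finset.sum_add_distrib, ← Finset.sum_sub_distrib, Finset.mul_sum]
      refine Finset.sum_congr rfl fun i _ => Finset.sum_congr rfl fun k _ => ?_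
      simp only [christoffel, Finset.mul_sum, Finset.sum_mul]
      exact Finset.sum_congr rfl fun m _ => by simp only [hh, hDD]; ring
    rw [s4, s1, s2, s3]; ring
  simp only [Finset.sum_add_distrib]
  rw [e1, e2, e3]
  ring

/-- The divergence of the energy tensor, with `r = ρ + p`. -/
theorem divT_energyTensor (hU : IsOpen U) (hg : IsLorentzMetric U g) (hu : IsUnitTimelike U g u)
    {rho p : Pt → ℝ} {x : Pt} (hx : x ∈ U) (hrho : DifferentiableAt ℝ rho x)
    (hp : DifferentiableAt ℝ p x) (j : Fin 4) :
    divT g (energyTensor g u rho p) x j =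
      (dotD u (fun y => rho y + p y) x + (rho x + p x) * expansion g u x) * u x j +
      (rho x + p x) * accV g u x j + ∑ i, ginv g x j i * pd i p x := by
  have du : ∀ i, DifferentiableAt ℝ (fun y => u y i) x := fun i =>
    differentiableAt_of_contDiffOn hU (hu.smooth i) hx
  have dh : ∀ i j, DifferentiableAt ℝ (fun y => ginv g y i j) x := fun i j =>
    differentiableAt_of_contDiffOn hU (hg.contDiffOn_ginv i j) hx
  have hr : DifferentiableAt ℝ (fun y => rho y + p y) x := hrho.fun_add hp
  have hT : ∀ i, pd i (energyTensor g u rho p i j) x =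
      pd i (fun y => rho y + p y) x * u x i * u x j +
      (rho x + p x) * pd i (fun y => u y i) x * u x j +
      (rho x + p x) * u x i * pd i (fun y => u y j) x + pd i p x * ginv g x i j
      + p x * pd i (fun y => ginv g y i j) x := by
    intro i
    have : energyTensor g u rho p i j =
        fun y => (rho y + p y) * u y i * u y j + p y * ginv g y i j := rfl
    rw [this, pd_add ((hr.fun_mul (du i)).fun_mul (du j)) (hp.fun_mul (dh i j)),
      pd_mul (hr.fun_mul (du i)) (du j), pd_mul hr (du i), pd_mul hp (dh i j)]
    ring
  have hz := divergence_ginv hU hg hx j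
  have hs : ∀ a b, ginv g x a b = ginv g x b a := hg.inv_symm hx
  simp only [divT, hT, energyTensor, dotD, expansion, accV]
  have r1 : ∑ i, ginv g x j i * pd i p x = ∑ i, ginv g x i j * pd i p x :=
    Finset.sum_congr rfl fun i _ => by rw [hs i j]
  rw [r1]
  simp only [Fin.sum_univ_four] at hz ⊢
  linear_combination (p x) * hz

/-- Conservation of a perfect energy tensor in terms of `p` and `r = ρ + p`: the components of
`∇·T = 0` orthogonal to `u` and along `u`. -/
theorem divT_eq_zero_iff (hU : IsOpen U) (hg : IsLorentzMetric U g) (hu : IsUnitTimelike U g u)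
    {rho p : Pt → ℝ} {x : Pt} (hx : x ∈ U) (hrho : DifferentiableAt ℝ rho x)
    (hp : DifferentiableAt ℝ p x) (hua : ∑ k, u x k * acc g u x k = 0) :
    divT g (energyTensor g u rho p) x = 0 ↔
      (∀ k, pd k p x = -(dotD u p x) * flat g u x k - (rho x + p x) * acc g u x k) ∧
      dotD u (fun y => rho y + p y) x + (rho x + p x) * expansion g u x = dotD u p x := by
  set R := dotD u (fun y => rho y + p y) x + (rho x + p x) * expansion g u x with hR
  have hdiv : divT g (energyTensor g u rho p) x =
      R • u x + (rho x + p x) • accV g u x + (g x)⁻¹ *ᵥ (fun i => pd i p x) := by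
    ext j
    rw [divT_energyTensor hU hg hu hx hrho hp]
    rfl
  have hlow : g x *ᵥ divT g (energyTensor g u rho p) x =
      fun k => R * flat g u x k + (rho x + p x) * acc g u x k + pd k p x := by
    rw [hdiv, mulVec_add, mulVec_add, mulVec_smul, mulVec_smul, mulVec_mulVec, hg.mul_inv hx,
      one_mulVec]
    rfl
  have huu : ∑ k, u x k * flat g u x k = -1 := by
    rw [← hu.unit x hx]
    simp only [flat, Finset.mul_sum]
    exact Finset.sum_congr rfl fun i _ => Finset.sum_congr rfl fun j _ => by ring
  have hcontr : ∑ k, u x k * (R * flat g u x k + (rho x + p x) * acc g u x k + pd k p x) =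
      -R + dotD u p x := by
    have : ∀ k, u x k * (R * flat g u x k + (rho x + p x) * acc g u x k + pd k p x) =
        R * (u x k * flat g u x k) + (rho x + p x) * (u x k * acc g u x k) + u x k * pd k p x :=
      fun k => by ring
    simp only [this, Finset.sum_add_distrib, ← Finset.mul_sum, huu, hua, dotD]
    ring
  have hiff : divT g (energyTensor g u rho p) x = 0 ↔
      ∀ k, R * flat g u x k + (rho x + p x) * acc g u x k + pd k p x = 0 := by
    constructor
    · intro h k
      rw [h, mulVec_zero] at hlow
      exact (congrFun hlow k).symm
    · intro h
      refine mulVec_eq_zero_of_left_inverse (hg.inv_mul hx) (hlow.trans (funext h))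
  rw [hiff]
  constructor
  · intro h
    simp only [h, mul_zero, Finset.sum_const_zero] at hcontr
    have hRp : R = dotD u p x := by linarith
    exact ⟨fun k => by rw [← hRp]; linarith [h k], hRp⟩
  · rintro ⟨h1, h2⟩ k
    rw [h1 k, h2]; ring

end Calculus

/-! ### The orthogonal frame of the flow -/

section Frame

open Matrix

variable {U : Set Pt} {g : Metric} {u : VField}

/-- The vector `s / s²` associated with a 1-form `s`; `s ↦ (s, e) / e²` is the contraction with
it. -/
noncomputable def unitDual (g : Metric) (s : Form1) : VField := fun x =>
  (ip g s s x)⁻¹ • ((g x)⁻¹ *ᵥ s x)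

/-- At the point `x`, the 1-forms `u, a, b, w` are an orthogonal basis, so that the coefficients of
a 1-form are its values on `-u`, `a / a²`, `b / b²`, `w / w²`; in this basis
`du = a ∧ (u + b)` and `da = a ∧ c` with `c = c_u u + c_b b`. -/
structure AdaptedFrame (g : Metric) (u : VField) (x : Pt) : Prop where
  u_u : flat g u x ⬝ᵥ u x = -1
  u_a : flat g u x ⬝ᵥ unitDual g (acc g u) x = 0
  u_b : flat g u x ⬝ᵥ unitDual g (bForm g u) x = 0
  u_w : flat g u x ⬝ᵥ unitDual g (rot g u) x = 0
  a_u : acc g u x ⬝ᵥ u x = 0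
  a_a : acc g u x ⬝ᵥ unitDual g (acc g u) x = 1
  a_b : acc g u x ⬝ᵥ unitDual g (bForm g u) x = 0
  a_w : acc g u x ⬝ᵥ unitDual g (rot g u) x = 0
  b_u : bForm g u x ⬝ᵥ u x = 0
  b_a : bForm g u x ⬝ᵥ unitDual g (acc g u) x = 0
  b_b : bForm g u x ⬝ᵥ unitDual g (bForm g u) x = 1
  b_w : bForm g u x ⬝ᵥ unitDual g (rot g u) x = 0
  expand : ∀ (s : Fin 4 → ℝ) (i : Fin 4), s i = -(s ⬝ᵥ u x) * flat g u x i +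
    (s ⬝ᵥ unitDual g (acc g u) x) * acc g u x i +
    (s ⬝ᵥ unitDual g (bForm g u) x) * bForm g u x i +
    (s ⬝ᵥ unitDual g (rot g u) x) * rot g u x i
  du : ∀ i j, d1 (flat g u) x i j = acc g u x i * (flat g u x j + bForm g u x j) -
    acc g u x j * (flat g u x i + bForm g u x i)
  da : ∀ i j, d1 (acc g u) x i j = acc g u x i * cForm g u x j - acc g u x j * cForm g u x i
  c_eq : ∀ i, cForm g u x i = cu g u x * flat g u x i + cb g u x * bForm g u x i
  ip_a_pos : 0 < ip g (acc g u) (acc g u) x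
  ip_b_pos : 0 < ip g (bForm g u) (bForm g u) x

theorem ip_eq (g : Metric) (s t : Form1) (x : Pt) : ip g s t x = s x ⬝ᵥ (g x)⁻¹ *ᵥ t x := by
  simp only [ip, dotProduct, mulVec, Finset.mul_sum, ginv]
  exact Finset.sum_congr rfl fun i _ => Finset.sum_congr rfl fun j _ => by ring

theorem ip_comm (hg : IsLorentzMetric U g) {x : Pt} (hx : x ∈ U) (s t : Form1) :
    ip g s t x = ip g t s x := by
  unfold ip
  rw [Finset.sum_comm]
  refine Finset.sum_congr rfl fun i _ => Finset.sum_congr rfl fun j _ => ?_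
  rw [show ginv g x j i = ginv g x i j from hg.inv_symm hx j i]; ring

theorem dot_unitDual (g : Metric) (s t : Form1) (x : Pt) :
    s x ⬝ᵥ unitDual g t x = ip g s t x / ip g t t x := by
  rw [unitDual, dotProduct_smul, ← ip_eq, smul_eq_mul, inv_mul_eq_div]

theorem starD_eq (f : Pt → ℝ) (x : Pt) :
    starD g u f x = dS f x ⬝ᵥ unitDual g (acc g u) x := (dot_unitDual _ _ _ _).symm

theorem tildeD_eq (f : Pt → ℝ) (x : Pt) :
    tildeD g u f x = dS f x ⬝ᵥ unitDual g (bForm g u) x := (dot_unitDual _ _ _ _).symm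

theorem hatD_eq (f : Pt → ℝ) (x : Pt) :
    hatD g u f x = dS f x ⬝ᵥ unitDual g (rot g u) x := (dot_unitDual _ _ _ _).symm

theorem dotD_eq (f : Pt → ℝ) (x : Pt) : dotD u f x = dS f x ⬝ᵥ u x := dotProduct_comm _ _

theorem d1_antisymm (s : Form1) (x : Pt) (i j : Fin 4) : d1 s x j i = -d1 s x i j := by
  simp only [d1]; ring

theorem sum_sum_antisymm {F : Fin 4 → Fin 4 → ℝ} (hF : ∀ i j, F j i = -F i j) (X : Fin 4 → ℝ) :
    ∑ j, (∑ i, X i * F i j) * X j = 0 := by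
  simp only [Finset.sum_mul]
  have h : ∑ j, ∑ i, X i * F i j * X j = -∑ j, ∑ i, X i * F i j * X j := by
    conv_lhs => rw [Finset.sum_comm]
    rw [← Finset.sum_neg_distrib]
    refine Finset.sum_congr rfl fun i _ => ?_
    rw [← Finset.sum_neg_distrib]
    exact Finset.sum_congr rfl fun j _ => by rw [hF j i]; ring
  linarith

/-- The product of a 1-form with a Hodge dual, as a determinant-like expression in raised
components. -/
theorem ip_hodge3 (hg : IsLorentzMetric U g) {x : Pt} (hx : x ∈ U) (s p : Form1) (F : Form2)
    (hF : ∀ i j, F x j i = -F x i j) {S P : Fin 4 → ℝ} {R : Fin 4 → Fin 4 → ℝ}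
    (hS : (g x)⁻¹ *ᵥ s x = S) (hP : (g x)⁻¹ *ᵥ p x = P) (hR : raise2 (g x)⁻¹ (F x) = R) :
    ip g s (hodge3 g (wedge12 p F)) x = √|(g x).det| *
      (-(S 0 * wedgeAt P R 1 2 3) + S 1 * wedgeAt P R 0 2 3 - S 2 * wedgeAt P R 0 1 3 +
        S 3 * wedgeAt P R 0 1 2) := by
  subst hS hP hR
  rw [ip_comm hg hx, ip_eq, hodge3_wedge12 g p F x hF]
  simp only [dotProduct, Fin.sum_univ_four]
  simp
  ring

theorem raise2_contract (hg : IsLorentzMetric U g) {x : Pt} (hx : x ∈ U) (s : Fin 4 → ℝ)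
    (F : Fin 4 → Fin 4 → ℝ) (k : Fin 4) :
    ∑ j, s j * raise2 (g x)⁻¹ F j k =
      ((g x)⁻¹ *ᵥ fun k' => ∑ j', ((g x)⁻¹ *ᵥ s) j' * F j' k') k := by
  have hs := hg.inv_symm hx
  simp only [raise2, mulVec, dotProduct, Finset.mul_sum, Finset.sum_mul]
  rw [sum_swap₁₃]
  refine Finset.sum_congr rfl fun a _ => Finset.sum_congr rfl fun b _ =>
    Finset.sum_congr rfl fun c _ => by rw [hs c b]; ring

theorem raise2_wedge (H : Matrix (Fin 4) (Fin 4) ℝ) (s t : Fin 4 → ℝ) (j k : Fin 4) :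
    raise2 H (fun i j => s i * t j - s j * t i) j k =
      (H *ᵥ s) j * (H *ᵥ t) k - (H *ᵥ s) k * (H *ᵥ t) j := by
  rw [mul_comm ((H *ᵥ s) k)]
  simp only [raise2, mulVec, dotProduct, Finset.sum_mul_sum]
  rw [← Finset.sum_sub_distrib]
  refine Finset.sum_congr rfl fun a _ => ?_
  rw [← Finset.sum_sub_distrib]
  exact Finset.sum_congr rfl fun b _ => by ring

/-- A non-zero 1-form orthogonal to `u` is space-like. -/
theorem ip_pos_of_orthogonal (hg : IsLorentzMetric U g) (hu : IsUnitTimelike U g u) {x : Pt}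
    (hx : x ∈ U) {s : Form1} (hs : s x ⬝ᵥ u x = 0) (hne : s x ≠ 0) : 0 < ip g s s x := by
  obtain ⟨A, hA, hG⟩ := hg.signature x hx
  have hlow : g x *ᵥ ((g x)⁻¹ *ᵥ s x) = s x := by rw [mulVec_mulVec, hg.mul_inv hx, one_mulVec]
  have h := pos_of_orthogonal hA hG (X := u x) (Y := (g x)⁻¹ *ᵥ s x) ?_ ?_ ?_
  · rwa [hlow, dotProduct_comm, ← ip_eq] at h
  · rw [← hu.unit x hx]
    simp only [dotProduct, mulVec, Finset.mul_sum]
    exact Finset.sum_congr rfl fun i _ => Finset.sum_congr rfl fun j _ => by ring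
  · rw [hlow, dotProduct_comm, hs]
  · exact fun h => hne (mulVec_eq_zero_of_left_inverse (hg.mul_inv hx) h)

/-- The algebraic hypotheses `(a, w) = (c, w) = 0`, `v = 0` and `a, w ≠ 0` give the frame. -/
theorem adaptedFrame (hU : IsOpen U) (hg : IsLorentzMetric U g) (hu : IsUnitTimelike U g u)
    (hC : IsFlowClass U g u) {x : Pt} (hx : x ∈ U) : AdaptedFrame g u x := by
  have hH := hg.inv_mul hx
  have hHu : (g x)⁻¹ *ᵥ flat g u x = u x := by
    change (g x)⁻¹ *ᵥ (g x *ᵥ u x) = u x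
    rw [mulVec_mulVec, hH, one_mulVec]
  have hHa : (g x)⁻¹ *ᵥ acc g u x = accV g u x := by
    change (g x)⁻¹ *ᵥ (g x *ᵥ accV g u x) = _
    rw [mulVec_mulVec, hH, one_mulVec]
  set F := d1 (flat g u) with hFdef
  have hF : ∀ i j, F x j i = -F x i j := d1_antisymm (flat g u) x
  have hGa : ∀ i j, d1 (acc g u) x j i = -d1 (acc g u) x i j := d1_antisymm (acc g u) x
  have huF : ∀ k, ∑ i, u x i * F x i k = acc g u x k := interior_d1_flat hU hg hu hx
  have uu : flat g u x ⬝ᵥ u x = -1 := by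
    rw [← hu.unit x hx]
    simp only [flat, dotProduct, Finset.sum_mul]
    exact Finset.sum_congr rfl fun i _ => Finset.sum_congr rfl fun j _ => by ring
  have au : acc g u x ⬝ᵥ u x = 0 := by
    rw [← sum_sum_antisymm hF (u x)]
    simp only [huF, dotProduct]
  have ipu : ∀ s : Form1, ip g s (flat g u) x = s x ⬝ᵥ u x := fun s => by rw [ip_eq, hHu]
  have ipa : ∀ s : Form1, ip g s (acc g u) x = s x ⬝ᵥ accV g u x := fun s => by rw [ip_eq, hHa]
  have ua : flat g u x ⬝ᵥ accV g u x = 0 := by rw [← ipa, ip_comm hg hx, ipu, au]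
  have ha2 : 0 < ip g (acc g u) (acc g u) x :=
    ip_pos_of_orthogonal hg hu hx au (hC.nongeodesic x hx)
  set R := raise2 (g x)⁻¹ (F x) with hR
  have hRa : ∀ i j, R j i = -R i j := raise2_antisymm hF
  have hdet : √|(g x).det| ≠ 0 :=
    (Real.sqrt_pos.2 (abs_pos.2 (hg.isUnit_det hx).ne_zero)).ne'
  have huR : ∀ k, ∑ j, flat g u x j * R j k = accV g u x k := by
    intro k
    rw [raise2_contract hg hx, hHu]
    simp only [huF]
    exact congrFun hHa k
  -- `(a, w) = 0` is `a ∧ u ∧ du = 0`; with `i(u)du = a` it gives `a ∧ du = 0`.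
  have hAR : ∀ i j k, wedgeAt (accV g u x) R i j k = 0 := by
    refine wedgeAt_eq_zero_of_contract hRa uu ua huR ?_
    have h := hC.acc_rot x hx
    rw [rot, ip_hodge3 hg hx _ _ _ hF hHa hHu rfl] at h
    exact (mul_eq_zero.1 h).resolve_left hdet
  have hlower : ∀ (s : Fin 4 → ℝ) (F : Fin 4 → Fin 4 → ℝ),
      (∀ i j k, wedgeAt ((g x)⁻¹ *ᵥ s) (raise2 (g x)⁻¹ F) i j k = 0) →
      ∀ i j k, wedgeAt s F i j k = 0 := fun s F h =>
    eq_zero_of_raise3 (hg.mul_inv hx) fun i j k => by rw [raise3_wedge, h]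
  have haF : ∀ i j k, wedgeAt (acc g u x) (F x) i j k = 0 := by
    refine hlower _ _ ?_
    rw [hHa]; exact hAR
  have hqa : accV g u x ⬝ᵥ acc g u x = ip g (acc g u) (acc g u) x := by
    rw [ipa, dotProduct_comm]
  have hdu : ∀ i j, F x i j = acc g u x i * (flat g u x j + bForm g u x j) -
      acc g u x j * (flat g u x i + bForm g u x i) := by
    intro i j
    have h := decompose_of_wedgeAt_eq_zero (q := accV g u x) hF haF i j
    rw [hqa] at h
    have hb : ∀ i, flat g u x i + bForm g u x i =
        (1 / ip g (acc g u) (acc g u) x) * ∑ j, accV g u x j * F x j i := by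
      intro i; simp only [bForm, interior]; ring
    rw [hb, hb]
    have := ha2.ne'
    field_simp
    linarith
  -- `v = 0` is `a ∧ da = 0`.
  have haG : ∀ i j k, wedgeAt (acc g u x) (d1 (acc g u) x) i j k = 0 := by
    refine hlower _ _ ?_
    have hv := hC.accRot_zero x hx
    rw [accRot, hodge3_wedge12 g _ _ x hGa] at hv
    have h0 := congrFun hv 0
    have h1 := congrFun hv 1
    have h2 := congrFun hv 2
    have h3 := congrFun hv 3
    simp [hdet] at h0 h1 h2 h3
    have hRG := raise2_antisymm (H := (g x)⁻¹) hGa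
    exact antisymm_eq_zero (wedgeAt_swap₁ hRG _) (wedgeAt_swap₂ hRG _) h3 h2 h1 h0
  have hda : ∀ i j, d1 (acc g u) x i j =
      acc g u x i * cForm g u x j - acc g u x j * cForm g u x i := by
    intro i j
    have h := decompose_of_wedgeAt_eq_zero (q := accV g u x) hGa haG i j
    rw [hqa] at h
    have hc : ∀ i, cForm g u x i =
        (1 / ip g (acc g u) (acc g u) x) * ∑ j, accV g u x j * d1 (acc g u) x j i := fun i => rfl
    rw [hc, hc]
    have := ha2.ne'
    field_simp
    linarith
  have hbX : ∀ X : Fin 4 → ℝ, bForm g u x ⬝ᵥ X = -(flat g u x ⬝ᵥ X) +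
      (1 / ip g (acc g u) (acc g u) x) * ∑ j, (∑ i, accV g u x i * F x i j) * X j := by
    intro X
    simp only [dotProduct]
    rw [Finset.mul_sum, ← Finset.sum_neg_distrib, ← Finset.sum_add_distrib]
    refine Finset.sum_congr rfl fun j _ => ?_
    simp only [bForm, interior]
    ring
  have bu : bForm g u x ⬝ᵥ u x = 0 := by
    have h1 : ∑ j, (∑ i, accV g u x i * F x i j) * u x j = -ip g (acc g u) (acc g u) x := by
      rw [← hqa]
      simp only [Finset.sum_mul, dotProduct]
      rw [Finset.sum_comm, ← Finset.sum_neg_distrib]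
      refine Finset.sum_congr rfl fun i _ => ?_
      rw [← huF i, Finset.mul_sum, ← Finset.sum_neg_distrib]
      exact Finset.sum_congr rfl fun j _ => by rw [hF j i]; ring
    rw [hbX, h1, uu]
    have := ha2.ne'
    field_simp
    ring
  have ba : bForm g u x ⬝ᵥ accV g u x = 0 := by
    have h1 := sum_sum_antisymm hF (accV g u x)
    rw [hbX, h1, ua]; ring
  -- If `b` vanished, then `du = a ∧ u` and `w = *(u ∧ du) = 0`.
  have hbne : bForm g u x ≠ 0 := by
    intro hb
    refine hC.rotating x hx ?_
    have h1 : ∀ i j k, wedgeAt (flat g u x) (F x) i j k = 0 := by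
      intro i j k
      simp only [wedgeAt, hdu, hb, Pi.zero_apply]
      ring
    have h2 : ∀ i j k, wedgeAt ((g x)⁻¹ *ᵥ flat g u x) (raise2 (g x)⁻¹ (F x)) i j k = 0 := by
      intro i j k
      rw [← raise3_wedge]
      simp [h1]
    rw [rot, hodge3_wedge12 g _ _ x hF]
    ext l
    fin_cases l <;> simp [h2]
  have hb2 : 0 < ip g (bForm g u) (bForm g u) x := ip_pos_of_orthogonal hg hu hx bu hbne
  have uw : ip g (flat g u) (rot g u) x = 0 := by
    rw [rot, ip_hodge3 hg hx _ _ _ hF hHu hHu rfl]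
    simp only [wedgeAt]
    rw [← hR, hRa 1 3, hRa 0 3, hRa 0 2]
    ring
  have hRw : ∀ j k, R j k = accV g u x j * (u x k + ((g x)⁻¹ *ᵥ bForm g u x) k) -
      accV g u x k * (u x j + ((g x)⁻¹ *ᵥ bForm g u x) j) := by
    intro j k
    have h1 : F x = fun i j => acc g u x i * (flat g u x + bForm g u x) j -
        acc g u x j * (flat g u x + bForm g u x) i := by
      ext i j; exact hdu i j
    rw [hR, h1, raise2_wedge, hHa, mulVec_add, hHu]
    rfl
  have bw : ip g (bForm g u) (rot g u) x = 0 := by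
    rw [rot, ip_hodge3 hg hx _ _ _ hF rfl hHu rfl]
    simp only [wedgeAt]
    simp only [← hR, hRw]
    ring
  have aw := hC.acc_rot x hx
  have hw2 : 0 < ip g (rot g u) (rot g u) x := by
    refine ip_pos_of_orthogonal hg hu hx ?_ (hC.rotating x hx)
    rw [← ipu, ip_comm hg hx, uw]
  have sym : ∀ s t : Form1, ip g s t x = 0 → ip g t s x = 0 := fun s t h => by
    rw [ip_comm hg hx, h]
  have ipuu : ip g (flat g u) (flat g u) x = -1 := by rw [ipu, uu]
  have ipau : ip g (acc g u) (flat g u) x = 0 := by rw [ipu, au]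
  have ipbu : ip g (bForm g u) (flat g u) x = 0 := by rw [ipu, bu]
  have ipba : ip g (bForm g u) (acc g u) x = 0 := by rw [ipa, ba]
  have hexp : ∀ (s : Fin 4 → ℝ) (i : Fin 4), s i = -(s ⬝ᵥ u x) * flat g u x i +
      (s ⬝ᵥ unitDual g (acc g u) x) * acc g u x i +
      (s ⬝ᵥ unitDual g (bForm g u) x) * bForm g u x i +
      (s ⬝ᵥ unitDual g (rot g u) x) * rot g u x i := by
    intro s i
    have h := expand_of_orthogonal (H := (g x)⁻¹)
      ![flat g u x, acc g u x, bForm g u x, rot g u x] ?_ ?_ s i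
    · conv_lhs => rw [h]
      simp only [Fin.sum_univ_four]
      simp only [cons_val_zero, cons_val_one, cons_val, unitDual, dotProduct_smul, smul_eq_mul,
        ← ip_eq, hHu, uu]
      ring
    · intro k l hkl
      fin_cases k <;> fin_cases l <;> first | exact absurd rfl hkl | skip
      all_goals
        simp only [Fin.zero_eta, Fin.mk_one, Fin.reduceFinMk, cons_val_zero, cons_val_one,
          cons_val, ← ip_eq]
      exacts [sym _ _ ipau, sym _ _ ipbu, uw, ipau, sym _ _ ipba, aw, ipbu, ipba, bw,
        sym _ _ uw, sym _ _ aw, sym _ _ bw]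
    · intro k
      fin_cases k <;>
        simp only [Fin.zero_eta, Fin.mk_one, Fin.reduceFinMk, cons_val_zero, cons_val_one,
          cons_val, ← ip_eq]
      exacts [by rw [ipuu]; norm_num, ha2.ne', hb2.ne', hw2.ne']
  have hca : ip g (cForm g u) (acc g u) x = 0 := by
    rw [ipa]
    have h1 := sum_sum_antisymm hGa (accV g u x)
    have h2 : cForm g u x ⬝ᵥ accV g u x = (1 / ip g (acc g u) (acc g u) x) *
        ∑ j, (∑ i, accV g u x i * d1 (acc g u) x i j) * accV g u x j := by
      simp only [cForm, interior, dotProduct, Finset.mul_sum]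
      refine Finset.sum_congr rfl fun i _ => ?_
      rw [Finset.sum_mul, Finset.sum_mul, Finset.mul_sum]
      exact Finset.sum_congr rfl fun j _ => by ring
    rw [h2, h1, mul_zero]
  have D := fun s t : Form1 => dot_unitDual g s t x
  refine
    { u_u := uu, a_u := au, b_u := bu, expand := hexp, du := hdu, da := hda
      u_a := by rw [D, sym _ _ ipau, zero_div]
      u_b := by rw [D, sym _ _ ipbu, zero_div]
      u_w := by rw [D, uw, zero_div]
      a_a := by rw [D, div_self ha2.ne']
      a_b := by rw [D, sym _ _ ipba, zero_div]
      a_w := by rw [D, aw, zero_div]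
      b_a := by rw [D, ipba, zero_div]
      b_b := by rw [D, div_self hb2.ne']
      b_w := by rw [D, bw, zero_div]
      c_eq := fun i => ?_
      ip_a_pos := ha2
      ip_b_pos := hb2 }
  have h := hexp (cForm g u x) i
  rw [D, D, D, hca, hC.c_rot x hx, ← ipu] at h
  rw [h, cu, cb]
  ring

end Frame

/-! ### Integrability conditions in the frame -/

section FrameCalculus

open Matrix

variable {U V : Set Pt} {g : Metric} {u : VField}

theorem dS_dot (f : Pt → ℝ) (x : Pt) (X : Fin 4 → ℝ) : dS f x ⬝ᵥ X = fderiv ℝ f x X := by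
  conv_rhs => rw [pi_eq_sum_univ' X]
  simp only [map_sum, map_smul, smul_eq_mul, dotProduct, dS, pd]
  exact Finset.sum_congr rfl fun i _ => by
    rw [mul_comm]

theorem dS_add_dot {f h : Pt → ℝ} {x : Pt} (hf : DifferentiableAt ℝ f x)
    (hh : DifferentiableAt ℝ h x) (X : Fin 4 → ℝ) :
    dS (fun y => f y + h y) x ⬝ᵥ X = dS f x ⬝ᵥ X + dS h x ⬝ᵥ X := by
  simp only [dS_dot]; rw [fderiv_fun_add hf hh]; rfl

theorem dS_mul_dot {f h : Pt → ℝ} {x : Pt} (hf : DifferentiableAt ℝ f x)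
    (hh : DifferentiableAt ℝ h x) (X : Fin 4 → ℝ) :
    dS (fun y => f y * h y) x ⬝ᵥ X = (dS f x ⬝ᵥ X) * h x + f x * (dS h x ⬝ᵥ X) := by
  simp only [dS_dot]; rw [fderiv_fun_mul hf hh]
  simp only [_root_.add_apply, _root_.smul_apply, smul_eq_mul]
  ring

theorem dS_const_mul_dot {f : Pt → ℝ} {x : Pt} (hf : DifferentiableAt ℝ f x) (r : ℝ)
    (X : Fin 4 → ℝ) : dS (fun y => r * f y) x ⬝ᵥ X = r * (dS f x ⬝ᵥ X) := by
  simp only [dS_dot]; rw [fderiv_const_mul hf]; rfl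

theorem dS_congr {f h : Pt → ℝ} (hV : IsOpen V) (hfh : ∀ y ∈ V, f y = h y) {x : Pt}
    (hx : x ∈ V) : dS f x = dS h x :=
  funext fun i => pd_congr hV hfh hx i

theorem contDiffOn_dotD {f : Pt → ℝ} (hV : IsOpen V) (hu : ∀ i, ContDiffOn ℝ ∞ (fun x => u x i) V)
    (hf : ContDiffOn ℝ ∞ f V) : ContDiffOn ℝ ∞ (dotD u f) V :=
  ContDiffOn.sum fun i _ => (hu i).mul (contDiffOn_pd hV hf i)

/-- The value of a 2-form, given by its components, on two vectors. -/
def pairing (F : Fin 4 → Fin 4 → ℝ) (X Y : Fin 4 → ℝ) : ℝ := ∑ i, ∑ j, F i j * X i * Y j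

theorem pairing_wedge {F : Fin 4 → Fin 4 → ℝ} {s t : Fin 4 → ℝ}
    (hF : ∀ i j, F i j = s i * t j - s j * t i) (X Y : Fin 4 → ℝ) :
    pairing F X Y = (s ⬝ᵥ X) * (t ⬝ᵥ Y) - (s ⬝ᵥ Y) * (t ⬝ᵥ X) := by
  rw [mul_comm (s ⬝ᵥ Y)]
  simp only [pairing, hF, dotProduct, Finset.sum_mul_sum]
  rw [← Finset.sum_sub_distrib]
  refine Finset.sum_congr rfl fun i _ => ?_
  rw [← Finset.sum_sub_distrib]
  exact Finset.sum_congr rfl fun j _ => by ring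

theorem pd_pd_comm {f : Pt → ℝ} (hV : IsOpen V) (hf : ContDiffOn ℝ ∞ f V) {x : Pt} (hx : x ∈ V)
    (i j : Fin 4) : pd i (pd j f) x = pd j (pd i f) x :=
  fderiv_fderiv_comm (hf.contDiffAt (hV.mem_nhds hx)) (Pi.single i 1) (Pi.single j 1)

/-- The relation `∑ (df_k ∧ s_k + f_k ds_k) = 0` obtained by differentiating
`dp = ∑ f_k s_k`. -/
theorem sum_eq_zero_of_dS_eq {n : ℕ} {p : Pt → ℝ} {f : Fin n → Pt → ℝ} {s : Fin n → Form1}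
    (hV : IsOpen V) (hp : ContDiffOn ℝ ∞ p V) (hf : ∀ k, ContDiffOn ℝ ∞ (f k) V)
    (hs : ∀ k i, ContDiffOn ℝ ∞ (fun x => s k x i) V)
    (h : ∀ y ∈ V, ∀ i, pd i p y = ∑ k, f k y * s k y i) {x : Pt} (hx : x ∈ V)
    (X Y : Fin 4 → ℝ) :
    ∑ k, ((dS (f k) x ⬝ᵥ X) * (s k x ⬝ᵥ Y) - (dS (f k) x ⬝ᵥ Y) * (s k x ⬝ᵥ X) +
      f k x * pairing (d1 (s k) x) X Y) = 0 := by
  have df : ∀ k, DifferentiableAt ℝ (f k) x := fun k => differentiableAt_of_contDiffOn hV (hf k) hx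
  have ds : ∀ k i, DifferentiableAt ℝ (fun x => s k x i) x := fun k i =>
    differentiableAt_of_contDiffOn hV (hs k i) hx
  have h1 : ∀ i j, pd i (pd j p) x =
      ∑ k, (pd i (f k) x * s k x j + f k x * pd i (fun y => s k y j) x) := by
    intro i j
    rw [pd_congr hV (fun y hy => h y hy j) hx, pd_sum fun k => (df k).fun_mul (ds k j)]
    exact Finset.sum_congr rfl fun k _ => pd_mul (df k) (ds k j) i
  have h2 : ∀ i j, ∑ k, (dS (f k) x i * s k x j - dS (f k) x j * s k x i +
      f k x * d1 (s k) x i j) = 0 := by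
    intro i j
    have h3 := pd_pd_comm hV hp hx i j
    rw [h1, h1, ← sub_eq_zero, ← Finset.sum_sub_distrib] at h3
    rw [← h3]
    exact Finset.sum_congr rfl fun k _ => by simp only [dS, d1]; ring
  have h4 : ∑ i, ∑ j, (∑ k, (dS (f k) x i * s k x j - dS (f k) x j * s k x i +
      f k x * d1 (s k) x i j)) * X i * Y j = 0 := by simp [h2]
  rw [← h4]
  simp only [Finset.sum_mul]
  rw [Finset.sum_congr rfl fun i _ => Finset.sum_comm, Finset.sum_comm]
  refine Finset.sum_congr rfl fun k _ => ?_
  rw [mul_comm (dS (f k) x ⬝ᵥ Y)]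
  simp only [pairing, dotProduct, Finset.sum_mul_sum]
  rw [Finset.mul_sum, ← Finset.sum_sub_distrib, ← Finset.sum_add_distrib]
  refine Finset.sum_congr rfl fun i _ => ?_
  rw [Finset.mul_sum, ← Finset.sum_sub_distrib, ← Finset.sum_add_distrib]
  exact Finset.sum_congr rfl fun j _ => by ring

section Smoothness

theorem contDiffOn_bForm (hU : IsOpen U) (hg : IsLorentzMetric U g) (hu : IsUnitTimelike U g u)
    (hC : IsFlowClass U g u) (i : Fin 4) : ContDiffOn ℝ ∞ (fun x => bForm g u x i) U :=
  (contDiffOn_flat hg hu.smooth i).neg.add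
    ((contDiffOn_const.div (contDiffOn_ip hg (contDiffOn_acc hU hg hu) (contDiffOn_acc hU hg hu))
      fun _ hx => (adaptedFrame hU hg hu hC hx).ip_a_pos.ne').mul
    (contDiffOn_interior (contDiffOn_accV hU hg hu)
      (contDiffOn_d1 hU (contDiffOn_flat hg hu.smooth)) i))

theorem contDiffOn_cForm (hU : IsOpen U) (hg : IsLorentzMetric U g) (hu : IsUnitTimelike U g u)
    (hC : IsFlowClass U g u) (i : Fin 4) : ContDiffOn ℝ ∞ (fun x => cForm g u x i) U :=
  (contDiffOn_const.div (contDiffOn_ip hg (contDiffOn_acc hU hg hu) (contDiffOn_acc hU hg hu))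
      fun _ hx => (adaptedFrame hU hg hu hC hx).ip_a_pos.ne').mul
    (contDiffOn_interior (contDiffOn_accV hU hg hu)
      (contDiffOn_d1 hU (contDiffOn_acc hU hg hu)) i)

theorem contDiffOn_cu (hU : IsOpen U) (hg : IsLorentzMetric U g) (hu : IsUnitTimelike U g u)
    (hC : IsFlowClass U g u) : ContDiffOn ℝ ∞ (cu g u) U :=
  (contDiffOn_ip hg (contDiffOn_cForm hU hg hu hC) (contDiffOn_flat hg hu.smooth)).neg

theorem contDiffOn_cb (hU : IsOpen U) (hg : IsLorentzMetric U g) (hu : IsUnitTimelike U g u)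
    (hC : IsFlowClass U g u) : ContDiffOn ℝ ∞ (cb g u) U :=
  (contDiffOn_ip hg (contDiffOn_cForm hU hg hu hC) (contDiffOn_bForm hU hg hu hC)).div
    (contDiffOn_ip hg (contDiffOn_bForm hU hg hu hC) (contDiffOn_bForm hU hg hu hC))
    fun _ hx => (adaptedFrame hU hg hu hC hx).ip_b_pos.ne'

theorem contDiffOn_Om (hU : IsOpen U) (hg : IsLorentzMetric U g) (hu : IsUnitTimelike U g u)
    (hC : IsFlowClass U g u) : ContDiffOn ℝ ∞ (Om g u) U :=
  (contDiffOn_expansion hU hg hu).sub (contDiffOn_cu hU hg hu hC)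

theorem contDiffOn_nu (hU : IsOpen U) (hg : IsLorentzMetric U g) (hu : IsUnitTimelike U g u)
    (hC : IsFlowClass U g u) : ContDiffOn ℝ ∞ (nu g u) U :=
  (contDiffOn_Om hU hg hu hC).add (contDiffOn_const.mul (contDiffOn_cb hU hg hu hC))

end Smoothness

/-- The integrability conditions of `dp = -f u + h a`. -/
theorem integrability (hU : IsOpen U) (hg : IsLorentzMetric U g) (hu : IsUnitTimelike U g u)
    (hC : IsFlowClass U g u) (hV : IsOpen V) (hVU : V ⊆ U) {p f h : Pt → ℝ}
    (hp : ContDiffOn ℝ ∞ p V) (hf : ContDiffOn ℝ ∞ f V) (hh : ContDiffOn ℝ ∞ h V)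
    (hdp : ∀ x ∈ V, ∀ i, pd i p x = -f x * flat g u x i + h x * acc g u x i)
    {x : Pt} (hx : x ∈ V) :
    starD g u f x + f x = dotD u h x + h x * cu g u x ∧
    tildeD g u h x = cb g u x * h x - f x ∧ hatD g u h x = 0 ∧
    tildeD g u f x = 0 ∧ hatD g u f x = 0 := by
  have A := adaptedFrame hU hg hu hC (hVU hx)
  have hdu := pairing_wedge (s := acc g u x) (t := flat g u x + bForm g u x) A.du
  have hda := pairing_wedge A.da
  have hc : cForm g u x = cu g u x • flat g u x + cb g u x • bForm g u x := by
    ext i; simp [A.c_eq i]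
  have key := sum_eq_zero_of_dS_eq (n := 2) (f := ![fun y => -1 * f y, h])
    (s := ![flat g u, acc g u]) hV hp ?_ ?_ ?_ hx
  · simp only [Fin.sum_univ_two, cons_val_zero, cons_val_one, hdu, hda, hc,
      dS_const_mul_dot (differentiableAt_of_contDiffOn hV hf hx), add_dotProduct,
      smul_dotProduct, smul_eq_mul] at key
    simp only [starD_eq, tildeD_eq, hatD_eq, dotD_eq]
    have k01 := key (u x) (unitDual g (acc g u) x)
    have k02 := key (u x) (unitDual g (bForm g u) x)
    have k03 := key (u x) (unitDual g (rot g u) x)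
    have k12 := key (unitDual g (acc g u) x) (unitDual g (bForm g u) x)
    have k13 := key (unitDual g (acc g u) x) (unitDual g (rot g u) x)
    simp only [A.u_u, A.u_a, A.u_b, A.u_w, A.a_u, A.a_a, A.a_b, A.a_w, A.b_u, A.b_a, A.b_b,
      A.b_w] at k01 k02 k03 k12 k13
    exact ⟨by linarith, by linarith, by linarith, by linarith, by linarith⟩
  · intro k
    fin_cases k
    · exact contDiffOn_const.mul hf
    · exact hh
  · intro k i
    fin_cases k
    · exact (contDiffOn_flat hg hu.smooth i).mono hVU
    · exact (contDiffOn_acc hU hg hu i).mono hVU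
  · intro y hy i
    simp [Fin.sum_univ_two, hdp y hy i]

/-- A function with `f~ = f^ = 0` has its differential in the span of `u` and `a`. -/
theorem pd_eq_of_tilde_hat {x : Pt} (A : AdaptedFrame g u x) {f : Pt → ℝ}
    (h1 : tildeD g u f x = 0) (h2 : hatD g u f x = 0) (i : Fin 4) :
    pd i f x = -dotD u f x * flat g u x i + starD g u f x * acc g u x i := by
  have h := A.expand (dS f x) i
  rw [← tildeD_eq, ← hatD_eq, ← starD_eq, ← dotD_eq, h1, h2] at h
  change dS f x i = _
  rw [h]; ring

/-- The energy-momentum equations `dp = -f u + h a`, `h. + θ h + f = 0`, with `f = p.` and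
`h = -(ρ + p)`. -/
theorem IsPerfect.equations (hU : IsOpen U) (hg : IsLorentzMetric U g)
    (hu : IsUnitTimelike U g u) (hC : IsFlowClass U g u) (hV : IsOpen V) (hVU : V ⊆ U)
    {rho p : Pt → ℝ} (hP : IsPerfect V g u rho p) {x : Pt} (hx : x ∈ V) :
    (∀ i, pd i p x = -(dotD u p x) * flat g u x i + -1 * (rho x + p x) * acc g u x i) ∧
    dotD u (fun y => -1 * (rho y + p y)) x + expansion g u x * (-1 * (rho x + p x)) +
      dotD u p x = 0 := by
  have A := adaptedFrame hU hg hu hC (hVU hx)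
  have hr := differentiableAt_of_contDiffOn hV hP.smooth_rho hx
  have hp := differentiableAt_of_contDiffOn hV hP.smooth_p hx
  have hua : ∑ k, u x k * acc g u x k = 0 := by
    rw [← A.a_u]; exact dotProduct_comm _ _
  obtain ⟨h1, h2⟩ := (divT_eq_zero_iff hU hg hu (hVU hx) hr hp hua).1 (hP.conserved x hx)
  refine ⟨fun i => by rw [h1 i]; ring, ?_⟩
  rw [dotD_eq, dS_const_mul_dot (hr.fun_add hp), ← dotD_eq]
  linarith

theorem IsPerfect.dS_eq (hU : IsOpen U) (hg : IsLorentzMetric U g)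
    (hu : IsUnitTimelike U g u) (hC : IsFlowClass U g u) (hV : IsOpen V) (hVU : V ⊆ U)
    {rho p : Pt → ℝ} (hP : IsPerfect V g u rho p) {x : Pt} (hx : x ∈ V) :
    dS p x = -(dotD u p x) • flat g u x + (-1 * (rho x + p x)) • acc g u x := by
  ext i
  simpa [dS] using (hP.equations hU hg hu hC hV hVU hx).1 i

/-- A conserved energy tensor, with `f = ṗ` and `h = -(ρ + p)`, forces `ḟ = -ν f`,
`f^* = -2 f - Ω h` and the two conditions on `Ω`.

The integrability conditions of `dp = -f u + h a` show that `df = -ḟ u + H a` is of the same form,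
with `H = -2 f - Ω h`.  Those of this second equation are linear in `f` and `h`: the coefficient of
`f` in the last of them is `φ₁ = 0`, and that of `h ≠ 0` is the quantity which must vanish. -/
theorem IsPerfect.conditions (hU : IsOpen U) (hg : IsLorentzMetric U g)
    (hu : IsUnitTimelike U g u) (hC : IsFlowClass U g u) (hV : IsOpen V) (hVU : V ⊆ U)
    {rho p : Pt → ℝ} (hP : IsPerfect V g u rho p) {x : Pt} (hx : x ∈ V) :
    dotD u (dotD u p) x = -(nu g u x * dotD u p x) ∧
    starD g u (dotD u p) x = -(2 * dotD u p x) + Om g u x * (rho x + p x) ∧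
    hatD g u (Om g u) x = 0 ∧ 2 * Om g u x * cb g u x + dotD u (Om g u) x = 0 := by
  set f := dotD u p with hf
  set h : Pt → ℝ := fun y => -1 * (rho y + p y) with hh
  have sf : ContDiffOn ℝ ∞ f V := contDiffOn_dotD hV (fun i => (hu.smooth i).mono hVU) hP.smooth_p
  have sh : ContDiffOn ℝ ∞ h V := contDiffOn_const.mul (hP.smooth_rho.add hP.smooth_p)
  have sO := (contDiffOn_Om hU hg hu hC).mono hVU
  have K1 := fun y (hy : y ∈ V) => integrability hU hg hu hC hV hVU hP.smooth_p sf sh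
    (fun y hy => (hP.equations hU hg hu hC hV hVU hy).1) hy
  have hE := fun y (hy : y ∈ V) => (hP.equations hU hg hu hC hV hVU hy).2
  have hstar : ∀ y ∈ V, starD g u f y = -2 * f y + -1 * (Om g u y * h y) := by
    intro y hy
    have h1 := (K1 y hy).1
    have h2 := hE y hy
    simp only [Om]
    linear_combination h1 + h2
  -- The integrability conditions once more, for the differential of `f`.
  set H : Pt → ℝ := fun y => -2 * f y + -1 * (Om g u y * h y) with hH
  have sH : ContDiffOn ℝ ∞ H V :=
    (contDiffOn_const.mul sf).add (contDiffOn_const.mul (sO.mul sh))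
  have sF : ContDiffOn ℝ ∞ (dotD u f) V := contDiffOn_dotD hV (fun i => (hu.smooth i).mono hVU) sf
  have K2 := fun y (hy : y ∈ V) => integrability hU hg hu hC hV hVU sf sF sH
    (fun y hy i => by
      rw [pd_eq_of_tilde_hat (adaptedFrame hU hg hu hC (hVU hy)) (K1 y hy).2.2.2.1
        (K1 y hy).2.2.2.2, hstar y hy]) hy
  have dH : ∀ y ∈ V, ∀ X, dS H y ⬝ᵥ X = -2 * (dS f y ⬝ᵥ X) +
      -1 * ((dS (Om g u) y ⬝ᵥ X) * h y + Om g u y * (dS h y ⬝ᵥ X)) := by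
    intro y hy X
    have d1 := differentiableAt_of_contDiffOn hV sf hy
    have d2 := differentiableAt_of_contDiffOn hV sO hy
    have d3 := differentiableAt_of_contDiffOn hV sh hy
    rw [dS_add_dot (d1.const_mul _) ((d2.fun_mul d3).const_mul _), dS_const_mul_dot d1,
      dS_const_mul_dot (d2.fun_mul d3), dS_mul_dot d2 d3]
  have hF : ∀ y ∈ V, dotD u f y = -1 * (nu g u y * f y) := by
    intro y hy
    have h1 := (K2 y hy).2.1
    rw [tildeD_eq, dH y hy, ← tildeD_eq, ← tildeD_eq, ← tildeD_eq, hC.tilde_Om y (hVU hy),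
      (K1 y hy).2.2.2.1, (K1 y hy).2.1] at h1
    simp only [nu]
    linear_combination h1
  have hne : h x ≠ 0 := mul_ne_zero (by norm_num) (hP.nonzero x hx)
  have hOhat : hatD g u (Om g u) x = 0 := by
    have h1 := (K2 x hx).2.2.1
    rw [hatD_eq, dH x hx, ← hatD_eq, ← hatD_eq, ← hatD_eq, (K1 x hx).2.2.1,
      (K1 x hx).2.2.2.2] at h1
    have : hatD g u (Om g u) x * h x = 0 := by linear_combination -h1
    exact (mul_eq_zero.1 this).resolve_right hne
  refine ⟨by rw [hF x hx]; ring, by rw [hstar x hx]; simp only [hh]; ring, hOhat, ?_⟩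
  have h1 := (K2 x hx).1
  have sN := (contDiffOn_nu hU hg hu hC).mono hVU
  have dF : starD g u (dotD u f) x =
      -1 * (starD g u (nu g u) x * f x + nu g u x * starD g u f x) := by
    have d1 := differentiableAt_of_contDiffOn hV sN hx
    have d2 := differentiableAt_of_contDiffOn hV sf hx
    rw [starD_eq, dS_congr hV hF hx, dS_const_mul_dot (d1.fun_mul d2), dS_mul_dot d1 d2,
      ← starD_eq, ← starD_eq]
  rw [dF, dotD_eq (u := u) H, dH x hx, ← dotD_eq, ← dotD_eq, ← dotD_eq, hF x hx, hstar x hx] at h1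
  have h2 : dotD u h x + expansion g u x * h x + f x = 0 := hE x hx
  have h3 := hC.varphi1_zero x (hVU hx)
  have : (2 * Om g u x * cb g u x + dotD u (Om g u) x) * h x = 0 := by
    simp only [varphi1, hH] at h1 h3
    simp only [nu, Om] at h1 h3 ⊢
    linear_combination h1 + f x * h3 - (expansion g u x - cu g u x) * h2
  exact (mul_eq_zero.1 this).resolve_right hne

end FrameCalculus

/-! ### The potentials of the flow and their derivatives -/

section Potentials

open Matrix

variable {U V : Set Pt} {g : Metric} {u : VField} {tau alpha mu beta : Pt → ℝ}

/-- A 1-form given by its components, as a field of continuous linear forms. -/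
noncomputable def formCLM (s : Form1) (x : Pt) : Pt →L[ℝ] ℝ :=
  ∑ i, s x i • ContinuousLinearMap.proj i

theorem formCLM_apply (s : Form1) (x X : Pt) : formCLM s x X = s x ⬝ᵥ X := by
  simp [formCLM, dotProduct]

theorem contDiffOn_formCLM {s : Form1} (hs : ∀ i, ContDiffOn ℝ ∞ (fun x => s x i) U) :
    ContDiffOn ℝ ∞ (formCLM s) U :=
  ContDiffOn.sum fun i _ => (hs i).smul contDiffOn_const

theorem curl_formCLM (hU : IsOpen U) {s : Form1} (hs : ∀ i, ContDiffOn ℝ ∞ (fun x => s x i) U)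
    {x : Pt} (hx : x ∈ U) (X Y : Pt) : curl (formCLM s) x X Y = pairing (d1 s x) X Y := by
  have ds : ∀ i, DifferentiableAt ℝ (fun x => s x i) x := fun i =>
    differentiableAt_of_contDiffOn hU (hs i) hx
  have hd : DifferentiableAt ℝ (formCLM s) x :=
    ((contDiffOn_formCLM hs).contDiffAt (hU.mem_nhds hx)).differentiableAt (by simp)
  have h : ∀ X Y : Pt, fderiv ℝ (formCLM s) x X Y =
      ∑ i, ∑ j, pd i (fun y => s y j) x * X i * Y j := by
    intro X Y
    have h1 : fderiv ℝ (fun y => formCLM s y Y) x X = fderiv ℝ (formCLM s) x X Y := by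
      rw [fderiv_clm_apply hd (differentiableAt_const Y)]
      simp
    rw [← h1, ← dS_dot]
    simp only [formCLM_apply, dotProduct, dS]
    refine Finset.sum_congr rfl fun i _ => ?_
    rw [pd_sum fun j => (ds j).mul_const _, Finset.sum_mul]
    refine Finset.sum_congr rfl fun j _ => ?_
    rw [pd_mul (ds j) (differentiableAt_const _), pd_const]
    ring
  rw [curl, h, h]
  rw [Finset.sum_comm (f := fun i j => pd i (fun y => s y j) x * Y i * X j)]
  simp only [pairing, ← Finset.sum_sub_distrib, d1]
  exact Finset.sum_congr rfl fun i _ => Finset.sum_congr rfl fun j _ => by ring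

/-- Smooth potentials with `u = -dτ + μ dα` and `a = β dα`. -/
structure Potentials (V : Set Pt) (g : Metric) (u : VField) (tau alpha mu beta : Pt → ℝ) :
    Prop where
  smooth_tau : ContDiffOn ℝ ∞ tau V
  smooth_alpha : ContDiffOn ℝ ∞ alpha V
  smooth_mu : ContDiffOn ℝ ∞ mu V
  smooth_beta : ContDiffOn ℝ ∞ beta V
  u_eq : ∀ x ∈ V, flat g u x = - dS tau x + mu x • dS alpha x
  a_eq : ∀ x ∈ V, acc g u x = beta x • dS alpha x

/-- The Frobenius theorem applies by `da = a ∧ c` and `du = a ∧ (u + b)`. -/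
theorem exists_potentials (hU : IsOpen U) (hg : IsLorentzMetric U g) (hu : IsUnitTimelike U g u)
    (hC : IsFlowClass U g u) {x₀ : Pt} (hx₀ : x₀ ∈ U) :
    ∃ V, IsOpen V ∧ x₀ ∈ V ∧ V ⊆ U ∧ ∃ tau alpha mu beta : Pt → ℝ,
      Potentials V g u tau alpha mu beta := by
  have sb : ∀ i, ContDiffOn ℝ ∞ (fun x => (flat g u x + bForm g u x) i) U := fun i =>
    (contDiffOn_flat hg hu.smooth i).add (contDiffOn_bForm hU hg hu hC i)
  have sa := contDiffOn_acc hU hg hu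
  obtain ⟨V, hV, hxV, hVU, tau, alpha, mu, beta, h1, h2, h3, h4, h⟩ :=
    exists_frobenius_potentials hU (A := formCLM (acc g u)) (B := formCLM (flat g u))
      (C := formCLM (cForm g u)) (K := formCLM fun x => flat g u x + bForm g u x)
      (contDiffOn_formCLM sa) (contDiffOn_formCLM (contDiffOn_flat hg hu.smooth))
      (contDiffOn_formCLM (contDiffOn_cForm hU hg hu hC)).continuousOn
      (fun x hx v w => by
        simp only [curl_formCLM hU sa hx, formCLM_apply]
        exact pairing_wedge (adaptedFrame hU hg hu hC hx).da v w)
      (fun x hx v w => by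
        simp only [curl_formCLM hU (contDiffOn_flat hg hu.smooth) hx, formCLM_apply]
        exact pairing_wedge (adaptedFrame hU hg hu hC hx).du v w)
      hx₀
      (fun h0 => by
        have := (adaptedFrame hU hg hu hC hx₀).a_a
        rw [← formCLM_apply, h0] at this
        simp at this)
  have hcomp : ∀ (s : Form1) x i, s x i = formCLM s x (Pi.single i 1) := fun s x i => by
    simp [formCLM_apply]
  refine ⟨V, hV, hxV, hVU, tau, alpha, mu, beta, h1, h2, h3, h4, fun x hx => ?_, fun x hx => ?_⟩
  · ext i
    rw [hcomp (flat g u), (h x hx).2]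
    simp [dS, pd]
  · ext i
    rw [hcomp (acc g u), (h x hx).1]
    simp [dS, pd]

/-- Potentials of a flow of the class under consideration, on an open subset of its domain. -/
structure FlowPotentials (U V : Set Pt) (g : Metric) (u : VField)
    (tau alpha mu beta : Pt → ℝ) : Prop extends Potentials V g u tau alpha mu beta where
  isOpen_domain : IsOpen U
  metric : IsLorentzMetric U g
  unit : IsUnitTimelike U g u
  flow : IsFlowClass U g u
  isOpen : IsOpen V
  subset : V ⊆ U

theorem contDiffOn_starD (hU : IsOpen U) (hg : IsLorentzMetric U g) (hu : IsUnitTimelike U g u)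
    (hC : IsFlowClass U g u) (hV : IsOpen V) (hVU : V ⊆ U) {f : Pt → ℝ}
    (hf : ContDiffOn ℝ ∞ f V) : ContDiffOn ℝ ∞ (starD g u f) V := by
  have sa : ∀ i, ContDiffOn ℝ ∞ (fun x => acc g u x i) V := fun i =>
    (contDiffOn_acc hU hg hu i).mono hVU
  have hs : ∀ i j, ContDiffOn ℝ ∞ (fun x => ginv g x i j) V := fun i j =>
    (hg.contDiffOn_ginv i j).mono hVU
  refine ContDiffOn.div ?_ ?_ fun x hx => (adaptedFrame hU hg hu hC (hVU hx)).ip_a_pos.ne'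
  · exact ContDiffOn.sum fun i _ => ContDiffOn.sum fun j _ =>
      ((hs i j).mul (contDiffOn_pd hV hf i)).mul (sa j)
  · exact ContDiffOn.sum fun i _ => ContDiffOn.sum fun j _ => ((hs i j).mul (sa i)).mul (sa j)

namespace FlowPotentials

variable {x : Pt}

theorem mono {W : Set Pt} (P : FlowPotentials U V g u tau alpha mu beta) (hW : W ⊆ V)
    (hWo : IsOpen W) : FlowPotentials U W g u tau alpha mu beta :=
  { smooth_tau := P.smooth_tau.mono hW
    smooth_alpha := P.smooth_alpha.mono hW
    smooth_mu := P.smooth_mu.mono hW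
    smooth_beta := P.smooth_beta.mono hW
    u_eq := fun x hx => P.u_eq x (hW hx)
    a_eq := fun x hx => P.a_eq x (hW hx)
    isOpen_domain := P.isOpen_domain
    metric := P.metric
    unit := P.unit
    flow := P.flow
    isOpen := hWo
    subset := hW.trans P.subset }

theorem frame (P : FlowPotentials U V g u tau alpha mu beta) (hx : x ∈ V) :
    AdaptedFrame g u x :=
  adaptedFrame P.isOpen_domain P.metric P.unit P.flow (P.subset hx)

theorem differentiableAt_mu (P : FlowPotentials U V g u tau alpha mu beta) (hx : x ∈ V) :
    DifferentiableAt ℝ mu x := differentiableAt_of_contDiffOn P.isOpen P.smooth_mu hx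

theorem differentiableAt_beta (P : FlowPotentials U V g u tau alpha mu beta) (hx : x ∈ V) :
    DifferentiableAt ℝ beta x := differentiableAt_of_contDiffOn P.isOpen P.smooth_beta hx

theorem smooth_cb (P : FlowPotentials U V g u tau alpha mu beta) :
    ContDiffOn ℝ ∞ (cb g u) V :=
  (contDiffOn_cb P.isOpen_domain P.metric P.unit P.flow).mono P.subset

theorem smooth_cu (P : FlowPotentials U V g u tau alpha mu beta) :
    ContDiffOn ℝ ∞ (cu g u) V :=
  (contDiffOn_cu P.isOpen_domain P.metric P.unit P.flow).mono P.subset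

theorem smooth_flat (P : FlowPotentials U V g u tau alpha mu beta) (i : Fin 4) :
    ContDiffOn ℝ ∞ (fun x => flat g u x i) V :=
  (contDiffOn_flat P.metric P.unit.smooth i).mono P.subset

theorem smooth_acc (P : FlowPotentials U V g u tau alpha mu beta) (i : Fin 4) :
    ContDiffOn ℝ ∞ (fun x => acc g u x i) V :=
  (contDiffOn_acc P.isOpen_domain P.metric P.unit i).mono P.subset

theorem smooth_dotD (P : FlowPotentials U V g u tau alpha mu beta) {f : Pt → ℝ}
    (hf : ContDiffOn ℝ ∞ f V) : ContDiffOn ℝ ∞ (dotD u f) V :=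
  contDiffOn_dotD P.isOpen (fun i => (P.unit.smooth i).mono P.subset) hf

theorem tau_dot (P : FlowPotentials U V g u tau alpha mu beta) (hx : x ∈ V) (X : Fin 4 → ℝ) :
    dS tau x ⬝ᵥ X = mu x * (dS alpha x ⬝ᵥ X) - flat g u x ⬝ᵥ X := by
  rw [P.u_eq x hx]
  simp [add_dotProduct, smul_dotProduct]

theorem acc_dot (P : FlowPotentials U V g u tau alpha mu beta) (hx : x ∈ V) (X : Fin 4 → ℝ) :
    acc g u x ⬝ᵥ X = beta x * (dS alpha x ⬝ᵥ X) := by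
  rw [P.a_eq x hx]
  simp [smul_dotProduct]

theorem beta_ne_zero (P : FlowPotentials U V g u tau alpha mu beta) (hx : x ∈ V) :
    beta x ≠ 0 := by
  intro h
  have h1 := (P.frame hx).a_a
  rw [P.acc_dot hx, h, zero_mul] at h1
  exact zero_ne_one h1

theorem alpha_dot (P : FlowPotentials U V g u tau alpha mu beta) (hx : x ∈ V) (X : Fin 4 → ℝ) :
    dS alpha x ⬝ᵥ X = (beta x)⁻¹ * (acc g u x ⬝ᵥ X) := by
  rw [P.acc_dot hx, inv_mul_cancel_left₀ (P.beta_ne_zero hx)]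

/-- `dμ = -β (u + b) + μ^* a`, obtained by contracting `du = dμ ∧ dα` with the frame. -/
theorem mu_derivatives (P : FlowPotentials U V g u tau alpha mu beta) (hx : x ∈ V) :
    dotD u mu x = beta x ∧ tildeD g u mu x = -beta x ∧ hatD g u mu x = 0 := by
  have A := P.frame hx
  have hdu := pairing_wedge (s := acc g u x) (t := flat g u x + bForm g u x) A.du
  have key := sum_eq_zero_of_dS_eq (n := 2) (p := tau) (f := ![mu, fun _ => -1])
    (s := ![dS alpha, flat g u]) P.isOpen P.smooth_tau ?_ ?_ ?_ hx
  · have hdd : ∀ X Y, pairing (d1 (dS alpha) x) X Y = 0 := by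
      intro X Y
      have h : ∀ i j, d1 (dS alpha) x i j = 0 := fun i j =>
        sub_eq_zero.2 (pd_pd_comm P.isOpen P.smooth_alpha hx i j)
      simp [pairing, h]
    have hc : ∀ X, dS (fun _ : Pt => (-1 : ℝ)) x ⬝ᵥ X = 0 := fun X => by simp [dS_dot]
    simp only [Fin.sum_univ_two, cons_val_zero, cons_val_one, hdu, hdd, hc, P.alpha_dot hx,
      add_dotProduct] at key
    simp only [tildeD_eq, hatD_eq, dotD_eq]
    have k01 := key (u x) (unitDual g (acc g u) x)
    have k12 := key (unitDual g (acc g u) x) (unitDual g (bForm g u) x)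
    have k13 := key (unitDual g (acc g u) x) (unitDual g (rot g u) x)
    simp only [A.u_u, A.u_a, A.u_b, A.u_w, A.a_u, A.a_a, A.a_b, A.a_w, A.b_u, A.b_a, A.b_b,
      A.b_w] at k01 k12 k13
    have hb := P.beta_ne_zero hx
    field_simp at k01 k12 k13
    exact ⟨by linarith, by linarith, by linarith⟩
  · intro k
    fin_cases k
    · exact P.smooth_mu
    · exact contDiffOn_const
  · intro k i
    fin_cases k
    · exact contDiffOn_pd P.isOpen P.smooth_alpha i
    · exact P.smooth_flat i
  · intro y hy i
    have h := congrFun (P.u_eq y hy) i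
    simp only [Pi.add_apply, Pi.neg_apply, Pi.smul_apply, smul_eq_mul] at h
    change dS tau y i = _
    simp only [Fin.sum_univ_two, cons_val_zero, cons_val_one, h]
    ring

/-- `dβ = -β c + β^* a`, obtained by contracting the derivative of `dα = β⁻¹ a` with the frame. -/
theorem beta_derivatives (P : FlowPotentials U V g u tau alpha mu beta) (hx : x ∈ V) :
    dotD u beta x = cu g u x * beta x ∧ tildeD g u beta x = -(cb g u x * beta x) ∧
    hatD g u beta x = 0 := by
  have A := P.frame hx
  have hda := pairing_wedge A.da
  have hc : cForm g u x = cu g u x • flat g u x + cb g u x • bForm g u x := by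
    ext i; simp [A.c_eq i]
  have sinv : ContDiffOn ℝ ∞ (fun y => (beta y)⁻¹) V :=
    P.smooth_beta.inv fun y hy => P.beta_ne_zero hy
  have hb := P.beta_ne_zero hx
  have hinv : ∀ X, dS beta x ⬝ᵥ X = -(beta x ^ 2 * (dS (fun y => (beta y)⁻¹) x ⬝ᵥ X)) := by
    intro X
    have h1 := dS_mul_dot (differentiableAt_of_contDiffOn P.isOpen sinv hx)
      (P.differentiableAt_beta hx) X
    rw [dS_congr P.isOpen (fun y hy => inv_mul_cancel₀ (P.beta_ne_zero hy)) hx, dS_dot] at h1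
    generalize dS (fun y => (beta y)⁻¹) x = d at h1 ⊢
    simp at h1
    field_simp at h1
    linear_combination -h1
  have key := sum_eq_zero_of_dS_eq (n := 1) (p := alpha) (f := ![fun y => (beta y)⁻¹])
    (s := ![acc g u]) P.isOpen P.smooth_alpha ?_ ?_ ?_ hx
  · simp only [Fin.sum_univ_one, cons_val_zero, hda, hc, add_dotProduct,
      smul_dotProduct, smul_eq_mul] at key
    simp only [tildeD_eq, hatD_eq, dotD_eq, hinv]
    have k01 := key (u x) (unitDual g (acc g u) x)
    have k12 := key (unitDual g (acc g u) x) (unitDual g (bForm g u) x)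
    have k13 := key (unitDual g (acc g u) x) (unitDual g (rot g u) x)
    simp only [A.u_u, A.u_a, A.u_b, A.u_w, A.a_u, A.a_a, A.a_b, A.a_w, A.b_u, A.b_a, A.b_b,
      A.b_w] at k01 k12 k13
    set d := dS (fun y => (beta y)⁻¹) x
    refine ⟨?_, ?_, ?_⟩
    · have : d ⬝ᵥ u x = -(beta x)⁻¹ * cu g u x := by linarith
      rw [this]; field_simp
    · have : d ⬝ᵥ unitDual g (bForm g u) x = (beta x)⁻¹ * cb g u x := by linarith
      rw [this]; field_simp
    · have : d ⬝ᵥ unitDual g (rot g u) x = 0 := by linarith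
      rw [this]; ring
  · intro k
    fin_cases k
    exact sinv
  · intro k i
    fin_cases k
    exact P.smooth_acc i
  · intro y hy i
    have h := congrFun (P.a_eq y hy) i
    have hby := P.beta_ne_zero hy
    simp only [Pi.smul_apply, smul_eq_mul] at h
    change dS alpha y i = _
    simp only [Fin.sum_univ_one, cons_val_zero, h]
    field_simp

/-- `ĉ_b = 0`.  The derivatives of `β` and `μ` give `dβ = β (c_b - c_u) u + c_b dμ + κ a`, and the
value of `d(dβ) = 0` on `(w, b)` is `-β ĉ_b`. -/
theorem hat_cb (P : FlowPotentials U V g u tau alpha mu beta) (hx : x ∈ V) :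
    hatD g u (cb g u) x = 0 := by
  have A := P.frame hx
  have hdu := pairing_wedge (s := acc g u x) (t := flat g u x + bForm g u x) A.du
  have hda := pairing_wedge A.da
  have key := sum_eq_zero_of_dS_eq (n := 3) (p := beta)
    (f := ![fun y => beta y * (cb g u y - cu g u y), cb g u,
      fun y => starD g u beta y - cb g u y * starD g u mu y])
    (s := ![flat g u, dS mu, acc g u]) P.isOpen P.smooth_beta ?_ ?_ ?_ hx
    (unitDual g (rot g u) x) (unitDual g (bForm g u) x)
  · have hdd : ∀ X Y, pairing (d1 (dS mu) x) X Y = 0 := by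
      intro X Y
      have h : ∀ i j, d1 (dS mu) x i j = 0 := fun i j =>
        sub_eq_zero.2 (pd_pd_comm P.isOpen P.smooth_mu hx i j)
      simp [pairing, h]
    simp only [Fin.sum_univ_three, cons_val_zero, cons_val_one, cons_val, hdu, hdd, hda] at key
    simp only [A.u_b, A.u_w, A.a_b, A.a_w, ← tildeD_eq, ← hatD_eq, (P.mu_derivatives hx).2.1,
      (P.mu_derivatives hx).2.2] at key
    have : hatD g u (cb g u) x * beta x = 0 := by linarith
    exact (mul_eq_zero.1 this).resolve_right (P.beta_ne_zero hx)
  · have ss := fun {f : Pt → ℝ} (hf : ContDiffOn ℝ ∞ f V) =>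
      contDiffOn_starD P.isOpen_domain P.metric P.unit P.flow P.isOpen P.subset hf
    intro k
    fin_cases k
    · exact P.smooth_beta.mul (P.smooth_cb.sub P.smooth_cu)
    · exact P.smooth_cb
    · exact (ss P.smooth_beta).sub (P.smooth_cb.mul (ss P.smooth_mu))
  · intro k i
    fin_cases k
    · exact P.smooth_flat i
    · exact contDiffOn_pd P.isOpen P.smooth_mu i
    · exact P.smooth_acc i
  · intro y hy i
    have hb := (P.frame hy).expand (dS beta y) i
    have hm := (P.frame hy).expand (dS mu y) i
    rw [← tildeD_eq, ← hatD_eq, ← starD_eq, ← dotD_eq, (P.beta_derivatives hy).1,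
      (P.beta_derivatives hy).2.1, (P.beta_derivatives hy).2.2] at hb
    rw [← tildeD_eq, ← hatD_eq, ← starD_eq, ← dotD_eq, (P.mu_derivatives hy).1,
      (P.mu_derivatives hy).2.1, (P.mu_derivatives hy).2.2] at hm
    change dS beta y i = _
    simp only [Fin.sum_univ_three, cons_val_zero, cons_val_one, cons_val]
    rw [hb, hm]
    ring

theorem smooth_sigma (P : FlowPotentials U V g u tau alpha mu beta) :
    ContDiffOn ℝ ∞ (fun y => beta y - mu y * cb g u y) V :=
  P.smooth_beta.sub (P.smooth_mu.mul P.smooth_cb)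

/-- The combination `σ = β - μ c_b` has its differential in the span of `u` and `a`. -/
theorem sigma_derivatives (P : FlowPotentials U V g u tau alpha mu beta) (hx : x ∈ V) :
    dotD u (fun y => beta y - mu y * cb g u y) x =
      cu g u x * beta x - beta x * cb g u x - mu x * dotD u (cb g u) x ∧
    tildeD g u (fun y => beta y - mu y * cb g u y) x = 0 ∧
    hatD g u (fun y => beta y - mu y * cb g u y) x = 0 := by
  have dc := differentiableAt_of_contDiffOn P.isOpen P.smooth_cb hx
  have h : ∀ X, dS (fun y => beta y - mu y * cb g u y) x ⬝ᵥ X = dS beta x ⬝ᵥ X -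
      ((dS mu x ⬝ᵥ X) * cb g u x + mu x * (dS (cb g u) x ⬝ᵥ X)) := by
    intro X
    rw [← dS_mul_dot (P.differentiableAt_mu hx) dc]
    simp only [dS_dot]
    rw [fderiv_fun_sub (P.differentiableAt_beta hx) ((P.differentiableAt_mu hx).fun_mul dc)]
    rfl
  have hm := P.mu_derivatives hx
  have hb := P.beta_derivatives hx
  simp only [tildeD_eq, hatD_eq, dotD_eq, h] at hm hb ⊢
  have h1 := P.flow.tilde_cb x (P.subset hx)
  have h2 := P.hat_cb hx
  rw [tildeD_eq] at h1
  rw [hatD_eq] at h2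
  rw [hm.1, hm.2.1, hm.2.2, hb.1, hb.2.1, hb.2.2, h1, h2]
  exact ⟨by ring, by ring, by ring⟩

theorem nu_dS_dot (P : FlowPotentials U V g u tau alpha mu beta) (hx : x ∈ V) (X : Fin 4 → ℝ) :
    dS (nu g u) x ⬝ᵥ X = dS (Om g u) x ⬝ᵥ X + 2 * (dS (cb g u) x ⬝ᵥ X) := by
  have dc := differentiableAt_of_contDiffOn P.isOpen P.smooth_cb hx
  have dO := differentiableAt_of_contDiffOn P.isOpen
    ((contDiffOn_Om P.isOpen_domain P.metric P.unit P.flow).mono P.subset) hx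
  rw [← dS_const_mul_dot dc, ← dS_add_dot dO (dc.const_mul 2)]
  rfl

end FlowPotentials
end Potentials
/-! ### Charts adapted to the potentials -/

section Chart

open Matrix

variable {U V : Set Pt} {g : Metric} {u : VField} {tau alpha mu beta l : Pt → ℝ} {S : Pt → Pt}
  {x₀ x : Pt} {r : ℝ}

/-- A cubical chart `(τ, α, μ, l)` about `x₀`, of half-edge `r`, whose first coordinates are
potentials of the flow; `S` is its inverse. -/
structure FlowChart (U V : Set Pt) (g : Metric) (u : VField) (tau alpha mu beta l : Pt → ℝ)
    (S : Pt → Pt) (x₀ : Pt) (r : ℝ) : Prop extends FlowPotentials U V g u tau alpha mu beta where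
  r_pos : 0 < r
  mem : x₀ ∈ V
  smooth_l : ContDiffOn ℝ ∞ l V
  smooth_inv : ContDiffOn ℝ ∞ S (Metric.ball ![tau x₀, alpha x₀, mu x₀, l x₀] r)
  mapsTo : ∀ x ∈ V, ![tau x, alpha x, mu x, l x] ∈ Metric.ball ![tau x₀, alpha x₀, mu x₀, l x₀] r
  inv_mapsTo : ∀ z ∈ Metric.ball ![tau x₀, alpha x₀, mu x₀, l x₀] r, S z ∈ V
  left_inv : ∀ x ∈ V, S ![tau x, alpha x, mu x, l x] = x
  right_inv : ∀ z ∈ Metric.ball ![tau x₀, alpha x₀, mu x₀, l x₀] r,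
    ![tau (S z), alpha (S z), mu (S z), l (S z)] = z

namespace FlowPotentials

/-- A vector annihilated by `dτ`, `dα` is orthogonal to `u`, `a`. -/
theorem dot_eq_zero_of_tau_alpha (P : FlowPotentials U V g u tau alpha mu beta) (hx : x ∈ V)
    {X : Fin 4 → ℝ} (h1 : dS tau x ⬝ᵥ X = 0) (h2 : dS alpha x ⬝ᵥ X = 0) :
    flat g u x ⬝ᵥ X = 0 ∧ acc g u x ⬝ᵥ X = 0 := by
  refine ⟨?_, by rw [P.acc_dot hx, h2, mul_zero]⟩
  have := P.tau_dot hx X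
  rw [h1, h2] at this
  linarith

end FlowPotentials

theorem AdaptedFrame.dot_expand (A : AdaptedFrame g u x) (s X : Fin 4 → ℝ) :
    s ⬝ᵥ X = -(s ⬝ᵥ u x) * (flat g u x ⬝ᵥ X) +
      (s ⬝ᵥ unitDual g (acc g u) x) * (acc g u x ⬝ᵥ X) +
      (s ⬝ᵥ unitDual g (bForm g u) x) * (bForm g u x ⬝ᵥ X) +
      (s ⬝ᵥ unitDual g (rot g u) x) * (rot g u x ⬝ᵥ X) := by
  have h : s = (-(s ⬝ᵥ u x)) • flat g u x + (s ⬝ᵥ unitDual g (acc g u) x) • acc g u x +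
      (s ⬝ᵥ unitDual g (bForm g u) x) • bForm g u x +
      (s ⬝ᵥ unitDual g (rot g u) x) • rot g u x := by
    ext i; simpa using A.expand s i
  conv_lhs => rw [h]
  simp only [add_dotProduct, smul_dotProduct, smul_eq_mul]

namespace FlowPotentials

theorem b_dot_eq_zero_of_tau_alpha_mu (P : FlowPotentials U V g u tau alpha mu beta) (hx : x ∈ V)
    {X : Fin 4 → ℝ} (h1 : dS tau x ⬝ᵥ X = 0) (h2 : dS alpha x ⬝ᵥ X = 0)
    (h3 : dS mu x ⬝ᵥ X = 0) : bForm g u x ⬝ᵥ X = 0 := by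
  obtain ⟨h4, h5⟩ := P.dot_eq_zero_of_tau_alpha hx h1 h2
  have h := (P.frame hx).dot_expand (dS mu x) X
  rw [h3, h4, h5, ← tildeD_eq, ← hatD_eq, (P.mu_derivatives hx).2.1,
    (P.mu_derivatives hx).2.2] at h
  have : beta x * (bForm g u x ⬝ᵥ X) = 0 := by linarith
  exact (mul_eq_zero.1 this).resolve_left (P.beta_ne_zero hx)

/-- On the frame, the matrix of values of `dτ`, `dα`, `dμ` is triangular. -/
theorem linearIndependent (P : FlowPotentials U V g u tau alpha mu beta) (hx : x ∈ V) :
    LinearIndependent ℝ ![dS tau x, dS alpha x, dS mu x] := by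
  rw [Fintype.linearIndependent_iff]
  intro c hc
  have A := P.frame hx
  have h : ∀ X, c 0 * (dS tau x ⬝ᵥ X) + c 1 * (dS alpha x ⬝ᵥ X) + c 2 * (dS mu x ⬝ᵥ X) = 0 := by
    intro X
    have := congrArg (· ⬝ᵥ X) hc
    simpa [Fin.sum_univ_three, add_dotProduct, smul_dotProduct] using this
  have hb := P.beta_ne_zero hx
  have e0 := h (u x)
  have e1 := h (unitDual g (acc g u) x)
  have e2 := h (unitDual g (bForm g u) x)
  simp only [P.tau_dot hx, P.alpha_dot hx, A.u_u, A.u_a, A.u_b, A.a_u, A.a_a, A.a_b] at e0 e1 e2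
  rw [← tildeD_eq, (P.mu_derivatives hx).2.1] at e2
  have c2 : c 2 = 0 := by
    have : c 2 * beta x = 0 := by linarith
    exact (mul_eq_zero.1 this).resolve_right hb
  rw [c2] at e0 e1
  have c0 : c 0 = 0 := by linarith
  rw [c0] at e1
  have c1 : c 1 = 0 := by
    have : c 1 * (beta x)⁻¹ = 0 := by linarith
    exact (mul_eq_zero.1 this).resolve_right (inv_ne_zero hb)
  intro i
  fin_cases i
  exacts [c0, c1, c2]

end FlowPotentials

/-- The fourth coordinate is the linear function with coefficients `w x₀`: a vector annihilated at
`x₀` by `dτ`, `dα`, `dμ` is orthogonal to `u`, `a`, `b`, so it vanishes if it is orthogonal to `w`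
as well. -/
theorem exists_flowChart (hU : IsOpen U) (hg : IsLorentzMetric U g) (hu : IsUnitTimelike U g u)
    (hC : IsFlowClass U g u) (hx₀ : x₀ ∈ U) {N : Set Pt} (hN : N ∈ nhds x₀) :
    ∃ V ⊆ N, ∃ (tau alpha mu beta l : Pt → ℝ) (S : Pt → Pt) (r : ℝ),
      FlowChart U V g u tau alpha mu beta l S x₀ r := by
  obtain ⟨V₁, hV₁, hxV₁, hV₁U, tau, alpha, mu, beta, Q⟩ := exists_potentials hU hg hu hC hx₀
  have P₁ : FlowPotentials U V₁ g u tau alpha mu beta := ⟨Q, hU, hg, hu, hC, hV₁, hV₁U⟩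
  set O : Set Pt := V₁ ∩ _root_.interior N with hOdef
  have hO : IsOpen O := hV₁.inter isOpen_interior
  have hxO : x₀ ∈ O := ⟨hxV₁, mem_interior_iff_mem_nhds.2 hN⟩
  have P := P₁.mono Set.inter_subset_left hO
  set L : Pt →L[ℝ] ℝ := ∑ i, rot g u x₀ i • ContinuousLinearMap.proj i with hL
  have hLX : ∀ X : Pt, L X = rot g u x₀ ⬝ᵥ X := fun X => by simp [hL, dotProduct]
  set Ψ : Pt → Pt := fun x => ![tau x, alpha x, mu x, L x] with hΨ
  have sΨ : ContDiffOn ℝ ∞ Ψ O := by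
    rw [contDiffOn_pi]
    intro i
    fin_cases i
    exacts [P.smooth_tau, P.smooth_alpha, P.smooth_mu, L.contDiff.contDiffOn]
  have dΨ : DifferentiableAt ℝ Ψ x₀ :=
    (sΨ.contDiffAt (hO.mem_nhds hxO)).differentiableAt (by simp)
  have hD : ∀ X, fderiv ℝ Ψ x₀ X =
      ![dS tau x₀ ⬝ᵥ X, dS alpha x₀ ⬝ᵥ X, dS mu x₀ ⬝ᵥ X, rot g u x₀ ⬝ᵥ X] := by
    intro X
    have h1 : ∀ i, fderiv ℝ (fun x => Ψ x i) x₀ X = fderiv ℝ Ψ x₀ X i := by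
      intro i
      exact congrArg (fun M : Pt →L[ℝ] ℝ => M X)
        (((ContinuousLinearMap.proj (R := ℝ) (φ := fun _ : Fin 4 => ℝ) i).hasFDerivAt.comp x₀
          dΨ.hasFDerivAt).fderiv)
    ext i
    rw [← h1]
    simp only [dS_dot, ← hLX]
    fin_cases i <;> simp [hΨ]
  have hinj : Function.Injective (fderiv ℝ Ψ x₀) := by
    rw [injective_iff_map_eq_zero]
    intro X hX
    rw [hD] at hX
    have h0 : dS tau x₀ ⬝ᵥ X = 0 := congrFun hX 0
    have h1 : dS alpha x₀ ⬝ᵥ X = 0 := congrFun hX 1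
    have h2 : dS mu x₀ ⬝ᵥ X = 0 := congrFun hX 2
    have h3 : rot g u x₀ ⬝ᵥ X = 0 := congrFun hX 3
    have h := (P.frame hxO).dot_expand X X
    rw [(P.dot_eq_zero_of_tau_alpha hxO h0 h1).1, (P.dot_eq_zero_of_tau_alpha hxO h0 h1).2,
      P.b_dot_eq_zero_of_tau_alpha_mu hxO h0 h1 h2, h3] at h
    simp only [mul_zero, add_zero] at h
    exact dotProduct_self_eq_zero.1 h
  let f' : Pt ≃L[ℝ] Pt :=
    (LinearEquiv.ofInjectiveEndo (fderiv ℝ Ψ x₀ : Pt →ₗ[ℝ] Pt) hinj).toContinuousLinearEquiv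
  have hf' : (f' : Pt →L[ℝ] Pt) = fderiv ℝ Ψ x₀ := by ext X; rfl
  obtain ⟨e, hxe, heO, he, hsymm⟩ := exists_smooth_chart hO hxO sΨ f' (hf' ▸ dΨ.hasFDerivAt)
  obtain ⟨r, hr, hball⟩ := Metric.isOpen_iff.1 e.open_target (Ψ x₀) (he ▸ e.map_source hxe)
  have hVo : IsOpen (e.source ∩ e ⁻¹' Metric.ball (Ψ x₀) r) :=
    e.isOpen_inter_preimage Metric.isOpen_ball
  have hVO : e.source ∩ e ⁻¹' Metric.ball (Ψ x₀) r ⊆ O := fun x hx => heO hx.1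
  refine ⟨_, fun x hx => interior_subset (hVO hx).2, tau, alpha, mu, beta, L, e.symm, r,
    { P.mono hVO hVo with
      r_pos := hr
      mem := ⟨hxe, by rw [Set.mem_preimage, he]; exact Metric.mem_ball_self hr⟩
      smooth_l := L.contDiff.contDiffOn
      smooth_inv := hsymm.mono hball
      mapsTo := fun x hx => by have := hx.2; rwa [Set.mem_preimage, he] at this
      inv_mapsTo := fun z hz => ⟨e.map_target (hball hz), by
        rw [Set.mem_preimage, e.right_inv (hball hz)]; exact hz⟩
      left_inv := fun x hx => by
        have := e.left_inv hx.1
        rwa [he] at this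
      right_inv := fun z hz => by
        have := e.right_inv (hball hz)
        rwa [he] at this }⟩

/-- The derivative of `τ`, `α`, `μ` along the image of a coordinate direction. -/
theorem FlowChart.dS_dot_fderiv_inv (C : FlowChart U V g u tau alpha mu beta l S x₀ r) {z : Pt}
    (hz : z ∈ Metric.ball ![tau x₀, alpha x₀, mu x₀, l x₀] r) (Z : Pt) :
    dS tau (S z) ⬝ᵥ fderiv ℝ S z Z = Z 0 ∧ dS alpha (S z) ⬝ᵥ fderiv ℝ S z Z = Z 1 ∧
    dS mu (S z) ⬝ᵥ fderiv ℝ S z Z = Z 2 := by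
  have dSz : DifferentiableAt ℝ S z :=
    (C.smooth_inv.contDiffAt (Metric.isOpen_ball.mem_nhds hz)).differentiableAt (by simp)
  have key : ∀ (f : Pt → ℝ) (i : Fin 4), ContDiffOn ℝ ∞ f V →
      (∀ z ∈ Metric.ball ![tau x₀, alpha x₀, mu x₀, l x₀] r, f (S z) = z i) →
      dS f (S z) ⬝ᵥ fderiv ℝ S z Z = Z i := by
    intro f i hf hfz
    have h1 : fderiv ℝ (fun z => f (S z)) z Z = Z i := by
      have : (fun z => f (S z)) =ᶠ[nhds z] fun z => z i := by
        filter_upwards [Metric.isOpen_ball.mem_nhds hz] with y hy using hfz y hy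
      rw [this.fderiv_eq]
      exact congrArg (fun M : Pt →L[ℝ] ℝ => M Z)
        (ContinuousLinearMap.proj (R := ℝ) (φ := fun _ : Fin 4 => ℝ) i).fderiv
    rw [dS_dot, ← h1]
    exact (congrArg (fun M : Pt →L[ℝ] ℝ => M Z) (fderiv_comp z
      (differentiableAt_of_contDiffOn C.isOpen hf (C.inv_mapsTo z hz)) dSz)).symm
  exact ⟨key tau 0 C.smooth_tau fun z hz => congrFun (C.right_inv z hz) 0,
    key alpha 1 C.smooth_alpha fun z hz => congrFun (C.right_inv z hz) 1,
    key mu 2 C.smooth_mu fun z hz => congrFun (C.right_inv z hz) 2⟩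

/-- A function whose differential vanishes on the image of `z - z'` has the same value at the
points with coordinates `z` and `z'`. -/
theorem FlowChart.eq_of_dS_dot_eq_zero (C : FlowChart U V g u tau alpha mu beta l S x₀ r)
    {f : Pt → ℝ} (hf : ContDiffOn ℝ ∞ f V) {z z' : Pt}
    (hz : z ∈ Metric.ball ![tau x₀, alpha x₀, mu x₀, l x₀] r)
    (hz' : z' ∈ Metric.ball ![tau x₀, alpha x₀, mu x₀, l x₀] r)
    (h : ∀ y ∈ Metric.ball ![tau x₀, alpha x₀, mu x₀, l x₀] r,
      dS f (S y) ⬝ᵥ fderiv ℝ S y (z - z') = 0) : f (S z) = f (S z') := by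
  have hseg : ∀ s ∈ Set.Icc (0 : ℝ) 1, z' + s • (z - z') ∈
      Metric.ball ![tau x₀, alpha x₀, mu x₀, l x₀] r := fun s hs =>
    (convex_ball _ _).add_smul_sub_mem hz' hz hs
  have hq : ∀ s ∈ Set.Icc (0 : ℝ) 1,
      HasDerivAt (fun s : ℝ => f (S (z' + s • (z - z'))) - f (S z'))
        (0 * (f (S (z' + s • (z - z'))) - f (S z'))) s := by
    intro s hs
    have hy := hseg s hs
    have dSy : DifferentiableAt ℝ S (z' + s • (z - z')) :=
      (C.smooth_inv.contDiffAt (Metric.isOpen_ball.mem_nhds hy)).differentiableAt (by simp)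
    have dfy := differentiableAt_of_contDiffOn C.isOpen hf (C.inv_mapsTo _ hy)
    have hline : HasDerivAt (fun s : ℝ => z' + s • (z - z')) (z - z') s := by
      simpa using ((hasDerivAt_id s).smul_const (z - z')).const_add z'
    have h1 := (dfy.hasFDerivAt.comp _ dSy.hasFDerivAt).comp_hasDerivAt s hline
    have h2 := h _ hy
    rw [dS_dot] at h2
    rw [zero_mul, ← h2]
    exact h1.sub_const _
  have := eq_zero_of_linear_ode (q := fun s : ℝ => f (S (z' + s • (z - z'))) - f (S z'))
    (κ := fun _ => 0) continuousOn_const hq (by simp)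
  simp only [one_smul, add_sub_cancel] at this
  linarith

end Chart

/-! ### Functions of the potentials -/

section Representation

open Matrix

variable {U V : Set Pt} {g : Metric} {u : VField} {tau alpha mu beta l : Pt → ℝ} {S : Pt → Pt}
  {x₀ x : Pt} {r : ℝ}

theorem vec4_mem_ball {a b : Pt} {r : ℝ} (hr : 0 < r) :
    a ∈ Metric.ball b r ↔
      |a 0 - b 0| < r ∧ |a 1 - b 1| < r ∧ |a 2 - b 2| < r ∧ |a 3 - b 3| < r := by
  rw [Metric.mem_ball, dist_pi_lt_iff hr, Fin.forall_fin_succ, Fin.forall_fin_succ,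
    Fin.forall_fin_succ, Fin.forall_fin_one]
  rfl

theorem pair_mem_ball {a b : ℝ × ℝ} {r : ℝ} :
    a ∈ Metric.ball b r ↔ |a.1 - b.1| < r ∧ |a.2 - b.2| < r := by
  rw [Metric.mem_ball, Prod.dist_eq, max_lt_iff]
  rfl

theorem contDiff_vec4 {E : Type*} [NormedAddCommGroup E] [NormedSpace ℝ E] {a b c d : E → ℝ}
    (ha : ContDiff ℝ ∞ a) (hb : ContDiff ℝ ∞ b) (hc : ContDiff ℝ ∞ c) (hd : ContDiff ℝ ∞ d) :
    ContDiff ℝ ∞ (fun p => (![a p, b p, c p, d p] : Pt)) := by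
  rw [contDiff_pi]
  intro i
  fin_cases i
  exacts [ha, hb, hc, hd]

namespace FlowChart

theorem image_tau_alpha (C : FlowChart U V g u tau alpha mu beta l S x₀ r) :
    (fun x => (tau x, alpha x)) '' V = Metric.ball (tau x₀, alpha x₀) r := by
  ext q
  rw [pair_mem_ball]
  constructor
  · rintro ⟨x, hx, rfl⟩
    obtain ⟨h0, h1, -, -⟩ := (vec4_mem_ball C.r_pos).1 (C.mapsTo x hx)
    exact ⟨h0, h1⟩
  · rintro ⟨h0, h1⟩
    have hq : ![q.1, q.2, mu x₀, l x₀] ∈ Metric.ball ![tau x₀, alpha x₀, mu x₀, l x₀] r :=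
      (vec4_mem_ball C.r_pos).2 ⟨h0, h1, by simp [C.r_pos], by simp [C.r_pos]⟩
    exact ⟨S ![q.1, q.2, mu x₀, l x₀], C.inv_mapsTo _ hq,
      Prod.ext (congrFun (C.right_inv _ hq) 0) (congrFun (C.right_inv _ hq) 1)⟩

/-- A function with `f~ = f^ = 0` is constant where `τ` and `α` are, because the coordinate cube is
convex; its values on the slice through the centre define `F`. -/
theorem exists_representedBy (C : FlowChart U V g u tau alpha mu beta l S x₀ r) {f : Pt → ℝ}
    (hf : ContDiffOn ℝ ∞ f V) (h1 : ∀ x ∈ V, tildeD g u f x = 0)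
    (h2 : ∀ x ∈ V, hatD g u f x = 0) : ∃ F, RepresentedBy V tau alpha f F := by
  have hmem : ∀ q ∈ (fun x => (tau x, alpha x)) '' V,
      ![q.1, q.2, mu x₀, l x₀] ∈ Metric.ball ![tau x₀, alpha x₀, mu x₀, l x₀] r := by
    intro q hq
    rw [C.image_tau_alpha, pair_mem_ball] at hq
    exact (vec4_mem_ball C.r_pos).2 ⟨hq.1, hq.2, by simp [C.r_pos], by simp [C.r_pos]⟩
  refine ⟨fun q => f (S ![q.1, q.2, mu x₀, l x₀]), ?_, ?_⟩
  · exact (hf.comp C.smooth_inv C.inv_mapsTo).comp (contDiff_vec4 contDiff_fst contDiff_snd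
      contDiff_const contDiff_const).contDiffOn hmem
  · intro x hx
    conv_lhs => rw [← C.left_inv x hx]
    refine C.eq_of_dS_dot_eq_zero hf (C.mapsTo x hx) (hmem _ ⟨x, hx, rfl⟩) fun y hy => ?_
    obtain ⟨k0, k1, -⟩ := C.dS_dot_fderiv_inv hy
      (![tau x, alpha x, mu x, l x] - ![tau x, alpha x, mu x₀, l x₀])
    have hSy := C.inv_mapsTo y hy
    obtain ⟨e0, e1⟩ := C.dot_eq_zero_of_tau_alpha hSy (k0.trans (sub_self (tau x)))
      (k1.trans (sub_self (alpha x)))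
    rw [(C.frame hSy).dot_expand, e0, e1, ← tildeD_eq, ← hatD_eq, h1 _ hSy, h2 _ hSy]
    ring

/-- `β` is a function of `τ, α, μ`, since `β^ = 0`. -/
theorem exists_beta_fun (C : FlowChart U V g u tau alpha mu beta l S x₀ r) :
    ∃ B : ℝ × ℝ × ℝ → ℝ, ContDiffOn ℝ ∞ B ((fun x => (tau x, alpha x, mu x)) '' V) ∧
      ∀ x ∈ V, beta x = B (tau x, alpha x, mu x) := by
  have hmem : ∀ q ∈ (fun x => (tau x, alpha x, mu x)) '' V,
      ![q.1, q.2.1, q.2.2, l x₀] ∈ Metric.ball ![tau x₀, alpha x₀, mu x₀, l x₀] r := by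
    rintro q ⟨x, hx, rfl⟩
    obtain ⟨h0, h1, h2, -⟩ := (vec4_mem_ball C.r_pos).1 (C.mapsTo x hx)
    exact (vec4_mem_ball C.r_pos).2 ⟨h0, h1, h2, by simp [C.r_pos]⟩
  refine ⟨fun q => beta (S ![q.1, q.2.1, q.2.2, l x₀]), ?_, ?_⟩
  · exact (C.smooth_beta.comp C.smooth_inv C.inv_mapsTo).comp (contDiff_vec4 contDiff_fst
      (contDiff_fst.comp contDiff_snd) (contDiff_snd.comp contDiff_snd)
      contDiff_const).contDiffOn hmem
  · intro x hx
    conv_lhs => rw [← C.left_inv x hx]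
    refine C.eq_of_dS_dot_eq_zero C.smooth_beta (C.mapsTo x hx) (hmem _ ⟨x, hx, rfl⟩)
      fun y hy => ?_
    obtain ⟨k0, k1, k2⟩ := C.dS_dot_fderiv_inv hy
      (![tau x, alpha x, mu x, l x] - ![tau x, alpha x, mu x, l x₀])
    have hSy := C.inv_mapsTo y hy
    have k0' := k0.trans (sub_self (tau x))
    have k1' := k1.trans (sub_self (alpha x))
    obtain ⟨e0, e1⟩ := C.dot_eq_zero_of_tau_alpha hSy k0' k1'
    have e2 := C.b_dot_eq_zero_of_tau_alpha_mu hSy k0' k1' (k2.trans (sub_self (mu x)))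
    rw [(C.frame hSy).dot_expand, e0, e1, e2, ← hatD_eq, (C.beta_derivatives hSy).2.2]
    ring

theorem isAdapted (C : FlowChart U V g u tau alpha mu beta l S x₀ r) :
    IsAdapted V g u tau alpha mu beta :=
  ⟨C.smooth_tau, C.smooth_alpha, C.smooth_mu, fun _ hx => C.linearIndependent hx,
    C.exists_beta_fun, C.u_eq, C.a_eq⟩

theorem isOpen_image (C : FlowChart U V g u tau alpha mu beta l S x₀ r) :
    IsOpen ((fun x => (tau x, alpha x)) '' V) := by
  rw [C.image_tau_alpha]; exact Metric.isOpen_ball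

end FlowChart

/-- On an open set `V` with open image under `(τ, α)`, the derivatives of a function
`f = F(τ, α)`. -/
theorem FlowPotentials.derivatives (P : FlowPotentials U V g u tau alpha mu beta)
    (hO : IsOpen ((fun x => (tau x, alpha x)) '' V)) {f : Pt → ℝ} {F : ℝ × ℝ → ℝ}
    (hF : RepresentedBy V tau alpha f F) (hx : x ∈ V) :
    dotD u f x = dTau F (tau x, alpha x) ∧
    starD g u f x = (beta x)⁻¹ * (mu x * dTau F (tau x, alpha x) + dAlpha F (tau x, alpha x)) ∧
    tildeD g u f x = 0 ∧ hatD g u f x = 0 := by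
  have A := P.frame hx
  have h : ∀ X, dS f x ⬝ᵥ X = dTau F (tau x, alpha x) * (dS tau x ⬝ᵥ X) +
      dAlpha F (tau x, alpha x) * (dS alpha x ⬝ᵥ X) := by
    intro X
    have dF : HasFDerivAt F (fderiv ℝ F (tau x, alpha x)) (tau x, alpha x) :=
      ((hF.1.contDiffAt (hO.mem_nhds ⟨x, hx, rfl⟩)).differentiableAt (by simp)).hasFDerivAt
    have dt := (differentiableAt_of_contDiffOn P.isOpen P.smooth_tau hx).hasFDerivAt
    have da := (differentiableAt_of_contDiffOn P.isOpen P.smooth_alpha hx).hasFDerivAt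
    have hc := (dF.comp x (dt.prodMk da)).fderiv
    rw [dS_congr P.isOpen hF.2 hx, dS_dot, dS_dot, dS_dot]
    change fderiv ℝ (F ∘ fun x => (tau x, alpha x)) x X = _
    rw [hc]
    have : (fderiv ℝ tau x X, fderiv ℝ alpha x X) =
        (fderiv ℝ tau x X) • ((1 : ℝ), (0 : ℝ)) + (fderiv ℝ alpha x X) • ((0 : ℝ), (1 : ℝ)) := by
      simp
    change fderiv ℝ F (tau x, alpha x) (fderiv ℝ tau x X, fderiv ℝ alpha x X) = _
    rw [this, map_add, map_smul, map_smul, dTau, dAlpha]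
    simp only [smul_eq_mul]
    ring
  simp only [dotD_eq, starD_eq, tildeD_eq, hatD_eq, h, P.tau_dot hx, P.alpha_dot hx, A.u_u, A.u_a,
    A.u_b, A.u_w, A.a_u, A.a_a, A.a_b, A.a_w]
  exact ⟨by ring, by ring, by ring, by ring⟩

theorem contDiffOn_dTau {D : Set (ℝ × ℝ)} (hD : IsOpen D) {F : ℝ × ℝ → ℝ}
    (hF : ContDiffOn ℝ ∞ F D) : ContDiffOn ℝ ∞ (dTau F) D :=
  (hF.fderiv_of_isOpen hD (by simp)).clm_apply contDiffOn_const

theorem contDiffOn_dAlpha {D : Set (ℝ × ℝ)} (hD : IsOpen D) {F : ℝ × ℝ → ℝ}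
    (hF : ContDiffOn ℝ ∞ F D) : ContDiffOn ℝ ∞ (dAlpha F) D :=
  (hF.fderiv_of_isOpen hD (by simp)).clm_apply contDiffOn_const

namespace FlowPotentials

theorem representedBy_dotD (P : FlowPotentials U V g u tau alpha mu beta)
    (hO : IsOpen ((fun x => (tau x, alpha x)) '' V)) {f : Pt → ℝ} {F : ℝ × ℝ → ℝ}
    (hF : RepresentedBy V tau alpha f F) : RepresentedBy V tau alpha (dotD u f) (dTau F) :=
  ⟨contDiffOn_dTau hO hF.1, fun _ hx => (P.derivatives hO hF hx).1⟩

/-- A solution `P(τ, α)` of the system gives a perfect energy tensor. -/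
theorem isPerfect_of_solvesSystem (Q : FlowPotentials U V g u tau alpha mu beta)
    (hO : IsOpen ((fun x => (tau x, alpha x)) '' V)) {rho p : Pt → ℝ} {P : ℝ × ℝ → ℝ}
    (hne : ∀ x ∈ V, rho x + p x ≠ 0) (hP : RepresentedBy V tau alpha p P)
    (hsys : SolvesSystem V g u tau alpha mu beta P)
    (hrho : ∀ x ∈ V, rho x = - p x - (beta x)⁻¹ *
      (mu x * dTau P (tau x, alpha x) + dAlpha P (tau x, alpha x))) :
    IsPerfect V g u rho p := by
  have hmaps : Set.MapsTo (fun x => (tau x, alpha x)) V ((fun x => (tau x, alpha x)) '' V) :=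
    fun x hx => ⟨x, hx, rfl⟩
  have sta : ContDiffOn ℝ ∞ (fun x => (tau x, alpha x)) V := Q.smooth_tau.prodMk Q.smooth_alpha
  have sp : ContDiffOn ℝ ∞ p V := (hP.1.comp sta hmaps).congr hP.2
  have sT : ContDiffOn ℝ ∞ (fun x => dTau P (tau x, alpha x)) V :=
    (contDiffOn_dTau hO hP.1).comp sta hmaps
  have sA : ContDiffOn ℝ ∞ (fun x => dAlpha P (tau x, alpha x)) V :=
    (contDiffOn_dAlpha hO hP.1).comp sta hmaps
  have srho : ContDiffOn ℝ ∞ rho V :=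
    (sp.neg.sub ((Q.smooth_beta.inv fun x hx => Q.beta_ne_zero hx).mul
      ((Q.smooth_mu.mul sT).add sA))).congr hrho
  set h : Pt → ℝ := fun y => -1 * (rho y + p y) with hh
  have sh : ContDiffOn ℝ ∞ h V := contDiffOn_const.mul (srho.add sp)
  have sf := Q.smooth_dotD sp
  have hdp : ∀ x ∈ V, ∀ i, pd i p x = -dotD u p x * flat g u x i + h x * acc g u x i := by
    intro x hx i
    obtain ⟨-, h2, h3, h4⟩ := Q.derivatives hO hP hx
    rw [pd_eq_of_tilde_hat (Q.frame hx) h3 h4, h2]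
    have := hrho x hx
    have e : h x = (beta x)⁻¹ *
        (mu x * dTau P (tau x, alpha x) + dAlpha P (tau x, alpha x)) := by
      simp only [hh]; linarith
    rw [e]
  refine ⟨srho, sp, hne, fun x hx => ?_⟩
  have A := Q.frame hx
  have hua : ∑ k, u x k * acc g u x k = 0 := by rw [← A.a_u]; exact dotProduct_comm _ _
  have dr := differentiableAt_of_contDiffOn Q.isOpen srho hx
  have dp := differentiableAt_of_contDiffOn Q.isOpen sp hx
  refine (divT_eq_zero_iff Q.isOpen_domain Q.metric Q.unit (Q.subset hx) dr dp hua).2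
    ⟨fun k => by rw [hdp x hx k]; ring, ?_⟩
  have K := (integrability Q.isOpen_domain Q.metric Q.unit Q.flow Q.isOpen Q.subset sp sf sh hdp
    hx).1
  have hP' := Q.representedBy_dotD hO hP
  rw [(Q.derivatives hO hP' hx).2.1, hP'.2 x hx] at K
  rw [hP'.2 x hx]
  obtain ⟨s1, s2⟩ := hsys x hx
  have hb := Q.beta_ne_zero hx
  have e : dotD u h x = -1 * dotD u (fun y => rho y + p y) x := by
    rw [dotD_eq, dS_const_mul_dot (dr.fun_add dp), ← dotD_eq]
  rw [e] at K
  have e2 := hrho x hx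
  simp only [hh] at K
  simp only [nu, Om] at s1 s2
  set T := dTau P (tau x, alpha x)
  set TT := dTau (dTau P) (tau x, alpha x)
  set TA := dAlpha (dTau P) (tau x, alpha x)
  -- By the system, `β f^* = -β (2 f + Ω h)`.
  have e3 : mu x * TT + TA = -(beta x) * (2 * T - (expansion g u x - cu g u x) *
      (rho x + p x)) := by
    rw [e2]
    field_simp
    linear_combination mu x * s1 + s2
  rw [e3] at K
  field_simp at K
  linear_combination K

/-- Conversely, the pressure of a perfect energy tensor solves the system. -/
theorem solvesSystem_of_isPerfect (Q : FlowPotentials U V g u tau alpha mu beta)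
    (hO : IsOpen ((fun x => (tau x, alpha x)) '' V)) {rho p : Pt → ℝ} {P : ℝ × ℝ → ℝ}
    (hp : IsPerfect V g u rho p) (hP : RepresentedBy V tau alpha p P) :
    SolvesSystem V g u tau alpha mu beta P ∧ ∀ x ∈ V, rho x = - p x - (beta x)⁻¹ *
      (mu x * dTau P (tau x, alpha x) + dAlpha P (tau x, alpha x)) := by
  have hrho : ∀ x ∈ V, rho x = - p x - (beta x)⁻¹ *
      (mu x * dTau P (tau x, alpha x) + dAlpha P (tau x, alpha x)) := by
    intro x hx
    have A := Q.frame hx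
    have h2 := hp.dS_eq Q.isOpen_domain Q.metric Q.unit Q.flow Q.isOpen Q.subset hx
    have h3 : starD g u p x = -1 * (rho x + p x) := by
      rw [starD_eq, h2, add_dotProduct, smul_dotProduct, smul_dotProduct, A.u_a, A.a_a]
      simp
    rw [(Q.derivatives hO hP hx).2.1] at h3
    linarith
  refine ⟨fun x hx => ?_, hrho⟩
  have hP' := Q.representedBy_dotD hO hP
  obtain ⟨h1, h2, -, -⟩ :=
    hp.conditions Q.isOpen_domain Q.metric Q.unit Q.flow Q.isOpen Q.subset hx
  obtain ⟨d1, d2, -, -⟩ := Q.derivatives hO hP' hx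
  rw [d1, hP'.2 x hx] at h1
  rw [d2, hP'.2 x hx, hrho x hx] at h2
  have hb := Q.beta_ne_zero hx
  refine ⟨by linarith, ?_⟩
  field_simp at h2
  simp only [nu] at h1
  linear_combination h2 - mu x * h1

end FlowPotentials

theorem FlowChart.isPerfect_iff (C : FlowChart U V g u tau alpha mu beta l S x₀ r)
    (rho p : Pt → ℝ) : IsPerfect V g u rho p ↔ (∀ x ∈ V, rho x + p x ≠ 0) ∧
      ∃ P : ℝ × ℝ → ℝ, RepresentedBy V tau alpha p P ∧
        SolvesSystem V g u tau alpha mu beta P ∧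
        ∀ x ∈ V, rho x = - p x - (beta x)⁻¹ *
          (mu x * dTau P (tau x, alpha x) + dAlpha P (tau x, alpha x)) := by
  constructor
  · intro hp
    have hdp : ∀ x ∈ V, ∀ s, s ⬝ᵥ flat g u x = 0 → s ⬝ᵥ acc g u x = 0 → dS p x ⬝ᵥ s = 0 := by
      intro x hx s h1 h2
      rw [hp.dS_eq C.isOpen_domain C.metric C.unit C.flow C.isOpen C.subset hx, dotProduct_comm,
        dotProduct_add, dotProduct_smul, dotProduct_smul, h1, h2]
      simp
    obtain ⟨P, hP⟩ := C.exists_representedBy hp.smooth_p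
      (fun x hx => by
        rw [tildeD_eq]
        exact hdp x hx _ (by rw [dotProduct_comm, (C.frame hx).u_b])
          (by rw [dotProduct_comm, (C.frame hx).a_b]))
      (fun x hx => by
        rw [hatD_eq]
        exact hdp x hx _ (by rw [dotProduct_comm, (C.frame hx).u_w])
          (by rw [dotProduct_comm, (C.frame hx).a_w]))
    obtain ⟨h1, h2⟩ := C.solvesSystem_of_isPerfect C.isOpen_image hp hP
    exact ⟨hp.nonzero, P, hP, h1, h2⟩
  · rintro ⟨hne, P, hP, hsys, hrho⟩
    exact C.isPerfect_of_solvesSystem C.isOpen_image hne hP hsys hrho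

end Representation

/-! ### The system for the pressure in the plane of `τ` and `α` -/

section PlaneSystem

open Metric

/-- Solutions `t ↦ S (e, t)` of `S' = A (S, t)` near the time `0`, depending smoothly on the initial
value `e`. -/
theorem exists_smooth_flow {E : Type} [NormedAddCommGroup E] [NormedSpace ℝ E]
    [FiniteDimensional ℝ E] {A : E × ℝ → E} {O : Set (E × ℝ)} {e₀ : E} (hO : IsOpen O)
    (h₀ : (e₀, 0) ∈ O) (hA : ContDiffOn ℝ ∞ A O) :
    ∃ δ > 0, ∃ S : E × ℝ → E, ContDiffOn ℝ ∞ S (ball (e₀, 0) δ) ∧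
      (∀ t, (t, (0 : ℝ)) ∈ ball (e₀, (0 : ℝ)) δ → S (t, 0) = t) ∧
      ∀ p ∈ ball (e₀, (0 : ℝ)) δ, (S p, p.2) ∈ O ∧ fderiv ℝ S p (0, 1) = A (S p, p.2) := by
  have hA' : ContDiffOn ℝ ∞ (fun p => ContinuousLinearMap.toSpanSingleton ℝ (A p)) O :=
    (ContinuousLinearMap.toSpanSingletonCLE (𝕜 := ℝ) (E := E)).contDiff.comp_contDiffOn hA
  obtain ⟨δ, hδ, S, hS, hS0, h⟩ := exists_radial_solution hO h₀ hA'
  refine ⟨δ, hδ, S, hS, hS0, fun p hp => ⟨(h p hp).1, ?_⟩⟩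
  have hne : ∀ p ∈ ball (e₀, (0 : ℝ)) δ, p.2 ≠ 0 → fderiv ℝ S p (0, 1) = A (S p, p.2) := by
    intro p hp hp2
    have h1 := (h p hp).2
    rw [show ((0 : E), p.2) = p.2 • ((0 : E), (1 : ℝ)) by simp, map_smul,
      ContinuousLinearMap.toSpanSingleton_apply] at h1
    exact smul_right_injective E hp2 h1
  by_cases hp2 : p.2 = 0
  · -- At time `0` the equation holds by continuity.
    have hc1 : ContinuousAt (fun p => fderiv ℝ S p ((0 : E), (1 : ℝ))) p :=
      (((hS.fderiv_of_isOpen (m := ∞) isOpen_ball (by simp)).clm_apply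
        contDiffOn_const).continuousOn).continuousAt (isOpen_ball.mem_nhds hp)
    have hcS : ContinuousAt S p := hS.continuousOn.continuousAt (isOpen_ball.mem_nhds hp)
    have hc2 : ContinuousAt (fun p => A (S p, p.2)) p :=
      ContinuousAt.comp (f := fun p : E × ℝ => (S p, p.2))
        (hA.continuousOn.continuousAt (hO.mem_nhds (h p hp).1)) (hcS.prodMk continuousAt_snd)
    have hl : Filter.Tendsto (fun s : ℝ => (p.1, s)) (nhdsWithin 0 {0}ᶜ) (nhds p) := by
      have : Continuous fun s : ℝ => (p.1, s) := by fun_prop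
      have h1 := this.tendsto 0
      rw [← hp2] at h1
      rw [← hp2]
      exact h1.mono_left nhdsWithin_le_nhds
    refine tendsto_nhds_unique_of_eventuallyEq (hc1.tendsto.comp hl) (hc2.tendsto.comp hl) ?_
    filter_upwards [hl (isOpen_ball.mem_nhds hp), self_mem_nhdsWithin] with s hs hs0
    exact hne _ hs hs0
  · exact hne p hp hp2

variable {D : Set (ℝ × ℝ)} {f h : ℝ × ℝ → ℝ} {q : ℝ × ℝ}

theorem plane_differentiableAt (hD : IsOpen D) (hf : ContDiffOn ℝ ∞ f D) (hq : q ∈ D) :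
    DifferentiableAt ℝ f q :=
  (hf.contDiffAt (hD.mem_nhds hq)).differentiableAt (by simp)

theorem fderiv_mul_apply (hf : DifferentiableAt ℝ f q) (hh : DifferentiableAt ℝ h q) (v : ℝ × ℝ) :
    fderiv ℝ (fun q => f q * h q) q v = fderiv ℝ f q v * h q + f q * fderiv ℝ h q v := by
  rw [fderiv_fun_mul hf hh]
  simp only [_root_.add_apply, _root_.smul_apply, smul_eq_mul]
  ring

theorem dTau_dAlpha_comm (hD : IsOpen D) (hf : ContDiffOn ℝ ∞ f D) (hq : q ∈ D) :
    dTau (dAlpha f) q = dAlpha (dTau f) q :=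
  fderiv_fderiv_comm (hf.contDiffAt (hD.mem_nhds hq)) (1, 0) (0, 1)

theorem dTau_congr (hD : IsOpen D) (hfh : ∀ y ∈ D, f y = h y) (hq : q ∈ D) :
    dTau f q = dTau h q := by
  have : f =ᶠ[nhds q] h := by filter_upwards [hD.mem_nhds hq] with y hy using hfh y hy
  simp only [dTau, this.fderiv_eq]

theorem dAlpha_congr (hD : IsOpen D) (hfh : ∀ y ∈ D, f y = h y) (hq : q ∈ D) :
    dAlpha f q = dAlpha h q := by
  have : f =ᶠ[nhds q] h := by filter_upwards [hD.mem_nhds hq] with y hy using hfh y hy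
  simp only [dAlpha, this.fderiv_eq]

/-- A solution on a ball of a linear equation `f_τ = κ f` which vanishes on the line `τ = t₀`. -/
theorem eq_zero_of_dTau_eq {t₀ a₀ ε : ℝ} {κ : ℝ × ℝ → ℝ}
    (hf : ContDiffOn ℝ ∞ f (ball (t₀, a₀) ε)) (hκ : ContinuousOn κ (ball (t₀, a₀) ε))
    (heq : ∀ q ∈ ball (t₀, a₀) ε, dTau f q = κ q * f q)
    (h0 : ∀ a, (t₀, a) ∈ ball (t₀, a₀) ε → f (t₀, a) = 0) (hq : q ∈ ball (t₀, a₀) ε) :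
    f q = 0 := by
  have hq' := pair_mem_ball.1 hq
  have hline : (t₀, q.2) ∈ ball (t₀, a₀) ε :=
    pair_mem_ball.2 ⟨by simpa using (abs_nonneg _).trans_lt hq'.1, hq'.2⟩
  have hseg : ∀ s ∈ Set.Icc (0 : ℝ) 1, (t₀ + s * (q.1 - t₀), q.2) ∈ ball (t₀, a₀) ε := by
    intro s hs
    refine pair_mem_ball.2 ⟨?_, hq'.2⟩
    simp only [add_sub_cancel_left, abs_mul, abs_of_nonneg hs.1]
    exact (mul_le_of_le_one_left (abs_nonneg _) hs.2).trans_lt hq'.1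
  have hcont : Continuous fun s : ℝ => (t₀ + s * (q.1 - t₀), q.2) := by fun_prop
  have := eq_zero_of_linear_ode (q := fun s : ℝ => f (t₀ + s * (q.1 - t₀), q.2))
    (κ := fun s => (q.1 - t₀) * κ (t₀ + s * (q.1 - t₀), q.2))
    (continuousOn_const.mul (hκ.comp hcont.continuousOn hseg)) ?_ ?_
  · simpa using this
  · intro s hs
    have hl : HasDerivAt (fun s : ℝ => (t₀ + s * (q.1 - t₀), q.2)) (q.1 - t₀, 0) s := by
      refine HasDerivAt.prodMk ?_ (hasDerivAt_const _ _)
      simpa using ((hasDerivAt_id s).mul_const (q.1 - t₀)).const_add t₀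
    have hd := (plane_differentiableAt isOpen_ball hf (hseg s hs)).hasFDerivAt.comp_hasDerivAt s hl
    have e := heq _ (hseg s hs)
    rw [dTau] at e
    rw [mul_assoc, ← e, ← smul_eq_mul, ← map_smul]
    exact hd.congr_deriv (by simp)
  · simpa using h0 _ hline

/-- The system `P_ττ + N P_τ = 0`, `P_τα + O P_α + 2 Σ P_τ = 0` has, under its compatibility
conditions, a solution with `P_τ = 0` and `P_α = 1` at a given point. -/
theorem exists_plane_solution (hD : IsOpen D) {t₀ a₀ : ℝ} (hm : (t₀, a₀) ∈ D)
    {N O Z : ℝ × ℝ → ℝ} (hN : ContDiffOn ℝ ∞ N D) (hO : ContDiffOn ℝ ∞ O D)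
    (hZ : ContDiffOn ℝ ∞ Z D) (hO' : ∀ q ∈ D, dTau O q = -((N q - O q) * O q))
    (hZ' : ∀ q ∈ D, 2 * dTau Z q = dAlpha N q + 2 * Z q * O q) :
    ∃ ε > 0, ball (t₀, a₀) ε ⊆ D ∧ ∃ P : ℝ × ℝ → ℝ, ContDiffOn ℝ ∞ P (ball (t₀, a₀) ε) ∧
      dTau P (t₀, a₀) = 0 ∧ dAlpha P (t₀, a₀) = 1 ∧ ∀ q ∈ ball (t₀, a₀) ε,
        dTau (dTau P) q + N q * dTau P q = 0 ∧
        dAlpha (dTau P) q + O q * dAlpha P q + 2 * Z q * dTau P q = 0 := by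
  -- The values `F₀ = P_τ` on the line `τ = t₀`, where `P = α - a₀`.
  obtain ⟨δ₀, hδ₀, S₀, sS₀, hS₀, hS₀'⟩ := exists_smooth_flow (E := ℝ) (e₀ := 0)
    (O := (fun p : ℝ × ℝ => (t₀, a₀ + p.2)) ⁻¹' D)
    (A := fun p => -O (t₀, a₀ + p.2) - 2 * Z (t₀, a₀ + p.2) * p.1)
    (hD.preimage (by fun_prop)) (by simpa using hm) (by
      have hc : ContDiff ℝ ∞ fun p : ℝ × ℝ => (t₀, a₀ + p.2) := by fun_prop
      exact ((hO.comp hc.contDiffOn fun _ h => h).neg).sub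
        ((contDiffOn_const.mul (hZ.comp hc.contDiffOn fun _ h => h)).mul contDiff_fst.contDiffOn))
  set F₀ : ℝ → ℝ := fun a => S₀ (0, a - a₀) with hF₀
  have hI : ∀ a, |a - a₀| < δ₀ → ((0 : ℝ), a - a₀) ∈ ball ((0 : ℝ), (0 : ℝ)) δ₀ := fun a ha =>
    pair_mem_ball.2 ⟨by simpa using hδ₀, by simpa using ha⟩
  have dF₀ : ∀ a, |a - a₀| < δ₀ →
      HasDerivAt F₀ (-O (t₀, a) - 2 * Z (t₀, a) * F₀ a) a := by
    intro a ha
    have hl : HasDerivAt (fun a : ℝ => ((0 : ℝ), a - a₀)) (0, 1) a :=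
      (hasDerivAt_const _ _).prodMk ((hasDerivAt_id a).sub_const a₀)
    have h1 := (plane_differentiableAt isOpen_ball sS₀ (hI a ha)).hasFDerivAt.comp_hasDerivAt a hl
    rw [(hS₀' _ (hI a ha)).2] at h1
    exact h1.congr_deriv (by simp [hF₀])
  -- The equations `P_τ = f`, `f_τ = -N f`, with `α` carried along as a parameter.
  obtain ⟨δ₁, hδ₁, S₁, sS₁, hS₁, hS₁'⟩ := exists_smooth_flow (E := ℝ × ℝ × ℝ) (e₀ := (0, 0, a₀))
    (O := (fun p : (ℝ × ℝ × ℝ) × ℝ => (t₀ + p.2, p.1.2.2)) ⁻¹' D)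
    (A := fun p => (p.1.2.1, -(N (t₀ + p.2, p.1.2.2) * p.1.2.1), 0))
    (hD.preimage (by fun_prop)) (by simpa using hm) (by
      have hc : ContDiff ℝ ∞ fun p : (ℝ × ℝ × ℝ) × ℝ => (t₀ + p.2, p.1.2.2) := by fun_prop
      have hc2 : ContDiff ℝ ∞ fun p : (ℝ × ℝ × ℝ) × ℝ => p.1.2.1 := by fun_prop
      exact hc2.contDiffOn.prodMk
        (((hN.comp hc.contDiffOn fun _ h => h).mul hc2.contDiffOn).neg.prodMk contDiffOn_const))
  set Φ : ℝ × ℝ → (ℝ × ℝ × ℝ) × ℝ := fun q => ((q.2 - a₀, F₀ q.2, q.2), q.1 - t₀) with hΦ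
  have hI' : ∀ q ∈ ball (t₀, a₀) δ₀, ((0 : ℝ), q.2 - a₀) ∈ ball ((0 : ℝ), (0 : ℝ)) δ₀ := fun q hq =>
    hI _ (pair_mem_ball.1 hq).2
  have sΦ : ContDiffOn ℝ ∞ Φ (ball (t₀, a₀) δ₀) := by
    have hc : ContDiff ℝ ∞ fun q : ℝ × ℝ => ((0 : ℝ), q.2 - a₀) := by fun_prop
    have hc1 : ContDiff ℝ ∞ fun q : ℝ × ℝ => q.2 - a₀ := by fun_prop
    have hc2 : ContDiff ℝ ∞ fun q : ℝ × ℝ => q.1 - t₀ := by fun_prop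
    exact (hc1.contDiffOn.prodMk ((sS₀.comp hc.contDiffOn hI').prodMk
      contDiff_snd.contDiffOn)).prodMk hc2.contDiffOn
  have hF₀a : F₀ a₀ = 0 := by
    simp only [hF₀, sub_self]
    exact hS₀ 0 (mem_ball_self hδ₀)
  have hΦ₀ : Φ (t₀, a₀) = ((0, 0, a₀), 0) := by simp [hΦ, hF₀a]
  obtain ⟨ε, hε, hsub⟩ : ∃ ε > 0, ball (t₀, a₀) ε ⊆
      D ∩ (ball (t₀, a₀) δ₀ ∩ Φ ⁻¹' ball ((0, 0, a₀), (0 : ℝ)) δ₁) := by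
    refine Metric.isOpen_iff.1
      (hD.inter (sΦ.continuousOn.isOpen_inter_preimage isOpen_ball isOpen_ball)) _
      ⟨hm, mem_ball_self hδ₀, ?_⟩
    rw [Set.mem_preimage, hΦ₀]
    exact mem_ball_self hδ₁
  set B := ball (t₀, a₀) ε with hB
  have hBo : IsOpen B := isOpen_ball
  have hBD : B ⊆ D := fun q hq => (hsub hq).1
  set G : ℝ × ℝ → ℝ × ℝ × ℝ := fun q => S₁ (Φ q) with hG
  have sG : ContDiffOn ℝ ∞ G B :=
    sS₁.comp (sΦ.mono fun q hq => (hsub hq).2.1) fun q hq => (hsub hq).2.2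
  have dG : ∀ q ∈ B, DifferentiableAt ℝ G q := fun q hq =>
    (sG.contDiffAt (hBo.mem_nhds hq)).differentiableAt (by simp)
  -- `G` solves the equations in `τ`, because `∂Φ/∂τ` is the unit time vector.
  have dGτ : ∀ q ∈ B, fderiv ℝ G q (1, 0) =
      ((G q).2.1, -(N (q.1, (G q).2.2) * (G q).2.1), 0) := by
    intro q hq
    have h1 : HasDerivAt (fun t => Φ (t, q.2)) ((0, 0, 0), 1) q.1 :=
      (hasDerivAt_const q.1 (q.2 - a₀, F₀ q.2, q.2)).prodMk ((hasDerivAt_id q.1).sub_const t₀)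
    have hS := ((sS₁.contDiffAt (isOpen_ball.mem_nhds (hsub hq).2.2)).differentiableAt
      (by simp)).hasFDerivAt
    have h2 : HasDerivAt (fun t => S₁ (Φ (t, q.2))) (fderiv ℝ S₁ (Φ q) ((0, 0, 0), 1)) q.1 :=
      HasFDerivAt.comp_hasDerivAt q.1 (f := fun t => Φ (t, q.2)) hS h1
    have h3 : HasDerivAt (fun t => G (t, q.2)) (fderiv ℝ G q (1, 0)) q.1 :=
      HasFDerivAt.comp_hasDerivAt q.1 (f := fun t => (t, q.2)) (dG q hq).hasFDerivAt
        ((hasDerivAt_id q.1).prodMk (hasDerivAt_const _ _))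
    rw [h3.unique h2]
    have h4 := (hS₁' _ (hsub hq).2.2).2
    have h5 : t₀ + (Φ q).2 = q.1 := by simp [hΦ]
    rw [h5] at h4
    exact h4
  have hG0 : ∀ a, (t₀, a) ∈ B → G (t₀, a) = (a - a₀, F₀ a, a) := by
    intro a ha
    have h1 : Φ (t₀, a) = ((a - a₀, F₀ a, a), 0) := by simp [hΦ]
    have h2 := (hsub ha).2.2
    rw [Set.mem_preimage, h1] at h2
    simp only [hG, h1]
    exact hS₁ _ h2
  set P : ℝ × ℝ → ℝ := fun q => (G q).1 with hP
  set f : ℝ × ℝ → ℝ := fun q => (G q).2.1 with hf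
  have sP : ContDiffOn ℝ ∞ P B := contDiff_fst.comp_contDiffOn sG
  have sf : ContDiffOn ℝ ∞ f B := (contDiff_fst.comp contDiff_snd).comp_contDiffOn sG
  have sA : ContDiffOn ℝ ∞ (fun q => (G q).2.2 - q.2) B :=
    ((contDiff_snd.comp contDiff_snd).comp_contDiffOn sG).sub contDiff_snd.contDiffOn
  have hproj : ∀ (π : ℝ × ℝ × ℝ →L[ℝ] ℝ), ∀ q ∈ B, ∀ v,
      fderiv ℝ (fun q => π (G q)) q v = π (fderiv ℝ G q v) := by
    intro π q hq v
    have := (π.hasFDerivAt.comp q (dG q hq).hasFDerivAt).fderiv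
    exact congrArg (fun M : ℝ × ℝ →L[ℝ] ℝ => M v) this
  have hA : ∀ q ∈ B, (G q).2.2 = q.2 := by
    intro q hq
    refine sub_eq_zero.1 (eq_zero_of_dTau_eq (κ := fun _ => 0) sA continuousOn_const ?_ ?_ hq)
    · intro q hq
      have h1 := hproj ((ContinuousLinearMap.snd ℝ ℝ ℝ).comp (ContinuousLinearMap.snd ℝ ℝ (ℝ × ℝ)))
        q hq (1, 0)
      rw [dGτ q hq] at h1
      have h2 : DifferentiableAt ℝ (fun q => (G q).2.2) q := (dG q hq).snd.snd
      rw [dTau, fderiv_fun_sub h2 differentiableAt_snd, _root_.sub_apply, fderiv_snd, zero_mul]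
      simpa using h1
    · intro a ha
      rw [hG0 a ha]; simp
  have hPτ : ∀ q ∈ B, dTau P q = f q := by
    intro q hq
    have h1 := hproj (ContinuousLinearMap.fst ℝ ℝ (ℝ × ℝ)) q hq (1, 0)
    rw [dGτ q hq] at h1
    exact h1
  have hfτ : ∀ q ∈ B, dTau f q = -(N q * f q) := by
    intro q hq
    have h1 := hproj ((ContinuousLinearMap.fst ℝ ℝ ℝ).comp (ContinuousLinearMap.snd ℝ ℝ (ℝ × ℝ)))
      q hq (1, 0)
    rw [dGτ q hq, hA q hq] at h1
    exact h1
  have hBa : ∀ a, (t₀, a) ∈ B → |a - a₀| < δ₀ := fun a ha => (pair_mem_ball.1 (hsub ha).2.1).2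
  have hα : ∀ (k : ℝ × ℝ → ℝ) (k₀ : ℝ → ℝ) (k' a : ℝ), (t₀, a) ∈ B → ContDiffOn ℝ ∞ k B →
      (∀ a, (t₀, a) ∈ B → k (t₀, a) = k₀ a) → HasDerivAt k₀ k' a → dAlpha k (t₀, a) = k' := by
    intro k k₀ k' a ha hk hkk h0
    have hev : (fun a => k (t₀, a)) =ᶠ[nhds a] k₀ := by
      have hc : Continuous fun a : ℝ => (t₀, a) := by fun_prop
      filter_upwards [(hBo.preimage hc).mem_nhds ha] with y hy using hkk y hy
    have h3 : HasDerivAt (fun a => k (t₀, a)) (fderiv ℝ k (t₀, a) (0, 1)) a :=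
      HasFDerivAt.comp_hasDerivAt a (f := fun a => (t₀, a))
        (plane_differentiableAt hBo hk ha).hasFDerivAt
        ((hasDerivAt_const _ _).prodMk (hasDerivAt_id a))
    exact h3.unique (h0.congr_of_eventuallyEq hev)
  have hPα₀ : ∀ a, (t₀, a) ∈ B → dAlpha P (t₀, a) = 1 := fun a ha =>
    hα P (fun a => a - a₀) 1 a ha sP (fun a ha => by simp only [hP, hG0 a ha])
      ((hasDerivAt_id a).sub_const a₀)
  have hfα₀ : ∀ a, (t₀, a) ∈ B → dAlpha f (t₀, a) = -O (t₀, a) - 2 * Z (t₀, a) * F₀ a := fun a ha =>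
    hα f F₀ _ a ha sf (fun a ha => by simp only [hf, hG0 a ha]) (dF₀ a (hBa a ha))
  have hc : (t₀, a₀) ∈ B := mem_ball_self hε
  -- The left side `R` of the second equation vanishes on `τ = t₀` by the choice of `F₀`, and the
  -- compatibility conditions give `R_τ = (O - N) R`.
  set R : ℝ × ℝ → ℝ := fun q => dAlpha f q + (O q * dAlpha P q + 2 * (Z q * f q)) with hR
  have sO := hO.mono hBD
  have sZ := hZ.mono hBD
  have sN := hN.mono hBD
  have sfα := contDiffOn_dAlpha hBo sf
  have sPα := contDiffOn_dAlpha hBo sP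
  have sR : ContDiffOn ℝ ∞ R B :=
    sfα.add ((sO.mul sPα).add (contDiffOn_const.mul (sZ.mul sf)))
  have hRτ : ∀ q ∈ B, dTau R q = (O q - N q) * R q := by
    intro q hq
    have d1 := plane_differentiableAt hBo sfα hq
    have d2 := plane_differentiableAt hBo sO hq
    have d3 := plane_differentiableAt hBo sPα hq
    have d4 := plane_differentiableAt hBo sZ hq
    have d5 := plane_differentiableAt hBo sf hq
    have d6 := plane_differentiableAt hBo sN hq
    have e1 : dTau R q = dTau (dAlpha f) q + ((dTau O q * dAlpha P q + O q * dTau (dAlpha P) q) +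
        2 * (dTau Z q * f q + Z q * dTau f q)) := by
      simp only [dTau, hR]
      rw [fderiv_fun_add d1 ((d2.fun_mul d3).fun_add ((d4.fun_mul d5).const_mul 2)),
        _root_.add_apply, fderiv_fun_add (d2.fun_mul d3) ((d4.fun_mul d5).const_mul 2),
        _root_.add_apply, fderiv_mul_apply d2 d3, fderiv_const_mul (d4.fun_mul d5),
        _root_.smul_apply, fderiv_mul_apply d4 d5, smul_eq_mul]
    have e2 : dTau (dAlpha f) q = -(dAlpha N q * f q + N q * dAlpha f q) := by
      rw [dTau_dAlpha_comm hBo sf hq, dAlpha_congr hBo hfτ hq]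
      simp only [dAlpha]
      rw [fderiv_fun_neg, _root_.neg_apply, fderiv_mul_apply d6 d5]
    have e3 : dTau (dAlpha P) q = dAlpha f q := by
      rw [dTau_dAlpha_comm hBo sP hq, dAlpha_congr hBo hPτ hq]
    rw [e1, e2, e3, hO' q (hBD hq), hfτ q hq]
    simp only [hR]
    linear_combination f q * hZ' q (hBD hq)
  have hR0 : ∀ q ∈ B, R q = 0 := fun q hq =>
    eq_zero_of_dTau_eq sR (sO.sub sN).continuousOn hRτ (fun a ha => by
      have e : f (t₀, a) = F₀ a := by simp only [hf, hG0 a ha]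
      simp only [hR]
      rw [hPα₀ a ha, hfα₀ a ha, e]
      ring) hq
  refine ⟨ε, hε, hBD, P, sP, ?_, hPα₀ a₀ hc, fun q hq => ⟨?_, ?_⟩⟩
  · rw [hPτ _ hc]
    simp only [hf, hG0 a₀ hc, hF₀a]
  · rw [dTau_congr hBo hPτ hq, hfτ q hq, hPτ q hq]; ring
  · rw [dAlpha_congr hBo hPτ hq, hPτ q hq]
    have := hR0 q hq
    simp only [hR] at this
    linear_combination this

end PlaneSystem

/-! ### Existence of perfect energy tensors -/

section Existence

open Matrix

variable {U V : Set Pt} {g : Metric} {u : VField} {tau alpha mu beta l : Pt → ℝ} {S : Pt → Pt}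
  {x₀ x : Pt} {r : ℝ}

/-- The cube of a chart can be shrunk into any neighbourhood of its centre. -/
theorem FlowChart.exists_restrict (C : FlowChart U V g u tau alpha mu beta l S x₀ r) {N : Set Pt}
    (hN : N ∈ nhds x₀) : ∃ W ⊆ N, ∃ r', FlowChart U W g u tau alpha mu beta l S x₀ r' := by
  set z₀ : Pt := ![tau x₀, alpha x₀, mu x₀, l x₀] with hz₀
  set Ψ : Pt → Pt := fun x => ![tau x, alpha x, mu x, l x] with hΨ
  have cΨ : ContinuousOn Ψ V := by
    rw [continuousOn_pi]
    intro i
    fin_cases i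
    exacts [C.smooth_tau.continuousOn, C.smooth_alpha.continuousOn, C.smooth_mu.continuousOn,
      C.smooth_l.continuousOn]
  have hz : z₀ ∈ Metric.ball z₀ r := Metric.mem_ball_self C.r_pos
  have cS : ContinuousAt S z₀ :=
    C.smooth_inv.continuousOn.continuousAt (Metric.isOpen_ball.mem_nhds hz)
  have hpre : S ⁻¹' N ∩ Metric.ball z₀ r ∈ nhds z₀ :=
    Filter.inter_mem (cS (by rw [C.left_inv x₀ C.mem]; exact hN)) (Metric.isOpen_ball.mem_nhds hz)
  obtain ⟨r', hr', hsub⟩ := Metric.mem_nhds_iff.1 hpre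
  have hWo : IsOpen (V ∩ Ψ ⁻¹' Metric.ball z₀ r') :=
    cΨ.isOpen_inter_preimage C.isOpen Metric.isOpen_ball
  refine ⟨V ∩ Ψ ⁻¹' Metric.ball z₀ r', ?_, r',
    { C.toFlowPotentials.mono Set.inter_subset_left hWo with
      r_pos := hr'
      mem := ⟨C.mem, Metric.mem_ball_self hr'⟩
      smooth_l := C.smooth_l.mono Set.inter_subset_left
      smooth_inv := C.smooth_inv.mono fun z hz => (hsub hz).2
      mapsTo := fun x hx => hx.2
      inv_mapsTo := fun z hz => ⟨C.inv_mapsTo z (hsub hz).2, by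
        rw [Set.mem_preimage]
        simp only [hΨ]
        rw [C.right_inv z (hsub hz).2]
        exact hz⟩
      left_inv := fun x hx => C.left_inv x hx.1
      right_inv := fun z hz => C.right_inv z (hsub hz).2 }⟩
  rintro x ⟨hxV, hx⟩
  have := (hsub hx).1
  rw [Set.mem_preimage] at this
  simp only [hΨ] at this
  rwa [C.left_inv x hxV] at this

namespace FlowChart

theorem exists_nu (C : FlowChart U V g u tau alpha mu beta l S x₀ r)
    (hc : ∀ x ∈ U, hatD g u (Om g u) x = 0) : ∃ F, RepresentedBy V tau alpha (nu g u) F := by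
  refine C.exists_representedBy
    ((contDiffOn_nu C.isOpen_domain C.metric C.unit C.flow).mono C.subset)
    (fun x hx => ?_) fun x hx => ?_
  · have h1 := C.flow.tilde_Om x (C.subset hx)
    have h2 := C.flow.tilde_cb x (C.subset hx)
    rw [tildeD_eq] at h1 h2 ⊢
    rw [C.nu_dS_dot hx, h1, h2]; ring
  · have h1 := hc x (C.subset hx)
    have h2 := C.hat_cb hx
    rw [hatD_eq] at h1 h2 ⊢
    rw [C.nu_dS_dot hx, h1, h2]; ring

theorem exists_Om (C : FlowChart U V g u tau alpha mu beta l S x₀ r)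
    (hc : ∀ x ∈ U, hatD g u (Om g u) x = 0) : ∃ F, RepresentedBy V tau alpha (Om g u) F :=
  C.exists_representedBy ((contDiffOn_Om C.isOpen_domain C.metric C.unit C.flow).mono C.subset)
    (fun x hx => C.flow.tilde_Om x (C.subset hx)) fun x hx => hc x (C.subset hx)

theorem exists_sigma (C : FlowChart U V g u tau alpha mu beta l S x₀ r) :
    ∃ F, RepresentedBy V tau alpha (fun x => beta x - mu x * cb g u x) F :=
  C.exists_representedBy C.smooth_sigma (fun _ hx => (C.sigma_derivatives hx).2.1)
    fun _ hx => (C.sigma_derivatives hx).2.2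

end FlowChart

/-- The two conditions on `Ω` make `ν`, `Ω` and `σ = β - μ c_b` functions of `(τ, α)` which satisfy,
because of `φ₁ = 0`, the compatibility conditions of the system for `p(τ, α)`.  The solution with
`p_τ = 0` and `p_α = 1` at the given point has `ρ + p = -β⁻¹ ≠ 0` there. -/
theorem isPerfectVelocity_of_conditions (hU : IsOpen U) (hg : IsLorentzMetric U g)
    (hu : IsUnitTimelike U g u) (hC : IsFlowClass U g u)
    (hc : ∀ x ∈ U, hatD g u (Om g u) x = 0 ∧
      2 * Om g u x * cb g u x + dotD u (Om g u) x = 0) : IsPerfectVelocity U g u := by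
  intro x₀ hx₀
  obtain ⟨V, -, tau, alpha, mu, beta, l, S, r, C⟩ :=
    exists_flowChart hU hg hu hC hx₀ Filter.univ_mem
  obtain ⟨N, hN⟩ := C.exists_nu fun x hx => (hc x hx).1
  obtain ⟨O, hO⟩ := C.exists_Om fun x hx => (hc x hx).1
  obtain ⟨Z, hZ⟩ := C.exists_sigma
  obtain ⟨ε, hε, hsub, P, sP, hPτ, hPα, hsys⟩ := exists_plane_solution C.isOpen_image
    ⟨x₀, C.mem, rfl⟩ hN.1 hO.1 hZ.1 (by
      rintro q ⟨x, hx, rfl⟩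
      dsimp only
      rw [← (C.derivatives C.isOpen_image hO hx).1, ← hO.2 x hx, ← hN.2 x hx, nu]
      linear_combination (hc x (C.subset hx)).2) (by
      rintro q ⟨x, hx, rfl⟩
      dsimp only
      have h1 := C.derivatives C.isOpen_image hN hx
      have h2 := C.derivatives C.isOpen_image hZ hx
      have h3 := C.flow.varphi1_zero x (C.subset hx)
      have h4 : dotD u (nu g u) x = dotD u (Om g u) x + 2 * dotD u (cb g u) x := by
        simp only [dotD_eq, C.nu_dS_dot hx]
      have h5 := (C.sigma_derivatives hx).1
      have h6 := h1.2.1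
      have h7 := (hc x (C.subset hx)).2
      have hb := C.beta_ne_zero hx
      rw [← h1.1, h4] at h6
      rw [varphi1, h6] at h3
      rw [← h2.1, h5, ← hZ.2 x hx, ← hO.2 x hx]
      field_simp at h3
      simp only [Om] at h3 h7 ⊢
      linear_combination -h3 + mu x * h7)
  set p : Pt → ℝ := fun x => P (tau x, alpha x) with hp
  set h : Pt → ℝ := fun x => (beta x)⁻¹ *
    (mu x * dTau P (tau x, alpha x) + dAlpha P (tau x, alpha x)) with hh
  set W : Set Pt := V ∩ (fun x => (tau x, alpha x)) ⁻¹' Metric.ball (tau x₀, alpha x₀) ε with hW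
  have sta : ContDiffOn ℝ ∞ (fun x => (tau x, alpha x)) V := C.smooth_tau.prodMk C.smooth_alpha
  have hWo : IsOpen W := sta.continuousOn.isOpen_inter_preimage C.isOpen Metric.isOpen_ball
  have hxW : x₀ ∈ W := ⟨C.mem, Metric.mem_ball_self hε⟩
  have ch : ContinuousOn h W := by
    have sW := sta.continuousOn.mono (Set.inter_subset_left : W ⊆ V)
    have hm : Set.MapsTo (fun x => (tau x, alpha x)) W (Metric.ball (tau x₀, alpha x₀) ε) :=
      fun x hx => hx.2
    exact ((C.smooth_beta.continuousOn.inv₀ fun x hx => C.beta_ne_zero hx).mono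
      Set.inter_subset_left).mul (((C.smooth_mu.continuousOn.mono Set.inter_subset_left).mul
      ((contDiffOn_dTau Metric.isOpen_ball sP).continuousOn.comp sW hm)).add
      ((contDiffOn_dAlpha Metric.isOpen_ball sP).continuousOn.comp sW hm))
  have hh₀ : h x₀ ≠ 0 := by
    simp only [hh, hPτ, hPα]
    simpa using C.beta_ne_zero C.mem
  obtain ⟨W', hW', r', C'⟩ := C.exists_restrict
    ((ch.isOpen_inter_preimage hWo isOpen_compl_singleton).mem_nhds
      (show x₀ ∈ W ∩ h ⁻¹' {0}ᶜ from ⟨hxW, hh₀⟩))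
  refine ⟨W', C'.isOpen, C'.mem, C'.subset, fun x => -p x - h x, p,
    C'.isPerfect_of_solvesSystem C'.isOpen_image (P := P) (fun x hx => ?_) ⟨?_, fun x _ => rfl⟩
      (fun x hx => ?_) fun x _ => rfl⟩
  · rw [show -p x - h x + p x = -h x by ring]
    exact neg_ne_zero.2 (hW' hx).2
  · refine sP.mono ?_
    rintro q ⟨x, hx, rfl⟩
    exact (hW' hx).1.2
  · have hxV : x ∈ V := (hW' hx).1.1
    have h1 := hsys _ (hW' hx).1.2
    rw [← hN.2 x hxV, ← hO.2 x hxV, ← hZ.2 x hxV] at h1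
    exact h1

end Existence

end Kin

theorem mainTheorem11 (U : Set Kin.Pt) (hU : IsOpen U) (g : Kin.Metric)
    (hg : Kin.IsLorentzMetric U g) (u : Kin.VField) (hu : Kin.IsUnitTimelike U g u)
    (hC : Kin.IsFlowClass U g u) :
    (Kin.IsPerfectVelocity U g u ↔
      ∀ x ∈ U, Kin.hatD g u (Kin.Om g u) x = 0 ∧
        2 * Kin.Om g u x * Kin.cb g u x + Kin.dotD u (Kin.Om g u) x = 0) ∧
    ((∀ x ∈ U, Kin.hatD g u (Kin.Om g u) x = 0 ∧
        2 * Kin.Om g u x * Kin.cb g u x + Kin.dotD u (Kin.Om g u) x = 0) →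
      ∀ x₀ ∈ U, ∀ N ∈ nhds x₀, ∃ V : Set Kin.Pt, IsOpen V ∧ x₀ ∈ V ∧ V ⊆ N ∩ U ∧
        ∃ tau alpha mu beta : Kin.Pt → ℝ,
          Kin.IsAdapted V g u tau alpha mu beta ∧
          (∃ F, Kin.RepresentedBy V tau alpha (Kin.nu g u) F) ∧
          (∃ F, Kin.RepresentedBy V tau alpha (Kin.Om g u) F) ∧
          (∃ F, Kin.RepresentedBy V tau alpha (fun x => beta x - mu x * Kin.cb g u x) F) ∧
          ∀ rho p : Kin.Pt → ℝ,
            Kin.IsPerfect V g u rho p ↔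
              (∀ x ∈ V, rho x + p x ≠ 0) ∧
              ∃ P : ℝ × ℝ → ℝ, Kin.RepresentedBy V tau alpha p P ∧
                Kin.SolvesSystem V g u tau alpha mu beta P ∧
                ∀ x ∈ V, rho x = - p x - (beta x)⁻¹ *
                  (mu x * Kin.dTau P (tau x, alpha x) + Kin.dAlpha P (tau x, alpha x))) := by
  refine ⟨⟨fun h x hx => ?_, fun h => Kin.isPerfectVelocity_of_conditions hU hg hu hC h⟩,
    fun h x₀ hx₀ N hN => ?_⟩
  · obtain ⟨V, hV, hxV, hVU, rho, p, hP⟩ := h x hx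
    exact (hP.conditions hU hg hu hC hV hVU hxV).2.2
  · obtain ⟨V, hVN, tau, alpha, mu, beta, l, S, r, C⟩ := Kin.exists_flowChart hU hg hu hC hx₀ hN
    have h' : ∀ x ∈ U, Kin.hatD g u (Kin.Om g u) x = 0 := fun x hx => (h x hx).1
    exact ⟨V, C.isOpen, C.mem, Set.subset_inter hVN C.subset, tau, alpha, mu, beta, C.isAdapted,
      C.exists_nu h', C.exists_Om h', C.exists_sigma, C.isPerfect_iff⟩
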